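/- Let $\mathbb N=\{1,2,\dots\}$ and let $c_{00}(\mathbb N)$ be the space of finitely supported real sequences; $f\in c_{00}(\mathbb N)$ acts on $x\in c_{00}(\mathbb N)$ by $f(x)=\sum_n f(n)x(n)$. For $E\subset\mathbb N$, $Ef$ is the restriction of $f$ to $E$; $f<g$ means that every element of $\operatorname{supp} f$ is smaller than every element of $\operatorname{supp} g$; a block sequence is a sequence of nonzero vectors $x_1<x_2<\cdots$. A JTG family is a sequence $(F_j)_{j\ge 0}$ of subsets of $c_{00}(\mathbb N)$ such that: (A) $F_0=\{\pm e_n^*:n\in\mathbb N\}$, and each $F_j$, $j\ge1$, is nonempty, countable, symmetric, compact in the topology of pointwise convergence and closed under restrictions of its elements to intervals of $\mathbb N$; (B) with $\tau_j=\sup\{\|f\|_\infty:f\in F_j\}$, the sequence $(\tau_j)_{j\ge0}$ is strictly decreasing and $\sum_{j\ge1}\tau_j\le1$; (C) for every block sequence $(x_k)_k$ in $c_{00}(\mathbb N)$, every $j\ge0$ and every $\delta>0$ there is $x\in\operatorname{span}\{x_k:k\in\mathbb N\}$ with $\delta\sup\{f(x):f\in\bigcup_i F_i\}>\sup\{f(x):f\in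 F_j\}$. Fix a JTG family, disjoint infinite sets $\Xi_1,\Xi_2\subset\mathbb N$, and an injective coding $\sigma:W\to\Xi_2$, where $W$ is the set of finite sequences $(f_1,\dots,f_d)$, $d\ge1$, with $f_1<\dots<f_d$ nonzero elements of $\bigcup_{j\ge1}F_j$, such that $\sigma(f_1,\dots,f_d)>k$ whenever some $f_i$ belongs to $F_k$. A finite or infinite block sequence $s=(f_i)_i$ in $\bigcup_{j\ge1}F_j\setminus\{0\}$ is special if $f_1\in\bigcup_{l\in\Xi_1}F_l$ and $f_{i+1}\in F_{\sigma(f_1,\dots,f_i)}$ for all $i$; put $\operatorname{ind}_s(f_1)=\min\{j:f_1\in F_j\}$ and $\operatorname{ind}_s(f_{i+1})=\sigma(f_1,\dots,f_i)$. Let $\mathscr S$ be the set of all finitely supported special functionals $x^*=E\sum_i f_i$ ($s=(f_i)_i$ special, $E$ an interval); the set of indices of such a representation is $\{\operatorname{ind}_s(f_i):Ef_i\ne0\}$. An element $x^*\in F_j$, $j\ge1$, is given the set of indices $\{j\}$. We say that $x_1^*,\dots,x_d^*\in\mathscr S\cup\bigcup_{j\ge1}F_j$ have pairwise disjoint indices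 if they have representations (as special functionals or as elements of some $F_j$) whose sets of indices are pairwise disjoint. Let $$\mathcal F_2=F_0\cup\Big\{\sum_{k=1}^d a_kx_k^*:\ a_k\in\mathbb Q,\ \sum_{k=1}^d a_k^2\le1,\ x_k^*\in\mathscr S\cup\bigcup_{j\ge1}F_j\text{ with pairwise disjoint indices}\Big\},$$ let $\mathcal F_{2,s}$ be defined in the same way with the additional requirement $\min\operatorname{supp}x_k^*\ge d$ for all $k\le d$, and let $$\mathcal F_s=F_0\cup\Big\{\sum_{k=1}^d\varepsilon_kx_k^*:\ \varepsilon_k\in\{-1,1\},\ x_k^*\in\mathscr S\cup\bigcup_{j\ge1}F_j\text{ with pairwise disjoint indices, }\min\operatorname{supp}x_k^*\ge d\Big\}.$$ (The condition on $\min\operatorname{supp}x_k^*$ is void when $x_k^*=0$.) For $\mathcal F_*\in\{\mathcal F_2,\mathcal F_{2,s},\mathcal F_s\}$ let $JT_{\mathcal F_*}$ be the completion of $c_{00}(\mathbb N)$ under the norm $\|x\|_{\mathcal F_*}=\sup\{f(x):f\in\mathcal F_*\}$. A Banach space $X$ is called $Z$ saturated if every infinite dimensional closed subspace of $X$ has a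 further subspace isomorphic to $Z$. **Theorem.** For every JTG family and every such coding: (i) $JT_{\mathcal F_{2,s}}$ is $c_0$ saturated; (ii) $JT_{\mathcal F_2}$ is $\ell_2$ saturated; (iii) $JT_{\mathcal F_s}$ is $c_0$ saturated. Moreover, for every infinite dimensional closed subspace $Y$ of $JT_{\mathcal F_{2,s}}$ or of $JT_{\mathcal F_s}$ (respectively of $JT_{\mathcal F_2}$) and every $\varepsilon>0$ there are a subspace $V\subset Y$ and an isomorphism $T$ of $V$ onto $c_0$ (respectively onto $\ell_2$) with $\|T\|\,\|T^{-1}\|\le1+\varepsilon$. -/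

import Mathlib

open scoped ENNReal ZeroAtInfty

noncomputable section

/-- The space `c₀₀(ℕ)` of finitely supported real sequences, indexed by `1, 2, 3, …`.  Its elements
are used both as vectors and as functionals. -/
abbrev C00 : Type := ℕ+ →₀ ℝ

namespace C00

/-- The action `f(x) = ∑ₙ f(n) x(n)` of a functional `f` on a vector `x`. -/
def pair (f x : C00) : ℝ := x.sum fun n a => f n * a

open Classical in
/-- The restriction `E f` of `f` to a set `E` of positive integers. -/
def restrict (E : Set ℕ+) (f : C00) : C00 := f.filter (· ∈ E)

/-- `f < g`: every element of the support of `f` is below every element of the support of `g`. -/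
def Before (f g : C00) : Prop := ∀ m ∈ f.support, ∀ n ∈ g.support, m < n

/-- An (infinite) block sequence: nonzero vectors with successive supports. -/
def IsBlockSequence (x : ℕ → C00) : Prop :=
  (∀ k, x k ≠ 0) ∧ ∀ k, Before (x k) (x (k + 1))

/-- `sup {f(x) : f ∈ G}`. -/
def supOn (G : Set C00) (x : C00) : ℝ := sSup ((fun f => pair f x) '' G)

/-- `sup {‖f‖_∞ : f ∈ G}`, as an extended nonnegative real. -/
def supNorm (G : Set C00) : ℝ≥0∞ := ⨆ f ∈ G, ⨆ n : ℕ+, ENNReal.ofReal |f n|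

lemma le_supNorm {G : Set C00} {f : C00} (hf : f ∈ G) (n : ℕ+) :
    ENNReal.ofReal |f n| ≤ supNorm G :=
  le_trans (le_iSup (fun n : ℕ+ => ENNReal.ofReal |f n|) n)
    (le_iSup₂ (f := fun (f : C00) (_ : f ∈ G) => ⨆ n : ℕ+, ENNReal.ofReal |f n|) f hf)

lemma pair_add (f x y : C00) : pair f (x + y) = pair f x + pair f y := by
  unfold pair
  exact Finsupp.sum_add_index' (fun _ => by simp) (fun _ _ _ => by ring)

lemma pair_smul (f : C00) (r : ℝ) (x : C00) : pair f (r • x) = r * pair f x := by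
  unfold pair
  rw [Finsupp.sum_smul_index (fun _ => by simp), Finsupp.sum, Finsupp.sum, Finset.mul_sum]
  exact Finset.sum_congr rfl fun _ _ => by ring

lemma pair_neg_left (f x : C00) : pair (-f) x = -pair f x := by
  simp [pair, Finsupp.sum, Finset.sum_neg_distrib]

lemma pair_single_left (n : ℕ+) (x : C00) : pair (Finsupp.single n 1) x = x n := by
  classical
  simp only [pair, Finsupp.sum, Finsupp.single_apply, ite_mul, one_mul, zero_mul]
  rw [Finset.sum_ite_eq x.support n]
  simp only [Finsupp.mem_support_iff, ne_eq, ite_not]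
  split_ifs with h <;> simp [h]

end C00

open C00

/-- A norming set: a symmetric set of functionals in `c₀₀(ℕ)`, bounded by one in the supremum norm,
that contains the coordinate functionals. -/
structure NormingSet where
  carrier : Set C00
  neg_mem : ∀ f ∈ carrier, -f ∈ carrier
  single_mem : ∀ n : ℕ+, Finsupp.single n 1 ∈ carrier
  abs_le_one : ∀ f ∈ carrier, ∀ n : ℕ+, |f n| ≤ 1

namespace NormingSet

variable (G : NormingSet)

lemma pair_le {f : C00} (hf : f ∈ G.carrier) (x : C00) : pair f x ≤ ∑ n ∈ x.support, |x n| := by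
  refine Finset.sum_le_sum fun n _ => ?_
  refine (le_abs_self _).trans ?_
  rw [abs_mul]
  exact mul_le_of_le_one_left (abs_nonneg _) (G.abs_le_one f hf n)

lemma bddAbove (x : C00) : BddAbove ((fun f => pair f x) '' G.carrier) := by
  refine ⟨∑ n ∈ x.support, |x n|, ?_⟩
  rintro _ ⟨f, hf, rfl⟩
  exact G.pair_le hf x

lemma pair_le_supOn {f : C00} (hf : f ∈ G.carrier) (x : C00) : pair f x ≤ supOn G.carrier x :=
  le_csSup (G.bddAbove x) ⟨f, hf, rfl⟩

lemma supOn_le {x : C00} {c : ℝ} (h : ∀ f ∈ G.carrier, pair f x ≤ c) : supOn G.carrier x ≤ c := by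
  refine csSup_le ⟨_, _, G.single_mem 1, rfl⟩ ?_
  rintro _ ⟨f, hf, rfl⟩
  exact h f hf

lemma abs_pair_le_supOn {f : C00} (hf : f ∈ G.carrier) (x : C00) :
    |pair f x| ≤ supOn G.carrier x := by
  refine abs_le'.2 ⟨G.pair_le_supOn hf x, ?_⟩
  rw [← pair_neg_left]
  exact G.pair_le_supOn (G.neg_mem f hf) x

/-- The space `c₀₀(ℕ)`, to be normed by `‖x‖ = sup {f(x) : f ∈ G}`. -/
def Pre (_ : NormingSet) : Type := C00

instance : AddCommGroup G.Pre := inferInstanceAs (AddCommGroup C00)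

instance : Module ℝ G.Pre := inferInstanceAs (Module ℝ C00)

instance : Norm G.Pre := ⟨fun x => supOn G.carrier x⟩

lemma norm_def (x : G.Pre) : ‖x‖ = supOn G.carrier x := rfl

lemma core : NormedSpace.Core ℝ G.Pre where
  norm_nonneg x := (abs_nonneg _).trans (G.abs_pair_le_supOn (G.single_mem 1) x)
  norm_smul c x := by
    have key : ∀ (c : ℝ) (x : C00), supOn G.carrier (c • x) ≤ |c| * supOn G.carrier x := by
      intro c x
      refine G.supOn_le fun f hf => ?_
      rw [pair_smul]
      refine (le_abs_self _).trans ?_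
      rw [abs_mul]
      exact mul_le_mul_of_nonneg_left (G.abs_pair_le_supOn hf x) (abs_nonneg _)
    refine le_antisymm (key c x) ?_
    rcases eq_or_ne c 0 with rfl | hc
    · rw [norm_zero, zero_mul]
      exact (abs_nonneg _).trans (G.abs_pair_le_supOn (G.single_mem 1) _)
    · have h := key c⁻¹ (c • (show C00 from x))
      rw [smul_smul (M := ℝ) (α := C00), inv_mul_cancel₀ hc, one_smul, abs_inv, inv_mul_eq_div,
        le_div_iff₀ (abs_pos.2 hc), mul_comm] at h
      exact h
  norm_triangle x y := by
    refine G.supOn_le fun f hf => ?_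
    refine (pair_add f x y).le.trans ?_
    exact add_le_add (G.pair_le_supOn hf x) (G.pair_le_supOn hf y)
  norm_eq_zero_iff x := by
    constructor
    · intro h
      refine Finsupp.ext fun n => ?_
      have h1 := G.abs_pair_le_supOn (G.single_mem n) x
      rw [← norm_def, h] at h1
      exact (pair_single_left n x).symm.trans (abs_nonpos_iff.1 h1)
    · rintro rfl
      refine le_antisymm (G.supOn_le fun f _ => ?_)
        ((abs_nonneg _).trans (G.abs_pair_le_supOn (G.single_mem 1) _))
      exact (Finsupp.sum_zero_index).le

instance : NormedAddCommGroup G.Pre := NormedAddCommGroup.ofCore G.core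

instance : NormedSpace ℝ G.Pre := NormedSpace.ofCore G.core

/-- The completion of `c₀₀(ℕ)` in the norm `‖x‖ = sup {f(x) : f ∈ G}`. -/
abbrev Completed : Type := UniformSpace.Completion G.Pre

end NormingSet

/-- A James Tree Generating (JTG) family `(F_j)_{j ≥ 0}` of subsets of `c₀₀(ℕ)`. -/
structure JTGFamily where
  F : ℕ → Set C00
  F_zero : F 0 = {f | ∃ n : ℕ+, f = Finsupp.single n 1 ∨ f = Finsupp.single n (-1)}
  nonempty : ∀ j, 1 ≤ j → (F j).Nonempty
  countable : ∀ j, 1 ≤ j → (F j).Countable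
  symm : ∀ j, 1 ≤ j → ∀ f ∈ F j, -f ∈ F j
  /-- compactness in the topology of pointwise convergence -/
  compact : ∀ j, 1 ≤ j → IsCompact ((fun (f : C00) (n : ℕ+) => f n) '' F j)
  restrict_mem : ∀ j, 1 ≤ j → ∀ f ∈ F j, ∀ E : Set ℕ+, E.OrdConnected → restrict E f ∈ F j
  tau_strictAnti : StrictAnti fun j => supNorm (F j)
  tau_sum : ∑' j : ℕ, supNorm (F (j + 1)) ≤ 1
  /-- no `‖·‖_{F_j}` dominates a multiple of `‖·‖_F`, `F = ⋃ F_i`, on the span of a block sequence -/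
  strictlySingular : ∀ x : ℕ → C00, IsBlockSequence x → ∀ j : ℕ, ∀ δ : ℝ, 0 < δ →
    ∃ y ∈ Submodule.span ℝ (Set.range x), supOn (F j) y < δ * supOn (⋃ i, F i) y

namespace JTGFamily

variable (𝓕 : JTGFamily)

/-- The set `W` of (nonempty) finite sequences `f₁ < ⋯ < f_d` of nonzero elements of
`⋃_{j ≥ 1} F_j`. -/
def W : Set (List C00) :=
  {l | l ≠ [] ∧ (∀ f ∈ l, f ≠ 0 ∧ ∃ j, 1 ≤ j ∧ f ∈ 𝓕.F j) ∧ l.Pairwise Before}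

/-- A pair `Ξ₁, Ξ₂` of disjoint infinite sets of positive integers with a coding
`σ : W → Ξ₂`; the values of `σ` outside `W` play no role. -/
structure Coding where
  Ξ₁ : Set ℕ
  Ξ₂ : Set ℕ
  infinite₁ : Ξ₁.Infinite
  infinite₂ : Ξ₂.Infinite
  disjoint : Disjoint Ξ₁ Ξ₂
  pos₁ : ∀ j ∈ Ξ₁, 1 ≤ j
  pos₂ : ∀ j ∈ Ξ₂, 1 ≤ j
  σ : List C00 → ℕ
  σ_mem : ∀ l ∈ 𝓕.W, σ l ∈ Ξ₂
  σ_injOn : Set.InjOn σ 𝓕.W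
  σ_gt : ∀ l ∈ 𝓕.W, ∀ f ∈ l, ∀ k, f ∈ 𝓕.F k → k < σ l

namespace Coding

variable {𝓕} (c : 𝓕.Coding)

/-- Finite special sequences `(f₁, …, f_d)`: `f₁ ∈ F_j` for some `j ∈ Ξ₁`, and
`f_{i+1} ∈ F_{σ(f₁, …, f_i)}`. (Initial segments of infinite special sequences are of this kind.) -/
def IsSpecial (l : List C00) : Prop :=
  l ∈ 𝓕.W ∧ (∃ j ∈ c.Ξ₁, ∃ f ∈ l.head?, f ∈ 𝓕.F j) ∧
    ∀ i : Fin l.length, i.1 ≠ 0 → l.get i ∈ 𝓕.F (c.σ (l.take i))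

/-- The index of the `i`-th term in the special sequence `l`: `min {j : f₁ ∈ F_j}` for the first
term, `σ(f₁, …, f_i)` for the term `f_{i+1}`. -/
def termIndex (l : List C00) (i : Fin l.length) : ℕ :=
  if i.1 = 0 then sInf {j | l.get i ∈ 𝓕.F j} else c.σ (l.take i)

/-- `c.HasIndex x I`: either `x = E ∑ fᵢ` is a finitely supported special functional, given by a
special sequence `(fᵢ)` and an interval `E` for which `I` is the set of indices of the terms with
`E fᵢ ≠ 0`, or `x` is an element of some `F_j`, `j ≥ 1`, and `I = {j}`. -/
def HasIndex (x : C00) (I : Set ℕ) : Prop :=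
  (∃ (l : List C00) (E : Set ℕ+), c.IsSpecial l ∧ E.OrdConnected ∧ x = restrict E l.sum ∧
      I = {j | ∃ i : Fin l.length, restrict E (l.get i) ≠ 0 ∧ j = c.termIndex l i}) ∨
    ∃ j, 1 ≤ j ∧ x ∈ 𝓕.F j ∧ I = {j}

/-- `x₁, …, x_d` are elements of `𝒮 ∪ ⋃_{j ≥ 1} F_j` with pairwise disjoint sets of indices. -/
def DisjointFamily {d : ℕ} (x : Fin d → C00) : Prop :=
  ∃ I : Fin d → Set ℕ, (∀ k, c.HasIndex (x k) (I k)) ∧ Pairwise fun k m => Disjoint (I k) (I m)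

/-- The set `𝓕₂`. -/
def F₂ : Set C00 :=
  𝓕.F 0 ∪ {f | ∃ (d : ℕ) (a : Fin d → ℚ) (x : Fin d → C00), ∑ k, a k ^ 2 ≤ 1 ∧
    c.DisjointFamily x ∧ f = ∑ k, (a k : ℝ) • x k}

/-- The set `𝓕_{2,s}`. -/
def F₂ₛ : Set C00 :=
  𝓕.F 0 ∪ {f | ∃ (d : ℕ) (a : Fin d → ℚ) (x : Fin d → C00), ∑ k, a k ^ 2 ≤ 1 ∧
    c.DisjointFamily x ∧ (∀ k, ∀ n ∈ (x k).support, d ≤ (n : ℕ)) ∧ f = ∑ k, (a k : ℝ) • x k}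

/-- The set `𝓕_s`. -/
def Fₛ : Set C00 :=
  𝓕.F 0 ∪ {f | ∃ (d : ℕ) (ε : Fin d → ℝ) (x : Fin d → C00), (∀ k, ε k = 1 ∨ ε k = -1) ∧
    c.DisjointFamily x ∧ (∀ k, ∀ n ∈ (x k).support, d ≤ (n : ℕ)) ∧ f = ∑ k, ε k • x k}

section Bounds

lemma list_sum_apply_ne_zero {n : ℕ+} : ∀ l : List C00, l.Pairwise Before → l.sum n ≠ 0 →
    ∃ i : Fin l.length, l.sum n = l.get i n
  | [], _, h => by simp at h
  | f :: l, hl, h => by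
    rw [List.pairwise_cons] at hl
    by_cases hl0 : l.sum n = 0
    · refine ⟨⟨0, by simp⟩, ?_⟩
      simp [hl0]
    · obtain ⟨i, hi⟩ := list_sum_apply_ne_zero l hl.2 hl0
      refine ⟨⟨i.1 + 1, by simp⟩, ?_⟩
      have hf : f n = 0 := by
        by_contra hf
        have := hl.1 (l.get i) (l.get_mem i) n (by simpa using hf) n
          (by rw [Finsupp.mem_support_iff, ← hi]; exact hl0)
        exact lt_irrefl _ this
      simpa [hf] using hi

lemma HasIndex.bound {x : C00} {I : Set ℕ} (h : c.HasIndex x I) {n : ℕ+} (hn : x n ≠ 0) :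
    ∃ j, j + 1 ∈ I ∧ ENNReal.ofReal |x n| ≤ supNorm (𝓕.F (j + 1)) := by
  suffices H : ∃ j, 1 ≤ j ∧ j ∈ I ∧ x n ≠ 0 ∧ ENNReal.ofReal |x n| ≤ supNorm (𝓕.F j) by
    obtain ⟨j, h1, h2, -, h3⟩ := H
    obtain ⟨k, rfl⟩ := Nat.exists_eq_add_of_le' h1
    exact ⟨k, h2, h3⟩
  rcases h with ⟨l, E, hl, -, rfl, rfl⟩ | ⟨j, hj, hx, rfl⟩
  · have hE : n ∈ E := by
      by_contra hE
      exact hn (by simp [restrict, hE])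
    have hx : restrict E l.sum n = l.sum n := by simp [restrict, hE]
    obtain ⟨i, hi⟩ := list_sum_apply_ne_zero l hl.1.2.2 (hx ▸ hn)
    have hin : l.get i n ≠ 0 := by rw [← hi, ← hx]; exact hn
    refine ⟨c.termIndex l i, ?_, ⟨i, ?_, rfl⟩, hn, ?_⟩
    · unfold termIndex
      split_ifs with h0
      · by_contra hlt
        obtain ⟨-, j, hj, hij⟩ := hl.1.2.1 _ (l.get_mem i)
        have hmem := Nat.sInf_mem (s := {j | l.get i ∈ 𝓕.F j}) ⟨j, hij⟩
        have hz : sInf {j | l.get i ∈ 𝓕.F j} = 0 := by omega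
        rw [hz, Set.mem_ofPred_eq, 𝓕.F_zero] at hmem
        obtain ⟨m, hm⟩ := hmem
        have h1 : |l.get i m| = 1 := by rcases hm with hm | hm <;> rw [hm] <;> simp
        have h2 := le_supNorm hij m
        rw [h1] at h2
        have h3 : supNorm (𝓕.F 0) ≤ 1 := by
          refine iSup₂_le fun f hf => iSup_le fun p => ?_
          rw [𝓕.F_zero] at hf
          classical
          obtain ⟨q, rfl | rfl⟩ := hf <;>
          · rw [Finsupp.single_apply]
            split_ifs <;> simp
        have h4 := 𝓕.tau_strictAnti (show 0 < j by omega)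
        simp only [ENNReal.ofReal_one] at h2
        exact absurd (h2.trans_lt h4) (not_lt.2 h3)
      · refine c.pos₂ _ (c.σ_mem _ ⟨?_, fun f hf => hl.1.2.1 f (List.mem_of_mem_take hf), ?_⟩)
        · intro h
          rw [List.take_eq_nil_iff] at h
          rcases h with h | h
          · exact h0 h
          · exact hl.1.1 h
        · exact hl.1.2.2.sublist (List.take_sublist _ _)
    · intro h
      have := DFunLike.congr_fun h n
      simp [restrict, hE] at this
      exact hin this
    · rw [hx, hi]
      refine le_supNorm ?_ n
      unfold termIndex
      split_ifs with h0
      · obtain ⟨-, j, hj, hij⟩ := hl.1.2.1 _ (l.get_mem i)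
        exact Nat.sInf_mem (s := {j | l.get i ∈ 𝓕.F j}) ⟨j, hij⟩
      · exact hl.2.2 i h0
  · exact ⟨j, hj, rfl, hn, le_supNorm hx n⟩

lemma DisjointFamily.sum_le_one {d : ℕ} {x : Fin d → C00} (h : c.DisjointFamily x) (n : ℕ+) :
    ∑ k, |x k n| ≤ 1 := by
  classical
  obtain ⟨I, hI, hd⟩ := h
  have H : ∀ k, ∃ j, x k n ≠ 0 → j + 1 ∈ I k ∧ ENNReal.ofReal |x k n| ≤ supNorm (𝓕.F (j + 1)) := by
    intro k
    by_cases hk : x k n = 0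
    · exact ⟨0, fun h => absurd hk h⟩
    · obtain ⟨j, hj⟩ := HasIndex.bound c (hI k) hk
      exact ⟨j, fun _ => hj⟩
  choose j hj using H
  have h0 : ∑ k, |x k n| = ∑ k with x k n ≠ 0, |x k n| := by
    rw [Finset.sum_filter]
    refine Finset.sum_congr rfl fun k _ => ?_
    split_ifs with h
    · rfl
    · simpa using h
  have hinj : Set.InjOn j ({k | x k n ≠ 0} : Finset (Fin d)) := by
    intro k hk m hm hkm
    by_contra hne
    have hk' := (hj k (by simpa using hk)).1
    have hm' := (hj m (by simpa using hm)).1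
    rw [← hkm] at hm'
    exact Set.disjoint_left.1 (hd hne) hk' hm'
  have h1 : ENNReal.ofReal (∑ k, |x k n|) ≤ 1 := by
    rw [h0, ENNReal.ofReal_sum_of_nonneg fun _ _ => abs_nonneg _]
    calc ∑ k with x k n ≠ 0, ENNReal.ofReal |x k n|
        ≤ ∑ k with x k n ≠ 0, supNorm (𝓕.F (j k + 1)) :=
          Finset.sum_le_sum fun k hk => (hj k (by simpa using hk)).2
      _ = ∑ m ∈ Finset.image j {k | x k n ≠ 0}, supNorm (𝓕.F (m + 1)) :=
          (Finset.sum_image (f := fun m => supNorm (𝓕.F (m + 1))) hinj).symm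
      _ ≤ ∑' m, supNorm (𝓕.F (m + 1)) := ENNReal.sum_le_tsum _
      _ ≤ 1 := 𝓕.tau_sum
  simpa using h1

lemma abs_sum_le_one {d : ℕ} {x : Fin d → C00} (h : c.DisjointFamily x) (a : Fin d → ℝ)
    (ha : ∀ k, |a k| ≤ 1) (n : ℕ+) : |(∑ k, a k • x k : C00) n| ≤ 1 := by
  rw [Finsupp.finsetSum_apply]
  refine (Finset.abs_sum_le_sum_abs _ _).trans (le_trans ?_ (DisjointFamily.sum_le_one c h n))
  refine Finset.sum_le_sum fun k _ => ?_
  rw [Finsupp.smul_apply, smul_eq_mul, abs_mul]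
  exact mul_le_of_le_one_left (abs_nonneg _) (ha k)

lemma abs_coeff_le_one {d : ℕ} {a : Fin d → ℚ} (h : ∑ k, a k ^ 2 ≤ 1) (k : Fin d) :
    |(a k : ℝ)| ≤ 1 := by
  have h1 : a k ^ 2 ≤ 1 :=
    (Finset.single_le_sum (f := fun k => a k ^ 2) (fun _ _ => sq_nonneg _)
      (Finset.mem_univ k)).trans h
  have h2 : (a k : ℝ) ^ 2 ≤ 1 := by exact_mod_cast h1
  exact (sq_le_one_iff_abs_le_one _).1 h2

lemma F_zero_neg {f : C00} (hf : f ∈ 𝓕.F 0) : -f ∈ 𝓕.F 0 := by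
  rw [𝓕.F_zero] at hf ⊢
  obtain ⟨n, rfl | rfl⟩ := hf
  · exact ⟨n, Or.inr (by rw [Finsupp.single_neg])⟩
  · exact ⟨n, Or.inl (by rw [Finsupp.single_neg, neg_neg])⟩

lemma F_zero_abs {f : C00} (hf : f ∈ 𝓕.F 0) (m : ℕ+) : |f m| ≤ 1 := by
  classical
  rw [𝓕.F_zero] at hf
  obtain ⟨n, rfl | rfl⟩ := hf <;>
  · rw [Finsupp.single_apply]
    split_ifs <;> simp

lemma single_mem_F_zero (n : ℕ+) : Finsupp.single n 1 ∈ 𝓕.F 0 := by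
  rw [𝓕.F_zero]
  exact ⟨n, Or.inl rfl⟩

end Bounds

/-- `𝓕₂` as a norming set. -/
def norming₂ : NormingSet where
  carrier := c.F₂
  neg_mem := by
    rintro f (hf | ⟨d, a, x, ha, hx, rfl⟩)
    · exact Or.inl (F_zero_neg hf)
    · exact Or.inr ⟨d, fun k => -a k, x, by simpa using ha, hx, by simp [Finset.sum_neg_distrib]⟩
  single_mem n := Or.inl (single_mem_F_zero n)
  abs_le_one := by
    rintro f (hf | ⟨d, a, x, ha, hx, rfl⟩) n
    · exact F_zero_abs hf n
    · exact c.abs_sum_le_one hx _ (abs_coeff_le_one ha) n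

/-- `𝓕_{2,s}` as a norming set. -/
def norming₂ₛ : NormingSet where
  carrier := c.F₂ₛ
  neg_mem := by
    rintro f (hf | ⟨d, a, x, ha, hx, hd, rfl⟩)
    · exact Or.inl (F_zero_neg hf)
    · exact Or.inr ⟨d, fun k => -a k, x, by simpa using ha, hx, hd,
        by simp [Finset.sum_neg_distrib]⟩
  single_mem n := Or.inl (single_mem_F_zero n)
  abs_le_one := by
    rintro f (hf | ⟨d, a, x, ha, hx, -, rfl⟩) n
    · exact F_zero_abs hf n
    · exact c.abs_sum_le_one hx _ (abs_coeff_le_one ha) n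

/-- `𝓕_s` as a norming set. -/
def normingₛ : NormingSet where
  carrier := c.Fₛ
  neg_mem := by
    rintro f (hf | ⟨d, ε, x, hε, hx, hd, rfl⟩)
    · exact Or.inl (F_zero_neg hf)
    · refine Or.inr ⟨d, fun k => -ε k, x, fun k => ?_, hx, hd, by simp [Finset.sum_neg_distrib]⟩
      rcases hε k with h | h <;> simp [h]
  single_mem n := Or.inl (single_mem_F_zero n)
  abs_le_one := by
    rintro f (hf | ⟨d, ε, x, hε, hx, -, rfl⟩) n
    · exact F_zero_abs hf n
    · refine c.abs_sum_le_one hx _ (fun k => ?_) n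
      rcases hε k with h | h <;> simp [h]

/-- The James tree space `JT_{𝓕₂}`. -/
abbrev JT₂ : Type := c.norming₂.Completed

/-- The James tree space `JT_{𝓕_{2,s}}`. -/
abbrev JT₂ₛ : Type := c.norming₂ₛ.Completed

/-- The James tree space `JT_{𝓕_s}`. -/
abbrev JTₛ : Type := c.normingₛ.Completed

end Coding

end JTGFamily

/-- The Banach space `X` is `Z` saturated: every infinite dimensional closed subspace of `X` has a
further subspace isomorphic to `Z`. -/
def IsSaturatedBy (X Z : Type*) [NormedAddCommGroup X] [NormedSpace ℝ X] [NormedAddCommGroup Z]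
    [NormedSpace ℝ Z] : Prop :=
  ∀ Y : Submodule ℝ X, IsClosed (Y : Set X) → ¬ FiniteDimensional ℝ Y →
    ∃ V : Submodule ℝ X, V ≤ Y ∧ Nonempty (V ≃L[ℝ] Z)

/-- For every `ε > 0`, every infinite dimensional closed subspace of `X` has a further subspace that
is `(1 + ε)`-isomorphic to `Z`. -/
def IsAlmostIsometricallySaturatedBy (X Z : Type*) [NormedAddCommGroup X] [NormedSpace ℝ X]
    [NormedAddCommGroup Z] [NormedSpace ℝ Z] : Prop :=
  ∀ Y : Submodule ℝ X, IsClosed (Y : Set X) → ¬ FiniteDimensional ℝ Y → ∀ ε : ℝ, 0 < ε →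
    ∃ V : Submodule ℝ X, V ≤ Y ∧
      ∃ T : V ≃L[ℝ] Z, ‖(T : V →L[ℝ] Z)‖ * ‖(T.symm : Z →L[ℝ] V)‖ ≤ 1 + ε

/-- The space `ℓ₂` of square summable real sequences. -/
abbrev EllTwo : Type := lp (fun _ : ℕ => ℝ) 2

/-- The space `c₀` of real null sequences with the supremum norm. -/
abbrev CZero : Type := C₀(ℕ, ℝ)

end

/-!
The point is to find, in the span of any block sequence, vectors that are negligible for every
single special functional and every `F_j` although their norm is one
(`exists_mem_span_nrm_normingS_lt`). On such vectors only combinations of many functionals matter,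
and those combinations are modelled on `ℓ₂` for `𝓕₂`, and on `c₀` for the two families with a
condition on supports.

Suppose that on the span of a block sequence a multiple of `‖·‖_𝒮`, the supremum over `F₀` and `𝒮 ∪
⋃ F_j`, dominates the norm of `𝓕_{2,s}`. The strict singularity axiom, applied successively to
finitely many indices, together with the summability of `(τ_j)` gives a `‖·‖_𝒮`-normalized block
sequence `(y_k)` in the span for which `y_k` is almost only seen by the functionals with indices in
a window `(p_k, q_k]`, for successive windows (`exists_isWindowed`). Bessel's inequality for
functionals with disjoint indices has two consequences.

* A sum of `n` signed terms has norm at least `√n / 4` (`IsWindowed.card_div_le_nrm_sq`).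
* At most a fixed number `D` of special sequences with pairwise disjoint indices above `p_k` take a
  value `≥ δ` on `y_k`. Since the coding is injective, a special sequence that shares an index with
  one of them has the same past, so on the earlier terms it is almost equal to one of `D` given
  functionals (`exists_finite_histories`).

Passing to limits along an ultrafilter, one finds a subsequence on which these `D` functionals are
almost constant: for every special sequence, all terms before the last one that it sees have nearly
the same value. Hence alternating sums of the subsequence are bounded in `‖·‖_𝒮`
(`abs_alternating_sum_le`, `nrm_normingS_le`), which contradicts the lower estimate `√n / 4`.

A gliding hump then puts, near any infinite dimensional subspace, normalized block sequences `(u_k)`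
with `‖u_k‖_𝒮` as small as desired in terms of the earlier terms (`exists_glidingHump`). For the
families with the condition on supports, a functional with `d` pieces vanishes on the terms
supported before `d`, and after the first remaining term its `d` pieces are negligible, whence the
`c₀` estimate (`IsHump.nrm_sum_le_of_abs_le`). For `𝓕₂`, each piece of a functional is counted at
the first `u_k` that its indices reach; the pieces counted earlier are few and hence negligible on
`u_k`, so the functional acts as an element of the unit ball of `ℓ₂`
(`IsHump.exists_ell_two_bound`), and norming functionals of the single terms combine to the
converse estimate (`IsHump.sqrt_le_nrm_sum`).
-/

noncomputable section

open C00 Finset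

/-! ### Finitely supported sequences, blocks and the norms they carry -/

namespace C00

/-- The `ℓ₁` norm of a finitely supported sequence. -/
def l1 (x : C00) : ℝ := ∑ n ∈ x.support, |x n|

lemma l1_nonneg (x : C00) : 0 ≤ l1 x := sum_nonneg fun _ _ => abs_nonneg _

lemma pair_eq_sum (f x : C00) {s : Finset ℕ+} (hs : x.support ⊆ s) :
    pair f x = ∑ n ∈ s, f n * x n :=
  Finsupp.sum_of_support_subset x hs _ fun _ _ => by simp

lemma pair_comm (f x : C00) : pair f x = pair x f := by
  classical
  rw [pair_eq_sum f x (subset_union_right (s₁ := f.support)),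
    pair_eq_sum x f (subset_union_left (s₂ := x.support))]
  exact sum_congr rfl fun _ _ => mul_comm _ _

/-- The functional `x ↦ f(x)` as a linear map. -/
def pairR (f : C00) : C00 →ₗ[ℝ] ℝ where
  toFun x := pair f x
  map_add' := pair_add f
  map_smul' := pair_smul f

lemma pair_zero (f : C00) : pair f 0 = 0 := (pairR f).map_zero

lemma pair_sum {ι : Type*} (f : C00) (s : Finset ι) (x : ι → C00) :
    pair f (∑ i ∈ s, x i) = ∑ i ∈ s, pair f (x i) := map_sum (pairR f) x s

lemma pair_add_left (f g x : C00) : pair (f + g) x = pair f x + pair g x := by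
  simp only [pair_comm _ x, pair_add]

lemma pair_sub_left (f g x : C00) : pair (f - g) x = pair f x - pair g x := by
  simp only [pair_comm _ x]
  exact (pairR x).map_sub f g

lemma pair_smul_left (r : ℝ) (f x : C00) : pair (r • f) x = r * pair f x := by
  simp only [pair_comm _ x, pair_smul]

lemma pair_sum_left {ι : Type*} (s : Finset ι) (f : ι → C00) (x : C00) :
    pair (∑ i ∈ s, f i) x = ∑ i ∈ s, pair (f i) x := by
  simp only [pair_comm _ x, pair_sum]

lemma pair_zero_left (x : C00) : pair 0 x = 0 := by rw [pair_comm, pair_zero]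

lemma abs_pair_le_mul_l1 {f x : C00} {t : ℝ} (h : ∀ n ∈ x.support, |f n| ≤ t) :
    |pair f x| ≤ t * l1 x := by
  rw [pair_eq_sum f x subset_rfl, l1, mul_sum]
  refine (abs_sum_le_sum_abs _ _).trans (sum_le_sum fun n hn => ?_)
  rw [abs_mul]
  exact mul_le_mul_of_nonneg_right (h n hn) (abs_nonneg _)

lemma pair_eq_zero {f x : C00} (h : ∀ n ∈ x.support, f n = 0) : pair f x = 0 := by
  rw [pair_eq_sum f x subset_rfl]
  exact sum_eq_zero fun n hn => by rw [h n hn, zero_mul]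

lemma restrict_of_mem {E : Set ℕ+} {n : ℕ+} (hn : n ∈ E) (f : C00) : restrict E f n = f n := by
  simp [restrict, hn]

lemma restrict_of_notMem {E : Set ℕ+} {n : ℕ+} (hn : n ∉ E) (f : C00) : restrict E f n = 0 := by
  simp [restrict, hn]

open Classical in
lemma restrict_apply (E : Set ℕ+) (f : C00) (n : ℕ+) :
    restrict E f n = if n ∈ E then f n else 0 := by
  split_ifs with h
  exacts [restrict_of_mem h f, restrict_of_notMem h f]

/-- Restriction to a set as a linear map. -/
def restrictL (E : Set ℕ+) : C00 →ₗ[ℝ] C00 where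
  toFun := restrict E
  map_add' f g := by ext n; by_cases h : n ∈ E <;> simp [restrict_apply, h]
  map_smul' r f := by ext n; by_cases h : n ∈ E <;> simp [restrict_apply, h]

lemma restrict_zero (E : Set ℕ+) : restrict E 0 = 0 := (restrictL E).map_zero

lemma restrict_add (E : Set ℕ+) (f g : C00) : restrict E (f + g) = restrict E f + restrict E g :=
  (restrictL E).map_add f g

lemma restrict_smul (E : Set ℕ+) (r : ℝ) (f : C00) : restrict E (r • f) = r • restrict E f :=
  (restrictL E).map_smul r f

lemma restrict_sum {ι : Type*} (E : Set ℕ+) (s : Finset ι) (f : ι → C00) :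
    restrict E (∑ i ∈ s, f i) = ∑ i ∈ s, restrict E (f i) := map_sum (restrictL E) f s

lemma restrict_list_sum (E : Set ℕ+) (l : List C00) :
    restrict E l.sum = (l.map (restrict E)).sum := map_list_sum (restrictL E) l

lemma restrict_restrict (E E' : Set ℕ+) (f : C00) :
    restrict E (restrict E' f) = restrict (E ∩ E') f := by
  ext n
  by_cases h : n ∈ E <;> by_cases h' : n ∈ E' <;> simp [restrict_apply, h, h']

lemma mem_support_restrict {E : Set ℕ+} {f : C00} {n : ℕ+} :
    n ∈ (restrict E f).support ↔ n ∈ E ∧ n ∈ f.support := by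
  by_cases h : n ∈ E <;> simp [restrict_apply, h]

lemma restrict_eq_self {E : Set ℕ+} {f : C00} (h : ∀ n ∈ f.support, n ∈ E) :
    restrict E f = f := by
  ext n
  by_cases hn : n ∈ E
  · exact restrict_of_mem hn f
  · rw [restrict_of_notMem hn]
    by_contra hf
    exact hn (h n (Finsupp.mem_support_iff.2 (Ne.symm hf)))

lemma restrict_eq_zero {E : Set ℕ+} {f : C00} (h : ∀ n ∈ f.support, n ∉ E) :
    restrict E f = 0 := by
  ext n
  by_cases hn : n ∈ E
  · rw [restrict_of_mem hn]
    by_contra hf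
    exact h n (Finsupp.mem_support_iff.2 hf) hn
  · exact restrict_of_notMem hn f

lemma restrict_univ (f : C00) : restrict Set.univ f = f := restrict_eq_self fun _ _ => trivial

lemma pair_restrict (E : Set ℕ+) (f x : C00) : pair (restrict E f) x = pair f (restrict E x) := by
  rw [pair_eq_sum _ x subset_rfl, pair_eq_sum f (restrict E x) (s := x.support)
    fun n hn => (mem_support_restrict.1 hn).2]
  refine sum_congr rfl fun n _ => ?_
  by_cases h : n ∈ E <;> simp [restrict_apply, h]

lemma pair_restrict_of_subset {E : Set ℕ+} {x : C00} (h : ∀ n ∈ x.support, n ∈ E) (f : C00) :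
    pair (restrict E f) x = pair f x := by
  rw [pair_restrict, restrict_eq_self h]

/-- The smallest interval that contains the support. -/
def hull (x : C00) : Set ℕ+ := {n | ∃ a ∈ x.support, ∃ b ∈ x.support, a ≤ n ∧ n ≤ b}

lemma subset_hull (x : C00) : ∀ n ∈ x.support, n ∈ hull x :=
  fun n hn => ⟨n, hn, n, hn, le_rfl, le_rfl⟩

lemma ordConnected_hull (x : C00) : (hull x).OrdConnected := by
  refine ⟨?_⟩
  rintro m ⟨a, ha, b, -, h1, -⟩ n ⟨-, -, b', hb', -, h4⟩ k ⟨hk1, hk2⟩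
  exact ⟨a, ha, b', hb', h1.trans hk1, hk2.trans h4⟩

lemma Before.notMem_hull {x y : C00} (h : Before x y) : ∀ n ∈ x.support, n ∉ hull y := by
  rintro n hn ⟨a, ha, -, -, h1, -⟩
  exact absurd (h n hn a ha) (not_lt.2 h1)

lemma Before.notMem_hull' {x y : C00} (h : Before x y) : ∀ n ∈ y.support, n ∉ hull x := by
  rintro n hn ⟨-, -, b, hb, -, h1⟩
  exact absurd (h b hb n hn) (not_lt.2 h1)

lemma exists_support_le (x : C00) : ∃ N : ℕ, ∀ n ∈ x.support, (n : ℕ) ≤ N :=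
  ⟨x.support.sup (fun n => (n : ℕ)), fun _ hn => Finset.le_sup (f := fun n : ℕ+ => (n : ℕ)) hn⟩

lemma exists_mem_support {x : C00} (h : x ≠ 0) : ∃ n, n ∈ x.support :=
  Finsupp.support_nonempty_iff.2 h

lemma Before.trans {x y z : C00} (hxy : Before x y) (hyz : Before y z) (hy : y ≠ 0) :
    Before x z := by
  obtain ⟨p, hp⟩ := exists_mem_support hy
  exact fun m hm n hn => (hxy m hm p hp).trans (hyz p hp n hn)

namespace IsBlockSequence

variable {x : ℕ → C00}

lemma before (h : IsBlockSequence x) {k m : ℕ} (hkm : k < m) : Before (x k) (x m) := by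
  induction m, hkm using Nat.le_induction with
  | base => exact h.2 k
  | succ m _ ih => exact ih.trans (h.2 m) (h.1 m)

lemma lt_of_mem_support (h : IsBlockSequence x) (k : ℕ) {n : ℕ+} (hn : n ∈ (x k).support) :
    k < (n : ℕ) := by
  induction k generalizing n with
  | zero => exact n.pos
  | succ k ih =>
    obtain ⟨m, hm⟩ := exists_mem_support (h.1 k)
    have h1 := ih hm
    have h2 : (m : ℕ) < n := h.2 k m hm n hn
    omega

lemma tail (h : IsBlockSequence x) (n : ℕ) : IsBlockSequence fun k => x (k + n) :=
  ⟨fun k => h.1 _, fun k => by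
    have := h.2 (k + n)
    rwa [show k + n + 1 = k + 1 + n by ring] at this⟩

lemma comp (h : IsBlockSequence x) {φ : ℕ → ℕ} (hφ : StrictMono φ) :
    IsBlockSequence (x ∘ φ) :=
  ⟨fun _ => h.1 _, fun k => h.before (hφ k.lt_succ_self)⟩

/-- Restriction to the range of `x m` picks out the `m`-th term of a combination. -/
lemma restrict_hull (h : IsBlockSequence x) (s : Finset ℕ) (a : ℕ → ℝ) {m : ℕ} (hm : m ∈ s) :
    restrict (hull (x m)) (∑ k ∈ s, a k • x k) = a m • x m := by
  rw [restrict_sum, sum_eq_single_of_mem m hm]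
  · rw [restrict_smul, restrict_eq_self (subset_hull _)]
  · intro k _ hk
    rw [restrict_smul, restrict_eq_zero, smul_zero]
    rcases lt_or_gt_of_ne hk with hk | hk
    · exact (h.before hk).notMem_hull
    · exact (h.before hk).notMem_hull'

lemma sum_ne_zero (h : IsBlockSequence x) (s : Finset ℕ) (a : ℕ → ℝ) {m : ℕ} (hm : m ∈ s)
    (ha : a m ≠ 0) : ∑ k ∈ s, a k • x k ≠ 0 := by
  intro h0
  have := h.restrict_hull s a hm
  rw [h0, restrict_zero] at this
  exact smul_ne_zero ha (h.1 m) this.symm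

end IsBlockSequence

lemma support_gt_of_mem_span {x : ℕ → C00} {N : ℕ} (h : ∀ k, ∀ n ∈ (x k).support, N < (n : ℕ))
    {y : C00} (hy : y ∈ Submodule.span ℝ (Set.range x)) : ∀ n ∈ y.support, N < (n : ℕ) := by
  intro n hn
  by_contra hlt
  have hle : Submodule.span ℝ (Set.range x) ≤ LinearMap.ker (Finsupp.lapply n : C00 →ₗ[ℝ] ℝ) := by
    rw [Submodule.span_le]
    rintro _ ⟨k, rfl⟩
    rw [SetLike.mem_coe, LinearMap.mem_ker, Finsupp.lapply_apply]
    by_contra hk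
    exact hlt (h k n (Finsupp.mem_support_iff.2 hk))
  exact Finsupp.mem_support_iff.1 hn (hle hy)

lemma exists_sum_of_mem_span {x : ℕ → C00} {y : C00} (hy : y ∈ Submodule.span ℝ (Set.range x)) :
    ∃ a : ℕ →₀ ℝ, y = ∑ k ∈ a.support, a k • x k := by
  obtain ⟨a, ha⟩ := (Finsupp.mem_span_range_iff_exists_finsupp).1 hy
  exact ⟨a, ha.symm⟩

end C00

/-- A sequence can be built term by term so that each term is related to the list of the earlier
ones. -/
lemma exists_seq_of_forall_list {α : Type*} (R : List α → α → Prop) (h : ∀ l, ∃ a, R l a) :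
    ∃ s : ℕ → α, ∀ n, R ((List.range n).map s) (s n) := by
  choose g hg using h
  let L : ℕ → List α := fun n => Nat.rec [] (fun _ l => l ++ [g l]) n
  refine ⟨fun n => g (L n), fun n => ?_⟩
  have : (List.range n).map (fun n => g (L n)) = L n := by
    induction n with
    | zero => rfl
    | succ n ih => rw [List.range_succ, List.map_append, ih]; rfl
  rw [this]
  exact hg _

namespace C00

/-- A block sequence can be built term by term, each term with a property that depends on the
earlier ones, if nonzero vectors with the property exist arbitrarily far out. -/
lemma exists_blockSequence {α : Type*} (v : α → C00) (R : List α → α → Prop)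
    (h : ∀ (l : List α) (N : ℕ), ∃ a, v a ≠ 0 ∧ (∀ n ∈ (v a).support, N < (n : ℕ)) ∧ R l a) :
    ∃ s : ℕ → α, IsBlockSequence (v ∘ s) ∧ ∀ n, R ((List.range n).map s) (s n) := by
  obtain ⟨s, hs⟩ := exists_seq_of_forall_list
    (fun l a => v a ≠ 0 ∧ (∀ b ∈ l, Before (v b) (v a)) ∧ R l a) (fun l => by
      have hN : ∃ N : ℕ, ∀ b ∈ l, ∀ n ∈ (v b).support, (n : ℕ) ≤ N := by
        induction l with
        | nil => exact ⟨0, by simp⟩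
        | cons b l ih =>
          obtain ⟨N, hN⟩ := ih
          obtain ⟨M, hM⟩ := exists_support_le (v b)
          refine ⟨max M N, fun c hc n hn => ?_⟩
          rcases List.mem_cons.1 hc with rfl | hc
          · exact (hM n hn).trans (le_max_left _ _)
          · exact (hN c hc n hn).trans (le_max_right _ _)
      obtain ⟨N, hN⟩ := hN
      obtain ⟨a, h0, ha, hR⟩ := h l N
      refine ⟨a, h0, fun b hb m hm n hn => ?_, hR⟩
      have h1 := hN b hb m hm
      have h2 := ha n hn
      exact PNat.coe_lt_coe _ _ |>.1 (h1.trans_lt h2))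
  refine ⟨s, ⟨fun k => (hs k).1, fun k => (hs (k + 1)).2.1 _ ?_⟩, fun n => (hs n).2.2⟩
  exact List.mem_map.2 ⟨k, List.mem_range.2 k.lt_succ_self, rfl⟩

end C00

namespace NormingSet

variable (G : NormingSet)

/-- The norm that a norming set defines on `c₀₀(ℕ)`. -/
def nrm (x : C00) : ℝ := supOn G.carrier x

lemma nrm_nonneg (x : C00) : 0 ≤ G.nrm x := G.core.norm_nonneg x

lemma nrm_smul (r : ℝ) (x : C00) : G.nrm (r • x) = |r| * G.nrm x := G.core.norm_smul r x

lemma nrm_eq_zero {x : C00} : G.nrm x = 0 ↔ x = 0 := G.core.norm_eq_zero_iff x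

lemma nrm_pos {x : C00} (hx : x ≠ 0) : 0 < G.nrm x :=
  (G.nrm_nonneg x).lt_of_ne fun h => hx (G.nrm_eq_zero.1 h.symm)

lemma nrm_zero : G.nrm 0 = 0 := G.nrm_eq_zero.2 rfl

lemma nrm_le {x : C00} {c : ℝ} (h : ∀ f ∈ G.carrier, pair f x ≤ c) : G.nrm x ≤ c := G.supOn_le h

lemma abs_pair_le {f : C00} (hf : f ∈ G.carrier) (x : C00) : |pair f x| ≤ G.nrm x :=
  G.abs_pair_le_supOn hf x

lemma exists_lt_pair {x : C00} {c : ℝ} (h : c < G.nrm x) : ∃ f ∈ G.carrier, c < pair f x := by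
  by_contra! hc
  exact absurd (G.nrm_le hc) (not_le.2 h)

/-- The norming set is closed under restrictions to intervals. -/
def IsIntervalClosed : Prop := ∀ f ∈ G.carrier, ∀ E : Set ℕ+, E.OrdConnected →
  restrict E f = 0 ∨ restrict E f ∈ G.carrier

variable {G}

lemma IsIntervalClosed.nrm_restrict_le (h : G.IsIntervalClosed) {E : Set ℕ+} (hE : E.OrdConnected)
    (x : C00) : G.nrm (restrict E x) ≤ G.nrm x := by
  refine G.nrm_le fun f hf => ?_
  rw [← pair_restrict]
  rcases h f hf E hE with h0 | h0
  · rw [h0, pair_zero_left]; exact G.nrm_nonneg x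
  · exact (le_abs_self _).trans (G.abs_pair_le h0 x)

lemma IsIntervalClosed.abs_coeff_mul_le (h : G.IsIntervalClosed) {x : ℕ → C00}
    (hx : IsBlockSequence x) (s : Finset ℕ) (a : ℕ → ℝ) {m : ℕ} (hm : m ∈ s) :
    |a m| * G.nrm (x m) ≤ G.nrm (∑ k ∈ s, a k • x k) := by
  rw [← G.nrm_smul, ← hx.restrict_hull s a hm]
  exact h.nrm_restrict_le (ordConnected_hull _) _

end NormingSet

/-! ### Functionals with indices -/

/-- Testing against rational coefficient vectors in the Euclidean unit ball suffices. -/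
lemma sum_sq_le_of_forall_rat {ι : Type*} [Fintype ι] {p : ι → ℝ} {C : ℝ} (hC : 0 ≤ C)
    (h : ∀ q : ι → ℚ, ∑ i, q i ^ 2 ≤ 1 → ∑ i, (q i : ℝ) * p i ≤ C) : ∑ i, p i ^ 2 ≤ C ^ 2 := by
  by_contra! hlt
  set S := ∑ i, p i ^ 2 with hS
  have hS0 : 0 < S := (sq_nonneg C).trans_lt hlt
  have hr : 0 < √S := Real.sqrt_pos.2 hS0
  have hCr : C < √S := Real.lt_sqrt_of_sq_lt hlt
  obtain ⟨t, ht1, ht2⟩ := exists_between ((div_lt_one hr).2 hCr)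
  have ht0 : 0 ≤ t := (div_nonneg hC hr.le).trans ht1.le
  have hopen : IsOpen ({a : ι → ℝ | ∑ i, a i ^ 2 < 1} ∩ {a | C < ∑ i, a i * p i}) :=
    (isOpen_lt (by fun_prop) continuous_const).inter (isOpen_lt continuous_const (by fun_prop))
  have hd : DenseRange fun (q : ι → ℚ) (i : ι) => (q i : ℝ) :=
    DenseRange.piMap fun _ => Rat.denseRange_cast
  obtain ⟨q, hq1, hq2⟩ := hd.exists_mem_open hopen ⟨fun i => t * (p i / √S), by
    have h1 : ∑ i, (t * (p i / √S)) ^ 2 = t ^ 2 := by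
      simp_rw [mul_pow, div_pow, Real.sq_sqrt hS0.le]
      rw [← mul_sum, ← sum_div, ← hS, div_self hS0.ne', mul_one]
    have h2 : ∑ i, t * (p i / √S) * p i = t * √S := by
      simp_rw [mul_assoc, div_mul_eq_mul_div, ← sq]
      rw [← mul_sum, ← sum_div, ← hS, Real.div_sqrt]
    refine ⟨?_, ?_⟩
    · rw [Set.mem_ofPred_eq, h1]; nlinarith
    · rw [Set.mem_ofPred_eq, h2]; exact (div_lt_iff₀ hr).1 ht1⟩
  rw [Set.mem_ofPred_eq] at hq1 hq2
  have hq3 : ∑ i, (q i : ℝ) ^ 2 ≤ 1 := hq1.le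
  exact absurd (h q (by exact_mod_cast hq3)) (not_le.2 hq2)

namespace JTGFamily

variable (𝓕 : JTGFamily)

lemma supNorm_zero_le : supNorm (𝓕.F 0) ≤ 1 := by
  refine iSup₂_le fun f hf => iSup_le fun n => ?_
  rw [ENNReal.ofReal_le_one]
  exact Coding.F_zero_abs hf n

lemma supNorm_le_one (j : ℕ) : supNorm (𝓕.F j) ≤ 1 :=
  (𝓕.tau_strictAnti.antitone j.zero_le).trans 𝓕.supNorm_zero_le

lemma abs_le_one {j : ℕ} {f : C00} (hf : f ∈ 𝓕.F j) (n : ℕ+) : |f n| ≤ 1 := by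
  rw [← ENNReal.ofReal_le_one]
  exact (le_supNorm hf n).trans (𝓕.supNorm_le_one j)

/-- The tail `∑_{j > q} τ_j`. -/
def tauTail (q : ℕ) : ℝ := (∑' j, supNorm (𝓕.F (j + q + 1))).toReal

lemma tsum_tail_ne_top (q : ℕ) : ∑' j, supNorm (𝓕.F (j + q + 1)) ≠ ∞ := by
  refine ne_top_of_le_ne_top ENNReal.one_ne_top (le_trans ?_ 𝓕.tau_sum)
  exact ENNReal.tsum_comp_le_tsum_of_injective (add_left_injective q) fun j => supNorm (𝓕.F (j + 1))

lemma tauTail_nonneg (q : ℕ) : 0 ≤ 𝓕.tauTail q := ENNReal.toReal_nonneg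

lemma tendsto_tauTail : Filter.Tendsto 𝓕.tauTail Filter.atTop (nhds 0) := by
  unfold tauTail
  have h := ENNReal.tendsto_sum_nat_add (fun j => supNorm (𝓕.F (j + 1)))
    (ne_top_of_le_ne_top ENNReal.one_ne_top 𝓕.tau_sum)
  have := (ENNReal.tendsto_toReal ENNReal.zero_ne_top).comp h
  simpa [Function.comp_def] using this

lemma abs_le_tauTail {j q : ℕ} (hj : q < j) {f : C00} (hf : f ∈ 𝓕.F j) (n : ℕ+) :
    |f n| ≤ 𝓕.tauTail q := by
  obtain ⟨k, rfl⟩ := Nat.exists_eq_add_of_lt hj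
  have h1 := (le_supNorm hf n).trans
    ((show supNorm (𝓕.F (q + k + 1)) = supNorm (𝓕.F (k + q + 1)) by rw [add_comm q k]).le.trans
    (ENNReal.le_tsum (f := fun j => supNorm (𝓕.F (j + q + 1))) k))
  exact (ENNReal.ofReal_le_iff_le_toReal (𝓕.tsum_tail_ne_top q)).1 h1

lemma exists_pos_tauTail_mul_le (q : ℕ) (c : ℝ) {η : ℝ} (hη : 0 < η) :
    ∃ p, q ≤ p ∧ 𝓕.tauTail p * c ≤ η := by
  have h : Filter.Tendsto (fun p => 𝓕.tauTail p * c) Filter.atTop (nhds 0) := by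
    simpa using 𝓕.tendsto_tauTail.mul_const c
  obtain ⟨p, h1, h2⟩ := ((h.eventually_lt_const hη).and (Filter.eventually_ge_atTop q)).exists
  exact ⟨p, h2, h1.le⟩

/-- The union `⋃_{j ≥ 0} F_j` as a norming set. -/
def normingUnion : NormingSet where
  carrier := ⋃ i, 𝓕.F i
  neg_mem f hf := by
    obtain ⟨i, hi⟩ := Set.mem_iUnion.1 hf
    rcases Nat.eq_zero_or_pos i with rfl | h
    · exact Set.mem_iUnion.2 ⟨0, Coding.F_zero_neg hi⟩
    · exact Set.mem_iUnion.2 ⟨i, 𝓕.symm i h f hi⟩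
  single_mem n := Set.mem_iUnion.2 ⟨0, Coding.single_mem_F_zero n⟩
  abs_le_one f hf := by
    obtain ⟨i, hi⟩ := Set.mem_iUnion.1 hf
    exact 𝓕.abs_le_one hi

lemma restrict_F_zero {f : C00} (hf : f ∈ 𝓕.F 0) (E : Set ℕ+) :
    restrict E f = 0 ∨ restrict E f ∈ 𝓕.F 0 := by
  rw [𝓕.F_zero] at hf ⊢
  obtain ⟨n, hn⟩ := hf
  by_cases h : n ∈ E
  · right
    rw [restrict_eq_self]
    · exact ⟨n, hn⟩
    · intro m hm
      have : m = n := by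
        rcases hn with rfl | rfl <;> simpa using Finsupp.support_single_subset hm
      rwa [this]
  · left
    rw [restrict_eq_zero]
    intro m hm
    have : m = n := by
      rcases hn with rfl | rfl <;> simpa using Finsupp.support_single_subset hm
    rwa [this]

lemma isIntervalClosed_normingUnion : 𝓕.normingUnion.IsIntervalClosed := by
  intro f hf E hE
  obtain ⟨i, hi⟩ := Set.mem_iUnion.1 hf
  rcases Nat.eq_zero_or_pos i with rfl | h
  · exact (𝓕.restrict_F_zero hi E).imp_right fun h => Set.mem_iUnion.2 ⟨0, h⟩
  · exact Or.inr (Set.mem_iUnion.2 ⟨i, 𝓕.restrict_mem i h f hi E hE⟩)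

lemma pair_le_supOn_F {j : ℕ} {f : C00} (hf : f ∈ 𝓕.F j) (x : C00) :
    pair f x ≤ supOn (𝓕.F j) x :=
  le_csSup ((𝓕.normingUnion.bddAbove x).mono
    (Set.image_mono (Set.subset_iUnion 𝓕.F j))) ⟨f, hf, rfl⟩

lemma abs_pair_le_supOn_F {j : ℕ} {f : C00} (hf : f ∈ 𝓕.F j) (x : C00) :
    |pair f x| ≤ supOn (𝓕.F j) x := by
  refine abs_le'.2 ⟨𝓕.pair_le_supOn_F hf x, ?_⟩
  rw [← pair_neg_left]
  refine 𝓕.pair_le_supOn_F ?_ x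
  rcases Nat.eq_zero_or_pos j with rfl | h
  exacts [Coding.F_zero_neg hf, 𝓕.symm j h f hf]

lemma exists_ne_zero (j : ℕ) : ∃ f ∈ 𝓕.F j, f ≠ 0 := by
  by_contra! h
  have h0 : supNorm (𝓕.F j) = 0 := by
    refine le_antisymm (iSup₂_le fun f hf => iSup_le fun n => ?_) bot_le
    rw [h f hf]; simp
  have := 𝓕.tau_strictAnti (Nat.lt_succ_self j)
  simp only [h0] at this
  exact absurd this not_lt_bot

namespace Coding

variable {𝓕} (c : 𝓕.Coding)

variable {c} in
lemma IsSpecial.take_mem_W {l : List C00} (hl : c.IsSpecial l) {i : ℕ} (hi : i ≠ 0) :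
    l.take i ∈ 𝓕.W := by
  refine ⟨fun h => ?_, fun f hf => hl.1.2.1 f (List.mem_of_mem_take hf),
    hl.1.2.2.sublist (List.take_sublist _ _)⟩
  rcases List.take_eq_nil_iff.1 h with h | h
  exacts [hi h, hl.1.1 h]

variable {c} in
lemma IsSpecial.get_mem {l : List C00} (hl : c.IsSpecial l) (i : Fin l.length) :
    l.get i ∈ 𝓕.F (c.termIndex l i) := by
  unfold termIndex
  split_ifs with h0
  · obtain ⟨-, j, -, hij⟩ := hl.1.2.1 _ (l.get_mem i)
    exact Nat.sInf_mem (s := {j | l.get i ∈ 𝓕.F j}) ⟨j, hij⟩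
  · exact hl.2.2 i h0

/-- An element of some `F_j`, `j ≥ 1`, is not in `F₀`, since `τ_j < 1`. -/
lemma notMem_F_zero {f : C00} {j : ℕ} (hj : 1 ≤ j) (hf : f ∈ 𝓕.F j) : f ∉ 𝓕.F 0 := by
  intro h0
  rw [𝓕.F_zero] at h0
  obtain ⟨m, hm⟩ := h0
  have h1 : |f m| = 1 := by rcases hm with hm | hm <;> rw [hm] <;> simp
  have h2 := le_supNorm hf m
  rw [h1, ENNReal.ofReal_one] at h2
  exact absurd (h2.trans_lt (𝓕.tau_strictAnti hj)) (not_lt.2 𝓕.supNorm_zero_le)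

variable {c} in
lemma IsSpecial.one_le_termIndex {l : List C00} (hl : c.IsSpecial l) (i : Fin l.length) :
    1 ≤ c.termIndex l i := by
  by_contra hlt
  obtain ⟨-, j, hj, hij⟩ := hl.1.2.1 _ (l.get_mem i)
  have := hl.get_mem i
  rw [show c.termIndex l i = 0 by omega] at this
  exact notMem_F_zero hj hij this

variable {c} in
lemma IsSpecial.termIndex_strictMono {l : List C00} (hl : c.IsSpecial l) :
    StrictMono (c.termIndex l) := by
  intro i i' h
  have hi' : i'.1 ≠ 0 := by have := Fin.lt_def.1 h; omega
  rw [show c.termIndex l i' = c.σ (l.take i') by simp [termIndex, hi']]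
  refine c.σ_gt _ (hl.take_mem_W hi') (l.get i) ?_ _ (hl.get_mem i)
  rw [List.mem_take_iff_getElem]
  exact ⟨i, by simpa using h, by simp⟩

variable {c} in
lemma IsSpecial.before {l : List C00} (hl : c.IsSpecial l) {i i' : Fin l.length} (h : i < i') :
    Before (l.get i) (l.get i') := List.pairwise_iff_get.1 hl.1.2.2 i i' h

lemma list_sum_eq (l : List C00) : l.sum = ∑ i : Fin l.length, l.get i := by
  simp

lemma exists_isSpecial : ∃ l, c.IsSpecial l := by
  obtain ⟨j, hj⟩ := c.infinite₁.nonempty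
  obtain ⟨f, hf, h0⟩ := 𝓕.exists_ne_zero j
  refine ⟨[f], ⟨by simp, ?_, by simp⟩, ⟨j, hj, f, by simp, hf⟩, ?_⟩
  · simpa using ⟨h0, j, c.pos₁ j hj, hf⟩
  · intro i hi
    exact absurd (by simp) hi

lemma hasIndex_zero : c.HasIndex 0 ∅ := by
  obtain ⟨l, hl⟩ := c.exists_isSpecial
  refine Or.inl ⟨l, ∅, hl, Set.ordConnected_empty, ?_, ?_⟩
  · rw [restrict_eq_zero]; simp
  · symm
    rw [Set.eq_empty_iff_forall_notMem]
    rintro j ⟨i, hi, -⟩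
    exact hi (restrict_eq_zero (by simp))

variable {c}

lemma HasIndex.restrict {x : C00} {I : Set ℕ} (h : c.HasIndex x I) {E : Set ℕ+}
    (hE : E.OrdConnected) : ∃ I' ⊆ I, c.HasIndex (restrict E x) I' := by
  rcases h with ⟨l, E', hl, hE', rfl, rfl⟩ | ⟨j, hj, hx, rfl⟩
  · refine ⟨_, ?_, Or.inl ⟨l, E ∩ E', hl, hE.inter hE', restrict_restrict _ _ _, rfl⟩⟩
    rintro j ⟨i, hi, rfl⟩
    refine ⟨i, fun h0 => hi ?_, rfl⟩
    rw [← restrict_restrict, h0, restrict_zero]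
  · exact ⟨{j}, subset_rfl, Or.inr ⟨j, hj, 𝓕.restrict_mem j hj x hx E hE, rfl⟩⟩

/-- The initial interval that is cut off from a special sequence `l` by the terms whose position
satisfies `P`. -/
def cut (l : List C00) (P : Fin l.length → Prop) : Set ℕ+ :=
  {n | ∃ i, P i ∧ ∃ m ∈ (l.get i).support, n ≤ m}

lemma isLowerSet_cut (l : List C00) (P : Fin l.length → Prop) : IsLowerSet (cut l P) := by
  rintro a b hba ⟨i, hi, m, hm, h⟩
  exact ⟨i, hi, m, hm, hba.trans h⟩

lemma mem_cut {l : List C00} {P : Fin l.length → Prop} {i : Fin l.length} (hi : P i) :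
    ∀ n ∈ (l.get i).support, n ∈ cut l P := fun n hn => ⟨i, hi, n, hn, le_rfl⟩

lemma IsSpecial.notMem_cut {l : List C00} (hl : c.IsSpecial l) {P : Fin l.length → Prop}
    (hP : ∀ i i', i ≤ i' → P i' → P i) {i : Fin l.length} (hi : ¬ P i) :
    ∀ n ∈ (l.get i).support, n ∉ cut l P := by
  rintro n hn ⟨i', hi', m, hm, h⟩
  have hlt : i' < i := lt_of_not_ge fun h => hi (hP _ _ h hi')
  exact absurd (hl.before hlt m hm n hn) (not_lt.2 h)

lemma IsSpecial.hasIndex_cut {l : List C00} (hl : c.IsSpecial l) {P : Fin l.length → Prop}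
    (hP : ∀ i i', i ≤ i' → P i' → P i) {E : Set ℕ+} (hE : E.OrdConnected) :
    c.HasIndex (C00.restrict (E ∩ cut l P) l.sum)
      {j | ∃ i, P i ∧ C00.restrict E (l.get i) ≠ 0 ∧ j = c.termIndex l i} := by
  refine Or.inl ⟨l, _, hl, hE.inter (isLowerSet_cut l P).ordConnected, rfl, ?_⟩
  ext j
  constructor
  · rintro ⟨i, hi, h0, rfl⟩
    refine ⟨i, ?_, rfl⟩
    rwa [← restrict_restrict, restrict_eq_self (mem_cut hi)]
  · rintro ⟨i, h0, rfl⟩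
    have hi : P i := by
      by_contra hi
      exact h0 (by rw [← restrict_restrict, restrict_eq_zero (hl.notMem_cut hP hi), restrict_zero])
    refine ⟨i, hi, ?_, rfl⟩
    rwa [← restrict_restrict, restrict_eq_self (mem_cut hi)] at h0

lemma IsSpecial.hasIndex_diff_cut {l : List C00} (hl : c.IsSpecial l) {P : Fin l.length → Prop}
    (hP : ∀ i i', i ≤ i' → P i' → P i) {E : Set ℕ+} (hE : E.OrdConnected) :
    c.HasIndex (C00.restrict (E ∩ (cut l P)ᶜ) l.sum)
      {j | ∃ i, ¬ P i ∧ C00.restrict E (l.get i) ≠ 0 ∧ j = c.termIndex l i} := by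
  refine Or.inl ⟨l, _, hl, hE.inter (isLowerSet_cut l P).compl.ordConnected, rfl, ?_⟩
  ext j
  constructor
  · rintro ⟨i, hi, h0, rfl⟩
    refine ⟨i, ?_, rfl⟩
    rwa [← restrict_restrict, restrict_eq_self (E := (cut l P)ᶜ) (hl.notMem_cut hP hi)]
  · rintro ⟨i, h0, rfl⟩
    have hi : ¬ P i := by
      intro hi
      refine h0 ?_
      rw [← restrict_restrict, restrict_eq_zero (E := (cut l P)ᶜ) (fun n hn => ?_), restrict_zero]
      exact fun h => h (mem_cut hi n hn)
    refine ⟨i, hi, ?_, rfl⟩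
    rwa [← restrict_restrict, restrict_eq_self (E := (cut l P)ᶜ) (hl.notMem_cut hP hi)] at h0

lemma restrict_inter_add_diff (E A : Set ℕ+) (f : C00) :
    C00.restrict (E ∩ A) f + C00.restrict (E ∩ Aᶜ) f = C00.restrict E f := by
  ext n
  by_cases h : n ∈ E <;> by_cases h' : n ∈ A <;> simp [restrict_apply, h, h']

/-- An element of `𝒮 ∪ ⋃ F_j` splits into the part with indices at most `p` and the part with
indices above `p`. -/
lemma HasIndex.split {x : C00} {I : Set ℕ} (h : c.HasIndex x I) (p : ℕ) :
    ∃ x₁ x₂, x = x₁ + x₂ ∧ c.HasIndex x₁ (I ∩ Set.Iic p) ∧ c.HasIndex x₂ (I ∩ Set.Ioi p) := by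
  rcases h with ⟨l, E, hl, hE, rfl, rfl⟩ | ⟨j, hj, hx, rfl⟩
  · have hP : ∀ i i', i ≤ i' → c.termIndex l i' ≤ p → c.termIndex l i ≤ p :=
      fun i i' hii h => (hl.termIndex_strictMono.monotone hii).trans h
    refine ⟨_, _, (restrict_inter_add_diff E (cut l fun i => c.termIndex l i ≤ p) l.sum).symm,
      ?_, ?_⟩
    · convert hl.hasIndex_cut hP hE using 1
      ext j
      constructor
      · rintro ⟨⟨i, hi, rfl⟩, hj⟩
        exact ⟨i, hj, hi, rfl⟩
      · rintro ⟨i, hj, hi, rfl⟩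
        exact ⟨⟨i, hi, rfl⟩, hj⟩
    · convert hl.hasIndex_diff_cut hP hE using 1
      ext j
      constructor
      · rintro ⟨⟨i, hi, rfl⟩, hj⟩
        exact ⟨i, not_le.2 hj, hi, rfl⟩
      · rintro ⟨i, hj, hi, rfl⟩
        exact ⟨⟨i, hi, rfl⟩, not_le.1 hj⟩
  · by_cases hjp : j ≤ p
    · refine ⟨x, 0, by simp, ?_, ?_⟩
      · rw [Set.inter_eq_left.2 (by simpa using hjp)]
        exact Or.inr ⟨j, hj, hx, rfl⟩
      · convert c.hasIndex_zero using 1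
        ext; simp; omega
    · refine ⟨0, x, by simp, ?_, ?_⟩
      · convert c.hasIndex_zero using 1
        ext; simp; omega
      · rw [Set.inter_eq_left.2 (by simpa using hjp)]
        exact Or.inr ⟨j, hj, hx, rfl⟩

lemma IsSpecial.hasIndex_drop {l : List C00} (hl : c.IsSpecial l) (r : ℕ) :
    c.HasIndex (l.drop r).sum {j | ∃ i : Fin l.length, r ≤ i.1 ∧ j = c.termIndex l i} := by
  have hP : ∀ i i' : Fin l.length, i ≤ i' → i'.1 < r → i.1 < r :=
    fun i i' h h' => (Fin.le_def.1 h).trans_lt h'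
  have h := hl.hasIndex_diff_cut hP (E := Set.univ) Set.ordConnected_univ
  have hsum : C00.restrict (Set.univ ∩ (cut l fun i => i.1 < r)ᶜ) l.sum = (l.drop r).sum := by
    rw [Set.univ_inter]
    have hsplit : l.sum = (l.take r).sum + (l.drop r).sum := by
      rw [← List.sum_append, List.take_append_drop]
    have h1 : C00.restrict (cut l fun i => i.1 < r)ᶜ (l.take r).sum = 0 := by
      rw [restrict_list_sum, List.sum_eq_zero]
      simp only [List.mem_map, forall_exists_index, and_imp]
      rintro _ f hf rfl
      obtain ⟨i, hi, rfl⟩ := List.mem_take_iff_getElem.1 hf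
      refine restrict_eq_zero fun n hn hn' => hn' ?_
      exact ⟨⟨i, by omega⟩, by simp; omega, n, hn, le_rfl⟩
    have h2 : C00.restrict (cut l fun i => i.1 < r)ᶜ (l.drop r).sum = (l.drop r).sum := by
      rw [restrict_list_sum]
      congr 1
      conv_rhs => rw [← List.map_id (l.drop r)]
      refine List.map_congr_left fun f hf => ?_
      obtain ⟨i, hi, rfl⟩ := List.mem_drop_iff_getElem.1 hf
      refine restrict_eq_self fun n hn => ?_
      exact hl.notMem_cut hP (i := ⟨r + i, by omega⟩) (by simp) n hn
    rw [hsplit, restrict_add, h1, h2, zero_add]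
  rw [hsum] at h
  convert h using 1
  ext j
  constructor
  · rintro ⟨i, hi, rfl⟩
    exact ⟨i, not_lt.2 hi, by rw [restrict_univ]; exact (hl.1.2.1 _ (l.get_mem i)).1, rfl⟩
  · rintro ⟨i, hi, -, rfl⟩
    exact ⟨i, not_lt.1 hi, rfl⟩

/-- A functional all of whose indices are at most `p` is a sum of at most `p` elements of
`F_1 ∪ ⋯ ∪ F_p`. -/
lemma HasIndex.abs_pair_le_of_le {x : C00} {I : Set ℕ} (h : c.HasIndex x I) {p : ℕ}
    (hI : I ⊆ Set.Iic p) {y : C00} {A : ℝ} (hA : 0 ≤ A)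
    (hy : ∀ j ≤ p, ∀ f ∈ 𝓕.F j, |pair f y| ≤ A) : |pair x y| ≤ p * A := by
  classical
  rcases h with ⟨l, E, hl, hE, rfl, rfl⟩ | ⟨j, hj, hx, rfl⟩
  · rw [list_sum_eq, restrict_sum, pair_sum_left]
    set s : Finset (Fin l.length) := {i | C00.restrict E (l.get i) ≠ 0} with hs
    have hi : ∀ i ∈ s, c.termIndex l i ≤ p := fun i hi =>
      hI ⟨i, (mem_filter.1 hi).2, rfl⟩
    have hcard : #s ≤ p := by
      have := card_le_card_of_injOn (t := Finset.Icc 1 p) (c.termIndex l)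
        (fun i h => mem_coe.2 (mem_Icc.2 ⟨hl.one_le_termIndex i, hi i h⟩))
        (hl.termIndex_strictMono.injective.injOn (s := s))
      simpa using this
    rw [← sum_subset (subset_univ s) fun i _ his => ?_]
    · refine (abs_sum_le_sum_abs _ _).trans ((sum_le_card_nsmul s _ A fun i his => ?_).trans ?_)
      · exact hy _ (hi i his) _ (𝓕.restrict_mem _ (hl.one_le_termIndex i) _ (hl.get_mem i) E hE)
      · rw [nsmul_eq_mul]
        gcongr
    · have : C00.restrict E (l.get i) = 0 := by simpa [hs] using his
      rw [this, pair_zero_left]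
  · have hjp : j ≤ p := by simpa using hI
    have h1 : (1 : ℝ) ≤ p := by exact_mod_cast hj.trans hjp
    exact (hy j hjp x hx).trans (le_mul_of_one_le_left hA h1)

/-- Functionals with pairwise disjoint indices above `q` are jointly bounded by `∑_{j > q} τ_j` at
each coordinate. -/
lemma sum_abs_apply_le_tauTail {ι : Type*} {s : Finset ι} {x : ι → C00} {I : ι → Set ℕ}
    (h : ∀ i ∈ s, c.HasIndex (x i) (I i)) (hd : (s : Set ι).PairwiseDisjoint I) {q : ℕ}
    (hq : ∀ i ∈ s, I i ⊆ Set.Ioi q) (n : ℕ+) : ∑ i ∈ s, |x i n| ≤ 𝓕.tauTail q := by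
  classical
  have H : ∀ i, ∃ j, i ∈ s → x i n ≠ 0 →
      j + q + 1 ∈ I i ∧ ENNReal.ofReal |x i n| ≤ supNorm (𝓕.F (j + q + 1)) := by
    intro i
    by_cases hi : i ∈ s ∧ x i n ≠ 0
    · obtain ⟨j, hj1, hj2⟩ := HasIndex.bound c (h i hi.1) hi.2
      have : q < j + 1 := hq i hi.1 hj1
      refine ⟨j - q, fun _ _ => ?_⟩
      rw [show j - q + q + 1 = j + 1 by omega]
      exact ⟨hj1, hj2⟩
    · exact ⟨0, fun h1 h2 => absurd ⟨h1, h2⟩ hi⟩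
  choose j hj using H
  have hinj : Set.InjOn j ({i ∈ s | x i n ≠ 0} : Finset ι) := by
    intro k hk m hm hkm
    by_contra hne
    rw [mem_coe, mem_filter] at hk hm
    have hk' := (hj k hk.1 hk.2).1
    have hm' := (hj m hm.1 hm.2).1
    rw [← hkm] at hm'
    exact Set.disjoint_left.1 (hd hk.1 hm.1 hne) hk' hm'
  rw [tauTail, ← ENNReal.ofReal_le_iff_le_toReal (𝓕.tsum_tail_ne_top q),
    ← sum_filter_of_ne (p := fun i => x i n ≠ 0) (fun i _ h => abs_ne_zero.1 h),
    ENNReal.ofReal_sum_of_nonneg fun _ _ => abs_nonneg _]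
  calc ∑ i ∈ s with x i n ≠ 0, ENNReal.ofReal |x i n|
      ≤ ∑ i ∈ s with x i n ≠ 0, supNorm (𝓕.F (j i + q + 1)) := sum_le_sum fun i hi => by
        rw [mem_filter] at hi
        exact (hj i hi.1 hi.2).2
    _ = ∑ m ∈ image j {i ∈ s | x i n ≠ 0}, supNorm (𝓕.F (m + q + 1)) :=
        (sum_image (f := fun m => supNorm (𝓕.F (m + q + 1))) hinj).symm
    _ ≤ ∑' m, supNorm (𝓕.F (m + q + 1)) := ENNReal.sum_le_tsum _

lemma HasIndex.abs_apply_le_tauTail {x : C00} {I : Set ℕ} (h : c.HasIndex x I) {q : ℕ}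
    (hq : I ⊆ Set.Ioi q) (n : ℕ+) : |x n| ≤ 𝓕.tauTail q := by
  simpa using sum_abs_apply_le_tauTail (s := {()}) (x := fun _ => x) (I := fun _ => I)
    (fun _ _ => h) (by simp) (fun _ _ => hq) n

lemma HasIndex.abs_pair_le_tauTail {x : C00} {I : Set ℕ} (h : c.HasIndex x I) {q : ℕ}
    (hq : I ⊆ Set.Ioi q) (y : C00) : |pair x y| ≤ 𝓕.tauTail q * l1 y :=
  abs_pair_le_mul_l1 fun n _ => h.abs_apply_le_tauTail hq n

variable (c)

/-- The coordinate functionals and the elements of `𝒮 ∪ ⋃ F_j`, up to sign, as a norming set. -/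
def normingS : NormingSet where
  carrier := 𝓕.F 0 ∪ {f | ∃ I, c.HasIndex f I ∨ c.HasIndex (-f) I}
  neg_mem := by
    rintro f (hf | ⟨I, hf | hf⟩)
    · exact Or.inl (F_zero_neg hf)
    · exact Or.inr ⟨I, Or.inr (by rwa [neg_neg])⟩
    · exact Or.inr ⟨I, Or.inl hf⟩
  single_mem n := Or.inl (single_mem_F_zero n)
  abs_le_one := by
    have key : ∀ f I, c.HasIndex f I → ∀ n, |f n| ≤ 1 := by
      intro f I hf n
      by_cases h0 : f n = 0
      · simp [h0]
      · obtain ⟨j, -, hj⟩ := HasIndex.bound c hf h0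
        rw [← ENNReal.ofReal_le_one]
        exact hj.trans (𝓕.supNorm_le_one _)
    rintro f (hf | ⟨I, hf | hf⟩) n
    · exact F_zero_abs hf n
    · exact key f I hf n
    · simpa using key _ I hf n

variable {c}

lemma HasIndex.abs_pair_le {x : C00} {I : Set ℕ} (h : c.HasIndex x I) (y : C00) :
    |pair x y| ≤ c.normingS.nrm y := c.normingS.abs_pair_le (Or.inr ⟨I, Or.inl h⟩) y

lemma hasIndex_of_mem_F {j : ℕ} (hj : 1 ≤ j) {f : C00} (hf : f ∈ 𝓕.F j) : c.HasIndex f {j} :=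
  Or.inr ⟨j, hj, hf, rfl⟩

lemma abs_pair_le_normingS {j : ℕ} {f : C00} (hf : f ∈ 𝓕.F j) (y : C00) :
    |pair f y| ≤ c.normingS.nrm y := by
  rcases Nat.eq_zero_or_pos j with rfl | h
  · exact c.normingS.abs_pair_le (Or.inl hf) y
  · exact (hasIndex_of_mem_F (c := c) h hf).abs_pair_le y

lemma normingUnion_le_normingS (y : C00) : 𝓕.normingUnion.nrm y ≤ c.normingS.nrm y := by
  refine NormingSet.nrm_le _ fun f hf => ?_
  obtain ⟨i, hi⟩ := Set.mem_iUnion.1 hf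
  exact (le_abs_self _).trans (abs_pair_le_normingS hi y)

/-- Bessel's inequality for `𝓕_{2,s}`. -/
lemma sum_sq_pair_le_norming₂ₛ {ι : Type*} {s : Finset ι} {x : ι → C00} {I : ι → Set ℕ}
    (h : ∀ i ∈ s, c.HasIndex (x i) (I i)) (hd : (s : Set ι).PairwiseDisjoint I)
    (hs : ∀ i ∈ s, ∀ n ∈ (x i).support, #s ≤ (n : ℕ)) (u : C00) :
    ∑ i ∈ s, pair (x i) u ^ 2 ≤ c.norming₂ₛ.nrm u ^ 2 := by
  let e := s.equivFin.symm
  have he : ∀ g : ι → ℝ, ∑ i ∈ s, g i = ∑ k, g (e k) := fun g => by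
    rw [Equiv.sum_comp e (fun i : s => g i), sum_coe_sort]
  rw [he]
  refine sum_sq_le_of_forall_rat (NormingSet.nrm_nonneg _ u) fun q hq => ?_
  have := c.norming₂ₛ.pair_le_supOn (f := ∑ k, (q k : ℝ) • x (e k)) (Or.inr ⟨#s, q, _, hq,
    ⟨fun k => I (e k), fun k => h _ (e k).2, fun k m hkm => hd (e k).2 (e m).2
      fun h => hkm (e.injective (Subtype.ext h))⟩, fun k => hs _ (e k).2, rfl⟩) u
  simpa [pair_sum_left, pair_smul_left, NormingSet.nrm] using this

/-- Bessel's inequality for `𝓕₂`. -/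
lemma sum_sq_pair_le_norming₂ {ι : Type*} {s : Finset ι} {x : ι → C00} {I : ι → Set ℕ}
    (h : ∀ i ∈ s, c.HasIndex (x i) (I i)) (hd : (s : Set ι).PairwiseDisjoint I) (u : C00) :
    ∑ i ∈ s, pair (x i) u ^ 2 ≤ c.norming₂.nrm u ^ 2 := by
  let e := s.equivFin.symm
  have he : ∀ g : ι → ℝ, ∑ i ∈ s, g i = ∑ k, g (e k) := fun g => by
    rw [Equiv.sum_comp e (fun i : s => g i), sum_coe_sort]
  rw [he]
  refine sum_sq_le_of_forall_rat (NormingSet.nrm_nonneg _ u) fun q hq => ?_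
  have := c.norming₂.pair_le_supOn (f := ∑ k, (q k : ℝ) • x (e k)) (Or.inr ⟨#s, q, _, hq,
    ⟨fun k => I (e k), fun k => h _ (e k).2, fun k m hkm => hd (e k).2 (e m).2
      fun h => hkm (e.injective (Subtype.ext h))⟩, rfl⟩) u
  simpa [pair_sum_left, pair_smul_left, NormingSet.nrm] using this

end Coding
end JTGFamily

/-! ### Windowed block sequences -/

lemma sum_half_pow_succ_le (s : Finset ℕ) : ∑ k ∈ s, (1 / 2 : ℝ) ^ (k + 1) ≤ 1 := by
  have h : HasSum (fun k : ℕ => (1 / 2 : ℝ) ^ (k + 1)) 1 := by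
    simpa [pow_succ, div_eq_mul_inv] using hasSum_geometric_two.mul_right (1 / 2 : ℝ)
  exact sum_le_hasSum s (fun _ _ => by positivity) h

/-- Double ultrafilter limits and a diagonal choice. -/
lemma exists_strictMono_forall_abs_sub_le {ι : Type*} [Finite ι] (h : ℕ → ι → ℕ → ℝ)
    (hb : ∀ k i m, |h k i m| ≤ 1) {δ : ℝ} (hδ : 0 < δ) :
    ∃ φ : ℕ → ℕ, StrictMono φ ∧ ∃ G : ι → ℝ, (∀ i, |G i| ≤ 1) ∧
      ∀ r m, r < m → ∀ i, |h (φ m) i (φ r) - G i| ≤ δ := by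
  have key : ∀ f : ℕ → ℝ, (∀ k, |f k| ≤ 1) → ∃ L : ℝ, |L| ≤ 1 ∧
      Filter.Tendsto f (Filter.hyperfilter ℕ) (nhds L) := by
    intro f hf
    obtain ⟨L, hL, h⟩ := (isCompact_Icc (a := (-1 : ℝ)) (b := 1)).ultrafilter_le_nhds
      ((Filter.hyperfilter ℕ).map f) (by
        rw [Filter.le_principal_iff]
        change ∀ᶠ k in (Filter.hyperfilter ℕ : Filter ℕ), f k ∈ Set.Icc (-1 : ℝ) 1
        exact Filter.Eventually.of_forall fun k => abs_le.1 (hf k))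
    exact ⟨L, abs_le.2 hL, h⟩
  choose H hH1 hH2 using fun i m => key (fun k => h k i m) fun k => hb k i m
  choose G hG1 hG2 using fun i => key (H i) (hH1 i)
  have hclose : ∀ (f : ℕ → ℝ) (L : ℝ), Filter.Tendsto f (Filter.hyperfilter ℕ) (nhds L) →
      ∀ᶠ k in (Filter.hyperfilter ℕ : Filter ℕ), |f k - L| < δ / 2 := by
    intro f L hf
    simpa [Real.dist_eq] using hf.eventually (Metric.ball_mem_nhds L (half_pos hδ))
  obtain ⟨φ, hφ⟩ := exists_seq_of_forall_list (fun (l : List ℕ) a =>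
    (∀ b ∈ l, b < a ∧ ∀ i, |h a i b - H i b| < δ / 2) ∧ ∀ i, |H i a - G i| < δ / 2) (fun l => by
      refine Filter.Eventually.exists (f := (Filter.hyperfilter ℕ : Filter ℕ)) ?_
      refine Filter.Eventually.and ?_ (Filter.eventually_all.2 fun i => hclose _ _ (hG2 i))
      induction l with
      | nil => simp
      | cons b l ih =>
        simp only [List.forall_mem_cons]
        refine Filter.Eventually.and (Filter.Eventually.and ?_
          (Filter.eventually_all.2 fun i => hclose _ _ (hH2 i b))) ih
        exact (Filter.eventually_gt_atTop b).filter_mono Nat.hyperfilter_le_atTop)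
  have hmem : ∀ {r m}, r < m → φ r ∈ (List.range m).map φ := fun h =>
    List.mem_map.2 ⟨_, List.mem_range.2 h, rfl⟩
  refine ⟨φ, fun r m hrm => ((hφ m).1 _ (hmem hrm)).1, G, hG1, fun r m hrm i => ?_⟩
  have h1 := ((hφ m).1 _ (hmem hrm)).2 i
  have h2 := (hφ r).2 i
  calc |h (φ m) i (φ r) - G i|
      ≤ |h (φ m) i (φ r) - H i (φ r)| + |H i (φ r) - G i| := abs_sub_le _ _ _
    _ ≤ δ := by linarith

lemma abs_sum_neg_one_pow_le_one (m : ℕ) : |∑ r ∈ range m, (-1 : ℝ) ^ r| ≤ 1 := by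
  rw [neg_one_geom_sum]
  split_ifs <;> simp

/-- An alternating sum stays bounded if, before each of its non-small terms, the sequence is almost
constant. -/
lemma abs_alternating_sum_le {a : ℕ → ℝ} {δ : ℝ} (hδ : 0 ≤ δ) (ha : ∀ r, |a r| ≤ 1)
    (h : ∀ m, δ ≤ |a m| → ∃ g : ℝ, |g| ≤ 1 ∧ ∀ r < m, |a r - g| ≤ 2 * δ) (m : ℕ) :
    |∑ r ∈ range m, (-1 : ℝ) ^ r * a r| ≤ 2 + 2 * δ * m := by
  induction m with
  | zero => simp
  | succ m ih =>
    rw [sum_range_succ]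
    refine (abs_add_le _ _).trans ?_
    rw [abs_mul, abs_pow, abs_neg, abs_one, one_pow, one_mul]
    push_cast
    by_cases hm : δ ≤ |a m|
    · obtain ⟨g, hg, hr⟩ := h m hm
      have h1 : ∑ r ∈ range m, (-1 : ℝ) ^ r * a r =
          ∑ r ∈ range m, (-1 : ℝ) ^ r * (a r - g) + (∑ r ∈ range m, (-1 : ℝ) ^ r) * g := by
        rw [sum_mul, ← sum_add_distrib]
        exact sum_congr rfl fun _ _ => by ring
      have h2 : |∑ r ∈ range m, (-1 : ℝ) ^ r * (a r - g)| ≤ m * (2 * δ) := by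
        refine (abs_sum_le_sum_abs _ _).trans
          ((sum_le_card_nsmul (range m) _ (2 * δ) fun r hr' => ?_).trans (by simp))
        rw [abs_mul, abs_pow, abs_neg, abs_one, one_pow, one_mul]
        exact hr r (mem_range.1 hr')
      have h3 : |(∑ r ∈ range m, (-1 : ℝ) ^ r) * g| ≤ 1 := by
        rw [abs_mul]
        exact mul_le_one₀ (abs_sum_neg_one_pow_le_one m) (abs_nonneg _) hg
      have h4 := abs_add_le (∑ r ∈ range m, (-1 : ℝ) ^ r * (a r - g))
        ((∑ r ∈ range m, (-1 : ℝ) ^ r) * g)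
      rw [h1]
      linarith [ha m]
    · linarith

/-- A sum of numbers in `[0, 1]` all but one of which are at most `η`. -/
lemma sum_le_one_add_card_mul {ι : Type*} {s : Finset ι} {g : ι → ℝ} {η : ℝ} (hη : 0 ≤ η)
    (h1 : ∀ i ∈ s, g i ≤ 1) (h2 : ∀ i ∈ s, ∀ j ∈ s, η < g i → η < g j → i = j) :
    ∑ i ∈ s, g i ≤ 1 + #s * η := by
  classical
  by_cases h : ∃ i ∈ s, η < g i
  · obtain ⟨i, hi, hgi⟩ := h
    rw [← add_sum_erase s g hi]
    refine add_le_add (h1 i hi) ((sum_le_card_nsmul _ _ η fun j hj => ?_).trans ?_)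
    · by_contra! hlt
      exact (mem_erase.1 hj).1 (h2 j (mem_of_mem_erase hj) i hi hlt hgi)
    · rw [nsmul_eq_mul]
      have : (#(s.erase i) : ℝ) ≤ #s := by exact_mod_cast card_le_card (erase_subset i s)
      gcongr
  · push Not at h
    have := sum_le_card_nsmul s g η h
    rw [nsmul_eq_mul] at this
    linarith

namespace JTGFamily

variable (𝓕 : JTGFamily)

/-- Finitely many of the norms `‖·‖_{F_j}` can be made small at once. -/
lemma exists_mem_span_supOn_le (p : ℕ) : ∀ {x : ℕ → C00}, IsBlockSequence x → ∀ {δ : ℝ}, 0 < δ →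
    ∃ y ∈ Submodule.span ℝ (Set.range x), y ≠ 0 ∧
      ∀ j < p, supOn (𝓕.F j) y ≤ δ * 𝓕.normingUnion.nrm y := by
  induction p with
  | zero => exact fun {x} hx δ _ => ⟨x 0, Submodule.subset_span ⟨0, rfl⟩, hx.1 0, by simp⟩
  | succ p ih =>
    intro x hx δ hδ
    obtain ⟨z, hz, hzR⟩ := exists_blockSequence (id : C00 → C00)
      (fun l y => y ∈ Submodule.span ℝ (Set.range x) ∧
        ∀ j < p, supOn (𝓕.F j) y ≤ δ * (1 / 2) ^ (l.length + 1) * 𝓕.normingUnion.nrm y)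
      (fun l N => by
        obtain ⟨y, hy, h0, hyj⟩ := ih (hx.tail N)
          (show 0 < δ * (1 / 2) ^ (l.length + 1) by positivity)
        refine ⟨y, h0, ?_, Submodule.span_mono ?_ hy, hyj⟩
        · refine support_gt_of_mem_span (fun k n hn => ?_) hy
          have := hx.lt_of_mem_support _ hn
          omega
        · rintro _ ⟨k, rfl⟩; exact ⟨k + N, rfl⟩)
    simp only [Function.id_comp, List.length_map, List.length_range] at hz hzR
    obtain ⟨w, hw, hwp⟩ := 𝓕.strictlySingular z hz p δ hδ
    change _ < δ * 𝓕.normingUnion.nrm w at hwp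
    have hw0 : w ≠ 0 := by
      rintro rfl
      obtain ⟨f, hf, -⟩ := 𝓕.exists_ne_zero p
      have := 𝓕.pair_le_supOn_F hf 0
      rw [pair_zero] at this
      rw [NormingSet.nrm_zero] at hwp
      linarith
    refine ⟨w, ?_, hw0, fun j hj => ?_⟩
    · refine Submodule.span_le.2 ?_ hw
      rintro _ ⟨k, rfl⟩
      exact (hzR k).1
    · rcases Nat.lt_succ_iff_lt_or_eq.1 hj with hj | rfl
      · obtain ⟨g, hg, -⟩ := 𝓕.exists_ne_zero j
        refine csSup_le ⟨_, g, hg, rfl⟩ ?_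
        rintro _ ⟨f, hf, rfl⟩
        obtain ⟨a, rfl⟩ := exists_sum_of_mem_span hw
        have hterm : ∀ k ∈ a.support, pair f (a k • z k) ≤
            δ * 𝓕.normingUnion.nrm (∑ k ∈ a.support, a k • z k) * (1 / 2) ^ (k + 1) := by
          intro k hk
          have h1 := 𝓕.isIntervalClosed_normingUnion.abs_coeff_mul_le hz a.support a hk
          have h2 := (𝓕.abs_pair_le_supOn_F hf (z k)).trans ((hzR k).2 j hj)
          calc pair f (a k • z k) ≤ |a k| * |pair f (z k)| := by
                rw [pair_smul, ← abs_mul]; exact le_abs_self _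
            _ ≤ |a k| * (δ * (1 / 2) ^ (k + 1) * 𝓕.normingUnion.nrm (z k)) := by gcongr
            _ = δ * (|a k| * 𝓕.normingUnion.nrm (z k)) * (1 / 2) ^ (k + 1) := by ring
            _ ≤ _ := by gcongr
        calc pair f (∑ k ∈ a.support, a k • z k) = ∑ k ∈ a.support, pair f (a k • z k) :=
              pair_sum _ _ _
          _ ≤ ∑ k ∈ a.support, _ := sum_le_sum hterm
          _ ≤ δ * 𝓕.normingUnion.nrm (∑ k ∈ a.support, a k • z k) := by
              rw [← mul_sum]
              exact mul_le_of_le_one_right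
                (mul_nonneg hδ.le (NormingSet.nrm_nonneg _ _)) (sum_half_pow_succ_le _)
      · exact hwp.le

namespace Coding

variable {𝓕} (c : 𝓕.Coding)

/-- A `‖·‖_𝒮`-normalized block sequence whose `k`-th term is almost only seen by the functionals with
indices in the window `(p k, q k]`, for successive windows. -/
structure IsWindowed (y : ℕ → C00) (p q : ℕ → ℕ) (η : ℝ) : Prop where
  block : IsBlockSequence y
  le : ∀ k, p k ≤ q k
  succ : ∀ k m, k < m → q k ≤ p m
  nrm : ∀ k, c.normingS.nrm (y k) = 1
  low : ∀ k, ∀ j ≤ p k, ∀ f ∈ 𝓕.F j, |pair f (y k)| ≤ η / (p k + 1)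
  high : ∀ k, 𝓕.tauTail (q k) * l1 (y k) ≤ η

variable {c}

lemma IsWindowed.comp {y : ℕ → C00} {p q : ℕ → ℕ} {η : ℝ} (h : c.IsWindowed y p q η) {φ : ℕ → ℕ}
    (hφ : StrictMono φ) : c.IsWindowed (y ∘ φ) (p ∘ φ) (q ∘ φ) η :=
  ⟨h.block.comp hφ, fun _ => h.le _, fun _ _ hk => h.succ _ _ (hφ hk), fun _ => h.nrm _,
    fun _ => h.low _, fun _ => h.high _⟩

variable (c) in
/-- The bound `η / (p + 1)` in `IsWindowed` allows for the at most `p` terms of a special functional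
with indices up to `p`; the upper end of the window is chosen after the vector. -/
lemma exists_isWindowed {x : ℕ → C00} (hx : IsBlockSequence x) {η : ℝ} (hη : 0 < η) (N₀ : ℕ) :
    ∃ y p q, c.IsWindowed y p q η ∧ (∀ k, y k ∈ Submodule.span ℝ (Set.range x)) ∧
      ∀ k, ∀ n ∈ (y k).support, N₀ < (n : ℕ) := by
  obtain ⟨s, hs, hR⟩ := exists_blockSequence (fun a : C00 × ℕ × ℕ => a.1)
    (fun l a => (a.2.1 ≤ a.2.2 ∧ (∀ b ∈ l, b.2.2 ≤ a.2.1) ∧ c.normingS.nrm a.1 = 1 ∧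
      (∀ j ≤ a.2.1, ∀ f ∈ 𝓕.F j, |pair f a.1| ≤ η / (a.2.1 + 1)) ∧
      𝓕.tauTail a.2.2 * l1 a.1 ≤ η) ∧ a.1 ∈ Submodule.span ℝ (Set.range x) ∧
      ∀ n ∈ a.1.support, N₀ < (n : ℕ)) (fun l N => by
      have hp : ∃ p : ℕ, ∀ b ∈ l, b.2.2 ≤ p := by
        induction l with
        | nil => exact ⟨0, by simp⟩
        | cons b l ih =>
          obtain ⟨p, hp⟩ := ih
          refine ⟨max b.2.2 p, fun d hd => ?_⟩
          rcases List.mem_cons.1 hd with rfl | hd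
          · exact le_max_left _ _
          · exact (hp d hd).trans (le_max_right _ _)
      obtain ⟨p, hp⟩ := hp
      obtain ⟨y, hy, h0, hyj⟩ := 𝓕.exists_mem_span_supOn_le (p + 1) (hx.tail (max N N₀))
        (show 0 < η / (p + 1) by positivity)
      have hpos := c.normingS.nrm_pos h0
      set z := (c.normingS.nrm y)⁻¹ • y with hz
      have hzmem : z ∈ Submodule.span ℝ (Set.range fun k => x (k + max N N₀)) :=
        Submodule.smul_mem _ _ hy
      have hzsupp : ∀ n ∈ z.support, max N N₀ < (n : ℕ) :=
        support_gt_of_mem_span (fun k n hn => by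
          have := hx.lt_of_mem_support _ hn
          omega) hzmem
      obtain ⟨q, hq, hqz⟩ := 𝓕.exists_pos_tauTail_mul_le p (l1 z) hη
      refine ⟨(z, p, q), smul_ne_zero (inv_ne_zero hpos.ne') h0,
        fun n hn => (le_max_left _ _).trans_lt (hzsupp n hn), ⟨hq, hp, ?_, ?_, hqz⟩, ?_,
        fun n hn => (le_max_right _ _).trans_lt (hzsupp n hn)⟩
      · rw [hz, NormingSet.nrm_smul, abs_inv, abs_of_pos hpos, inv_mul_cancel₀ hpos.ne']
      · intro j hj f hf
        have h1 : |pair f y| ≤ η / (p + 1) * c.normingS.nrm y :=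
          (𝓕.abs_pair_le_supOn_F hf y).trans ((hyj j (Nat.lt_succ_of_le hj)).trans (by
            gcongr
            exact normingUnion_le_normingS y))
        rw [hz, pair_smul, abs_mul, abs_inv, abs_of_pos hpos, inv_mul_le_iff₀ hpos, mul_comm]
        exact h1
      · refine Submodule.span_mono ?_ hzmem
        rintro _ ⟨k, rfl⟩; exact ⟨k + max N N₀, rfl⟩)
  refine ⟨fun k => (s k).1, fun k => (s k).2.1, fun k => (s k).2.2,
    ⟨hs, fun k => (hR k).1.1, fun k m hkm => (hR m).1.2.1 _ ?_, fun k => (hR k).1.2.2.1,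
      fun k => (hR k).1.2.2.2.1, fun k => (hR k).1.2.2.2.2⟩, fun k => (hR k).2.1,
    fun k => (hR k).2.2⟩
  exact List.mem_map.2 ⟨k, List.mem_range.2 hkm, rfl⟩

end Coding
end JTGFamily

/-! ### Special sequences that see a windowed block sequence -/

namespace JTGFamily
namespace Coding

variable {𝓕 : JTGFamily} {c : 𝓕.Coding}

/-- The indices above `p` of the terms after the first of a special sequence. -/
def tailIndices (c : 𝓕.Coding) (l : List C00) (p : ℕ) : Set ℕ :=
  {j | ∃ i : Fin l.length, 1 ≤ i.1 ∧ j = c.termIndex l i} ∩ Set.Ioi p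

lemma exists_take_eq_of_not_disjoint {l l' : List C00} (hl : c.IsSpecial l) (hl' : c.IsSpecial l')
    {p : ℕ} (h : ¬ Disjoint (c.tailIndices l p) (c.tailIndices l' p)) :
    ∃ r, r < l.length ∧ r < l'.length ∧ 1 ≤ r ∧ l.take r = l'.take r ∧ p < c.σ (l.take r) := by
  obtain ⟨j, ⟨⟨i, hi, hij⟩, hj⟩, ⟨i', hi', hij'⟩, -⟩ := Set.not_disjoint_iff.1 h
  have h1 : j = c.σ (l.take i) := by rw [hij, termIndex, if_neg (by omega)]
  have h2 : j = c.σ (l'.take i') := by rw [hij', termIndex, if_neg (by omega)]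
  have heq := c.σ_injOn (hl.take_mem_W (i := i) (by omega)) (hl'.take_mem_W (i := i') (by omega))
    (h1.symm.trans h2)
  have hlen := congrArg List.length heq
  have h3 := i.2
  have h4 := i'.2
  rw [List.length_take, List.length_take, min_eq_left h3.le, min_eq_left h4.le] at hlen
  refine ⟨i, h3, hlen ▸ h4, hi, ?_, h1 ▸ hj⟩
  rw [heq, hlen]

/-- Every special sequence that sees `y` has a nonempty initial segment in common with one of `D`
given ones: Bessel's inequality bounds the size of a family with disjoint indices, and a common
index determines the preceding terms. The first terms are left out, since their indices are not
values of the coding. -/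
lemma exists_finite_histories {y : C00} {p : ℕ} {η δ B : ℝ} {D : ℕ}
    (hlow : ∀ j ≤ p, ∀ f ∈ 𝓕.F j, |pair f y| ≤ η / (p + 1)) (hM : c.norming₂ₛ.nrm y ≤ B)
    (hη0 : 0 ≤ η) (hη : η ≤ δ / 2) (hδ : 0 < δ) (hD : B ^ 2 < (D + 1) * (δ / 2) ^ 2)
    (hsupp : ∀ n ∈ y.support, D + 1 ≤ (n : ℕ)) :
    ∃ h : Fin D → List C00, (∀ i, c.IsSpecial (h i)) ∧
      ∀ l, c.IsSpecial l → δ ≤ |pair (l.drop 1).sum y| →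
        ∃ i, ∃ r, r < l.length ∧ r < (h i).length ∧ 1 ≤ r ∧ l.take r = (h i).take r ∧
          p < c.σ (l.take r) := by
  classical
  have hpiece : ∀ l, c.IsSpecial l → δ ≤ |pair (l.drop 1).sum y| → ∃ x I, c.HasIndex x I ∧
      I ⊆ c.tailIndices l p ∧ (∀ n ∈ x.support, D + 1 ≤ (n : ℕ)) ∧ δ / 2 ≤ |pair x y| := by
    intro l hl hly
    obtain ⟨x₁, x₂, hx, hx₁, hx₂⟩ := (hl.hasIndex_drop 1).split p
    obtain ⟨I, hI, hxI⟩ := hx₂.restrict (ordConnected_hull y)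
    refine ⟨_, I, hxI, hI, ?_, ?_⟩
    · intro n hn
      obtain ⟨a, ha, -, -, han, -⟩ := (mem_support_restrict.1 hn).1
      exact (hsupp a ha).trans (PNat.coe_le_coe _ _ |>.2 han)
    · rw [pair_restrict_of_subset (subset_hull y)]
      have h1 : |pair x₁ y| ≤ η := by
        refine (hx₁.abs_pair_le_of_le Set.inter_subset_right (by positivity) hlow).trans ?_
        rw [mul_div_assoc', div_le_iff₀ (by positivity)]
        nlinarith
      rw [hx, pair_add_left] at hly
      have := abs_add_le (pair x₁ y) (pair x₂ y)
      linarith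
  choose! x I hxI hI hxs hxy using hpiece
  let good : Finset (List C00) → Prop := fun s =>
    (∀ l ∈ s, c.IsSpecial l ∧ δ ≤ |pair (l.drop 1).sum y|) ∧
      (s : Set (List C00)).PairwiseDisjoint fun l => c.tailIndices l p
  have hcard : ∀ s, good s → #s ≤ D := by
    intro s hs
    by_contra! hlt
    obtain ⟨t, hts, ht⟩ := exists_subset_card_eq (Nat.succ_le_of_lt hlt)
    have hst : ∀ l ∈ t, c.IsSpecial l ∧ δ ≤ |pair (l.drop 1).sum y| := fun l hl => hs.1 l (hts hl)
    have h1 := sum_sq_pair_le_norming₂ₛ (c := c) (s := t) (x := x) (I := I)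
      (fun l hl => hxI l (hst l hl).1 (hst l hl).2)
      (fun l hl l' hl' hne => (hs.2 (hts hl) (hts hl') hne).mono
        (hI l (hst l hl).1 (hst l hl).2) (hI l' (hst l' hl').1 (hst l' hl').2))
      (fun l hl n hn => ht ▸ hxs l (hst l hl).1 (hst l hl).2 n hn) y
    have h2 : (#t : ℝ) * (δ / 2) ^ 2 ≤ ∑ l ∈ t, pair (x l) y ^ 2 := by
      rw [← nsmul_eq_mul]
      refine card_nsmul_le_sum t _ _ fun l hl => ?_
      rw [← sq_abs (pair _ _)]
      gcongr
      exact hxy l (hst l hl).1 (hst l hl).2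
    have h3 : c.norming₂ₛ.nrm y ^ 2 ≤ B ^ 2 := by
      gcongr
      exact NormingSet.nrm_nonneg _ _
    rw [ht] at h2
    push_cast at h2
    linarith
  -- A family of largest size.
  obtain ⟨m, ⟨s, hs, hsm⟩, hmax⟩ : ∃ m, (∃ s, good s ∧ #s = m) ∧ ¬ ∃ s, good s ∧ #s = m + 1 := by
    by_contra! hcon
    have : ∀ m, ∃ s, good s ∧ #s = m := by
      intro m
      induction m with
      | zero => exact ⟨∅, ⟨by simp, by simp⟩, by simp⟩
      | succ m ih => exact hcon m ih
    obtain ⟨s, hs, hsD⟩ := this (D + 1)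
    have := hcard s hs
    omega
  obtain ⟨l₀, hl₀⟩ := c.exists_isSpecial
  refine ⟨fun i => s.toList.getD i l₀, fun i => ?_, fun l hl hly => ?_⟩
  · by_cases hi : i.1 < s.toList.length
    · simp only [List.getD_eq_getElem _ _ hi]
      exact (hs.1 _ (mem_toList.1 (List.getElem_mem hi))).1
    · simpa only [List.getD_eq_default _ _ (not_lt.1 hi)] using hl₀
  · obtain ⟨l', hl', hdis⟩ : ∃ l' ∈ s, ¬ Disjoint (c.tailIndices l p) (c.tailIndices l' p) := by
      by_contra! hcon
      have hls : l ∉ s := by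
        intro hls
        have h0 : pair (x l) y ≠ 0 := fun h0 => by
          have := hxy l hl hly
          rw [h0, abs_zero] at this
          linarith
        obtain ⟨n, hn⟩ : ∃ n, x l n ≠ 0 := by
          by_contra! h
          exact h0 (pair_eq_zero fun n _ => h n)
        obtain ⟨j, hj, -⟩ := HasIndex.bound c (hxI l hl hly) hn
        exact Set.disjoint_left.1 (hcon l hls) (hI l hl hly hj) (hI l hl hly hj)
      refine hmax ⟨insert l s, ⟨?_, ?_⟩, by rw [card_insert_of_notMem hls, hsm]⟩
      · intro l' hl'
        rcases mem_insert.1 hl' with rfl | hl'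
        exacts [⟨hl, hly⟩, hs.1 l' hl']
      · rw [coe_insert]
        exact hs.2.insert fun l' hl' _ => hcon l' hl'
    obtain ⟨i, hi, hil⟩ := List.getElem_of_mem (mem_toList.2 hl')
    have hiD : i < D := by
      have := hcard s hs
      rw [length_toList] at hi
      omega
    refine ⟨⟨i, hiD⟩, ?_⟩
    simp only [List.getD_eq_getElem _ _ hi, hil]
    exact exists_take_eq_of_not_disjoint hl (hs.1 l' hl').1 hdis

/-- Special sequences with a common initial segment act almost identically on a vector that is
negligible for the indices that follow. -/
lemma IsSpecial.abs_pair_sub_le {l l' : List C00} (hl : c.IsSpecial l) (hl' : c.IsSpecial l')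
    {r q : ℕ} (hr : 1 ≤ r) (hrl : r < l.length) (hrl' : r < l'.length)
    (heq : l.take r = l'.take r) (hq : q < c.σ (l.take r)) (y : C00) :
    |pair (l.drop 1).sum y - pair (l'.drop 1).sum y| ≤ 2 * (𝓕.tauTail q * l1 y) := by
  -- The common initial segment cancels; the remaining indices are at least the next coding value.
  have hsplit : ∀ l : List C00, (l.drop 1).sum = ((l.take r).drop 1).sum + (l.drop r).sum := by
    intro l
    have h1 : l.drop 1 = (l.take r).drop 1 ++ l.drop r := by
      conv_lhs => rw [← List.take_append_drop r l, List.drop_append]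
      rcases Nat.lt_or_ge 0 l.length with h | h
      · rw [show 1 - (l.take r).length = 0 by rw [List.length_take]; omega, List.drop_zero]
      · rw [List.length_eq_zero_iff.1 (Nat.le_zero.1 h)]; simp
    rw [h1, List.sum_append]
  have htail : ∀ l : List C00, c.IsSpecial l → r < l.length → q < c.σ (l.take r) →
      |pair (l.drop r).sum y| ≤ 𝓕.tauTail q * l1 y := by
    intro l hl hrl hq
    refine (hl.hasIndex_drop r).abs_pair_le_tauTail ?_ y
    rintro j ⟨i, hi, rfl⟩
    have h1 : c.termIndex l ⟨r, hrl⟩ = c.σ (l.take r) := by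
      rw [termIndex, if_neg (by simp; omega)]
    exact (h1 ▸ hq).trans_le (hl.termIndex_strictMono.monotone (Fin.le_def.2 hi))
  rw [hsplit l, hsplit l', pair_add_left, pair_add_left, heq, add_sub_add_left_eq_sub]
  refine (abs_sub _ _).trans ?_
  have h1 := htail l hl hrl hq
  have h2 := htail l' hl' hrl' (heq ▸ hq)
  linarith

namespace IsWindowed

variable {y : ℕ → C00} {p q : ℕ → ℕ} {η : ℝ}

lemma nonneg (h : c.IsWindowed y p q η) : 0 ≤ η :=
  (mul_nonneg (𝓕.tauTail_nonneg _) (l1_nonneg _)).trans (h.high 0)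

lemma low_le (h : c.IsWindowed y p q η) {k j : ℕ} (hj : j ≤ p k) {f : C00} (hf : f ∈ 𝓕.F j) :
    |pair f (y k)| ≤ η :=
  (h.low k j hj f hf).trans (div_le_self h.nonneg (by simp))

/-- Each `F_j` sees at most one term of a windowed sequence. -/
lemma nrm_union_sum_le (h : c.IsWindowed y p q η) (n : ℕ) {θ : ℕ → ℝ} (hθ : ∀ k, |θ k| ≤ 1) :
    𝓕.normingUnion.nrm (∑ k ∈ range n, θ k • y k) ≤ 1 + n * η := by
  refine NormingSet.nrm_le _ fun f hf => ?_
  obtain ⟨j, hj⟩ := Set.mem_iUnion.1 hf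
  rw [pair_sum]
  have hterm : ∀ k, pair f (θ k • y k) ≤ |pair f (y k)| := fun k => by
    rw [pair_smul]
    refine (le_abs_self _).trans ?_
    rw [abs_mul]
    exact mul_le_of_le_one_left (abs_nonneg _) (hθ k)
  refine (sum_le_sum fun k _ => hterm k).trans ?_
  have hle : ∀ k, |pair f (y k)| ≤ 1 := fun k => h.nrm k ▸ abs_pair_le_normingS hj (y k)
  have hwin : ∀ k, η < |pair f (y k)| → p k < j ∧ j ≤ q k := by
    intro k hk
    refine ⟨lt_of_not_ge fun hjk => absurd (h.low_le hjk hj) (not_le.2 hk), ?_⟩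
    by_contra! hjq
    have := abs_pair_le_mul_l1 (x := y k) fun n _ => 𝓕.abs_le_tauTail hjq hj n
    exact absurd (this.trans (h.high k)) (not_le.2 hk)
  have := sum_le_one_add_card_mul (s := range n) h.nonneg (fun k _ => hle k)
    (fun k _ m _ hk hm => by
      have h1 := hwin k hk
      have h2 := hwin m hm
      rcases lt_trichotomy k m with hkm | hkm | hkm
      · have := h.succ k m hkm; omega
      · exact hkm
      · have := h.succ m k hkm; omega)
  simpa using this

/-- Each term of a windowed sequence is almost normed by a functional with indices in its window. -/
lemma exists_hasIndex (h : c.IsWindowed y p q η) (hη : η ≤ 1 / 8) (k : ℕ) :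
    ∃ b I, c.HasIndex b I ∧ I ⊆ Set.Ioc (p k) (q k) ∧ 1 / 4 ≤ |pair b (y k)| := by
  obtain ⟨f, hf, hfy⟩ := c.normingS.exists_lt_pair (x := y k) (c := 1 / 2)
    (by rw [h.nrm]; norm_num)
  obtain ⟨b, I, hb, hby⟩ : ∃ b I, c.HasIndex b I ∧ 1 / 2 < |pair b (y k)| := by
    rcases hf with hf | ⟨I, hf | hf⟩
    · have := (le_abs_self _).trans (h.low_le (Nat.zero_le (p k)) hf)
      linarith
    · exact ⟨f, I, hf, hfy.trans_le (le_abs_self _)⟩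
    · refine ⟨-f, I, hf, ?_⟩
      rw [pair_neg_left, abs_neg]
      exact hfy.trans_le (le_abs_self _)
  obtain ⟨b₁, b₂, rfl, hb₁, hb₂⟩ := hb.split (p k)
  obtain ⟨b₃, b₄, rfl, hb₃, hb₄⟩ := hb₂.split (q k)
  refine ⟨b₃, _, hb₃, fun j hj => ⟨hj.1.2, hj.2⟩, ?_⟩
  have h1 : |pair b₁ (y k)| ≤ η := by
    refine (hb₁.abs_pair_le_of_le Set.inter_subset_right
      (div_nonneg h.nonneg (by positivity)) (h.low k)).trans ?_
    rw [mul_div_assoc', div_le_iff₀ (by positivity)]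
    nlinarith [h.nonneg]
  have h2 : |pair b₄ (y k)| ≤ η :=
    (hb₄.abs_pair_le_tauTail Set.inter_subset_right _).trans (h.high k)
  rw [pair_add_left, pair_add_left] at hby
  have h3 := abs_add_le (pair b₁ (y k)) (pair b₃ (y k) + pair b₄ (y k))
  have h4 := abs_add_le (pair b₃ (y k)) (pair b₄ (y k))
  linarith

/-- A lower `ℓ₂` estimate for windowed sequences. -/
lemma card_div_le_nrm_sq (h : c.IsWindowed y p q η) (hη : η ≤ 1 / 8) {n : ℕ}
    (hn : ∀ k, ∀ m ∈ (y k).support, n ≤ (m : ℕ)) {θ : ℕ → ℝ} (hθ : ∀ k, |θ k| = 1) :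
    (n : ℝ) / 16 ≤ c.norming₂ₛ.nrm (∑ k ∈ range n, θ k • y k) ^ 2 := by
  choose b I hb hI hby using h.exists_hasIndex hη
  choose J hJ hbJ using fun k => (hb k).restrict (ordConnected_hull (y k))
  have hbessel := sum_sq_pair_le_norming₂ₛ (c := c) (s := range n)
    (x := fun k => C00.restrict (hull (y k)) (b k)) (I := J) (fun k _ => hbJ k)
    (fun k _ m _ hkm => by
      refine Set.disjoint_left.2 fun j hjk hjm => ?_
      have h1 := hI k (hJ k hjk)
      have h2 := hI m (hJ m hjm)
      rcases lt_or_gt_of_ne hkm with hkm | hkm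
      · have := h.succ k m hkm; have := h1.2; have := h2.1; omega
      · have := h.succ m k hkm; have := h1.1; have := h2.2; omega)
    (fun k _ m hm => by
      obtain ⟨a, ha, -, -, ham, -⟩ := (mem_support_restrict.1 hm).1
      rw [card_range]
      exact (hn k a ha).trans (PNat.coe_le_coe _ _ |>.2 ham))
    (∑ k ∈ range n, θ k • y k)
  refine le_trans ?_ hbessel
  have : (n : ℝ) / 16 = ∑ _k ∈ range n, (1 / 16 : ℝ) := by simp [div_eq_mul_inv]
  rw [this]
  refine sum_le_sum fun k hk => ?_
  rw [pair_restrict, h.block.restrict_hull (range n) θ hk, pair_smul, mul_pow, ← sq_abs (θ k), hθ,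
    one_pow, one_mul, ← sq_abs]
  nlinarith [hby k]

end IsWindowed
end Coding
end JTGFamily

/-! ### Vectors that are small on all special functionals -/

namespace C00

/-- Bounds for the initial sums of a combination of a block sequence pass to restrictions to initial
intervals. -/
lemma abs_pair_restrict_lowerSet_le {w : ℕ → C00} (hw : IsBlockSequence w) {t : C00} {θ : ℕ → ℝ}
    {C₁ C₂ : ℝ} {U : Set ℕ+} (hU : IsLowerSet U) {n : ℕ}
    (h1 : ∀ m ≤ n, |∑ r ∈ range m, θ r * pair t (w r)| ≤ C₁)
    (h2 : ∀ r, |θ r * pair (restrict U t) (w r)| ≤ C₂) :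
    |pair (restrict U t) (∑ r ∈ range n, θ r • w r)| ≤ C₁ + C₂ := by
  have hC₂ : 0 ≤ C₂ := (abs_nonneg _).trans (h2 0)
  simp only [pair_sum, pair_smul]
  -- Up to some term the supports lie in `U`, and after that term they are disjoint from `U`.
  suffices H : ∀ m ≤ n, |∑ r ∈ range m, θ r * pair (restrict U t) (w r)| ≤ C₁ + C₂ ∧
      ((∀ r < m, ∀ k ∈ (w r).support, k ∈ U) ∨ ∀ r, m ≤ r → pair (restrict U t) (w r) = 0) from
    (H n le_rfl).1
  intro m
  induction m with
  | zero =>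
    intro _
    have := h1 0 (Nat.zero_le n)
    simp only [range_zero, sum_empty, abs_zero] at this ⊢
    exact ⟨by linarith, Or.inl fun r hr => absurd hr (Nat.not_lt_zero r)⟩
  | succ m ih =>
    intro hm
    obtain ⟨hb, hin | hout⟩ := ih (by omega)
    · have heq : ∀ m' ≤ m, ∑ r ∈ range m', θ r * pair (restrict U t) (w r) =
          ∑ r ∈ range m', θ r * pair t (w r) := fun m' hm' => sum_congr rfl fun r hr => by
        rw [pair_restrict_of_subset (hin r ((mem_range.1 hr).trans_le hm'))]
      by_cases hmU : ∀ k ∈ (w m).support, k ∈ U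
      · refine ⟨?_, Or.inl fun r hr => ?_⟩
        · rw [sum_range_succ, heq m le_rfl, pair_restrict_of_subset hmU, ← sum_range_succ]
          exact (h1 (m + 1) hm).trans (by linarith)
        · rcases Nat.lt_succ_iff_lt_or_eq.1 hr with hr | rfl
          exacts [hin r hr, hmU]
      · push Not at hmU
        obtain ⟨k, hk, hkU⟩ := hmU
        refine ⟨?_, Or.inr fun r hr => ?_⟩
        · rw [sum_range_succ, heq m le_rfl]
          exact (abs_add_le _ _).trans (add_le_add (h1 m (by omega)) (h2 m))
        · refine pair_eq_zero fun a ha => restrict_of_notMem (fun haU => hkU ?_) t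
          exact hU (hw.before (Nat.lt_of_succ_le hr) k hk a ha).le haU
    · refine ⟨?_, Or.inr fun r hr => hout r (by omega)⟩
      rw [sum_range_succ, hout m le_rfl, mul_zero, add_zero]
      exact hb

end C00

namespace JTGFamily
namespace Coding

variable {𝓕 : JTGFamily} {c : 𝓕.Coding}

lemma abs_pair_restrict_drop_le {l : List C00} (hl : c.IsSpecial l) {E : Set ℕ+}
    (hE : E.OrdConnected) (y : C00) :
    |pair (C00.restrict E (l.drop 1).sum) y| ≤ c.normingS.nrm y := by
  obtain ⟨I, -, hI⟩ := (hl.hasIndex_drop 1).restrict hE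
  exact hI.abs_pair_le y

/-- If the tails of special sequences are bounded on the initial sums of a combination of a block
sequence, then so are all functionals of `𝒮 ∪ ⋃ F_j` on the combination. -/
lemma nrm_normingS_le {w : ℕ → C00} (hw : IsBlockSequence w) {θ : ℕ → ℝ} {C₁ C₂ : ℝ} {n : ℕ}
    (hθ : ∀ r, |θ r| ≤ 1) (hnrm : ∀ r, c.normingS.nrm (w r) ≤ 1)
    (h1 : ∀ l, c.IsSpecial l → ∀ m ≤ n, |∑ r ∈ range m, θ r * pair (l.drop 1).sum (w r)| ≤ C₁)
    (h2 : 𝓕.normingUnion.nrm (∑ r ∈ range n, θ r • w r) ≤ C₂) :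
    c.normingS.nrm (∑ r ∈ range n, θ r • w r) ≤ C₂ + 2 * (C₁ + 1) := by
  set x := ∑ r ∈ range n, θ r • w r with hx
  obtain ⟨l₀, hl₀⟩ := c.exists_isSpecial
  have hC₁ : 0 ≤ C₁ := (abs_nonneg _).trans (h1 l₀ hl₀ 0 (Nat.zero_le n))
  have hunion : ∀ j, ∀ f ∈ 𝓕.F j, |pair f x| ≤ C₂ := fun j f hf =>
    (𝓕.normingUnion.abs_pair_le (Set.mem_iUnion.2 ⟨j, hf⟩) x).trans h2
  have hind : ∀ b I, c.HasIndex b I → |pair b x| ≤ C₂ + 2 * (C₁ + 1) := by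
    rintro b I (⟨l, E, hl, hE, rfl, -⟩ | ⟨j, hj, hb, -⟩)
    · have hlower : ∀ U : Set ℕ+, IsLowerSet U →
          |pair (C00.restrict U (l.drop 1).sum) x| ≤ C₁ + 1 := fun U hU =>
        abs_pair_restrict_lowerSet_le hw hU (h1 l hl) fun r => by
          rw [abs_mul]
          exact mul_le_one₀ (hθ r) (abs_nonneg _)
            ((abs_pair_restrict_drop_le hl hU.ordConnected _).trans (hnrm r))
      -- An interval is the difference of two initial intervals.
      have hdiff : C00.restrict E (l.drop 1).sum =
          C00.restrict (lowerClosure E) (l.drop 1).sum -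
            C00.restrict (↑(lowerClosure E) \ E) (l.drop 1).sum := by
        ext k
        rw [Finsupp.sub_apply]
        by_cases hk : k ∈ E
        · rw [restrict_of_mem hk, restrict_of_mem (subset_lowerClosure hk),
            restrict_of_notMem fun h => h.2 hk, sub_zero]
        · by_cases hk' : k ∈ (lowerClosure E : Set ℕ+)
          · rw [restrict_of_notMem hk, restrict_of_mem hk',
              restrict_of_mem (E := ↑(lowerClosure E) \ E) ⟨hk', hk⟩, sub_self]
          · rw [restrict_of_notMem hk, restrict_of_notMem hk',
              restrict_of_notMem fun h => hk' h.1, sub_self]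
      have hU₂ : IsLowerSet ((lowerClosure E : Set ℕ+) \ E) := by
        rintro a b hba ⟨ha, haE⟩
        refine ⟨(lowerClosure E).lower hba ha, fun hb => haE ?_⟩
        obtain ⟨e, he, hae⟩ := mem_lowerClosure.1 ha
        exact hE.out hb he ⟨hba, hae⟩
      have hd := hlower _ (lowerClosure E).lower
      have hd' := hlower _ hU₂
      obtain ⟨f, t, rfl⟩ := List.exists_cons_of_ne_nil hl.1.1
      obtain ⟨-, j, hj, hf⟩ := hl.1.2.1 f (by simp)
      have hfx := hunion j _ (𝓕.restrict_mem j hj f hf E hE)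
      rw [List.sum_cons, restrict_add, pair_add_left]
      rw [List.drop_one, List.tail_cons] at hdiff hd hd'
      rw [hdiff, pair_sub_left]
      refine (abs_add_le _ _).trans ?_
      have := abs_sub (pair (C00.restrict (lowerClosure E) t.sum) x)
        (pair (C00.restrict (↑(lowerClosure E) \ E) t.sum) x)
      linarith
    · have := hunion j b hb
      linarith
  refine NormingSet.nrm_le _ fun b hb => ?_
  rcases hb with hb | ⟨I, hb | hb⟩
  · have := (le_abs_self _).trans (hunion 0 b hb)
    linarith
  · exact (le_abs_self _).trans (hind b I hb)
  · rw [← neg_neg b, pair_neg_left]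
    exact (neg_le_abs _).trans (hind _ I hb)

/-- On the span of a block sequence, no multiple of `‖·‖_𝒮` dominates the norm of `𝓕_{2,s}`. This
drives all three saturation results, since the other two norms dominate that of `𝓕_{2,s}`. -/
theorem exists_mem_span_nrm_normingS_lt (c : 𝓕.Coding) {x : ℕ → C00} (hx : IsBlockSequence x)
    {ε : ℝ} (hε : 0 < ε) :
    ∃ y ∈ Submodule.span ℝ (Set.range x), y ≠ 0 ∧
      c.normingS.nrm y < ε * c.norming₂ₛ.nrm y := by
  by_contra! hcon
  -- The signed sum below has `‖·‖_𝒮` at most `12` and norm at least `√n / 4`; `2304 = 16 * 12²`.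
  obtain ⟨n, hn⟩ := exists_nat_gt (max 1 (2304 / ε ^ 2))
  have hn1 : (1 : ℝ) < n := (le_max_left _ _).trans_lt hn
  have hn0 : (0 : ℝ) < n := by linarith
  have hnε : 2304 < n * ε ^ 2 := by
    have := (le_max_right _ _).trans_lt hn
    rwa [div_lt_iff₀ (by positivity)] at this
  obtain ⟨D, hD⟩ := exists_nat_gt ((1 / ε) ^ 2 / (1 / n / 2 : ℝ) ^ 2)
  rw [div_lt_iff₀ (by positivity)] at hD
  set δ : ℝ := 1 / n with hδ
  have hδ0 : 0 < δ := by positivity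
  have hδ1 : δ ≤ 1 := by rw [hδ, div_le_one hn0]; exact hn1.le
  obtain ⟨y, p, q, hy, hyx, hysupp⟩ := c.exists_isWindowed hx (η := δ / 8) (by positivity)
    (max (D + 1) n)
  have hyM : ∀ k, c.norming₂ₛ.nrm (y k) ≤ 1 / ε := fun k => by
    have := hcon (y k) (hyx k) (hy.block.1 k)
    rw [hy.nrm] at this
    rwa [le_div_iff₀ hε, mul_comm]
  -- `h k i`, `i < D`, are the possible pasts of the special sequences that see `y k`.
  choose h hh1 hh2 using fun k => exists_finite_histories (c := c) (y := y k) (p := p k)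
    (η := δ / 8) (δ := δ) (B := 1 / ε) (D := D) (hy.low k) (hyM k) (by positivity) (by linarith)
    hδ0 (hD.trans_le (by gcongr; linarith)) (fun n hn => by
      have := hysupp k n hn
      exact (le_max_left _ _).trans this.le)
  obtain ⟨φ, hφ, G, hG, hφG⟩ := exists_strictMono_forall_abs_sub_le
    (fun k i m => pair ((h k i).drop 1).sum (y m)) (fun k i m => by
      have := abs_pair_restrict_drop_le (hh1 k i) Set.ordConnected_univ (y m)
      rwa [restrict_univ, hy.nrm] at this) hδ0
  have hw := hy.comp hφ
  set θ : ℕ → ℝ := fun r => (-1) ^ r with hθ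
  have hθ1 : ∀ r, |θ r| = 1 := fun r => by simp [hθ]
  set v := ∑ r ∈ range n, θ r • (y ∘ φ) r with hv
  have hvS : c.normingS.nrm v ≤ 12 := by
    have h1 := nrm_normingS_le (c := c) hw.block (θ := θ) (n := n) (C₁ := 4) (C₂ := 2)
      (fun r => (hθ1 r).le) (fun r => (hw.nrm r).le) (fun l hl m hm => ?_) ?_
    · linarith
    · refine (abs_alternating_sum_le (δ := δ) hδ0.le (fun r => ?_) (fun m hm => ?_) m).trans ?_
      · have := abs_pair_restrict_drop_le hl Set.ordConnected_univ ((y ∘ φ) r)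
        rwa [restrict_univ, hw.nrm] at this
      · obtain ⟨i, r₀, hr1, hr2, hr3, hr4, hr5⟩ := hh2 (φ m) l hl hm
        refine ⟨G i, hG i, fun r hr => ?_⟩
        have h1 := hφG r m hr i
        have h2 := hl.abs_pair_sub_le (hh1 (φ m) i) hr3 hr1 hr2 hr4
          ((hy.succ _ _ (hφ hr)).trans_lt hr5) (y (φ r))
        have h3 := hy.high (φ r)
        have h4 := abs_sub_le (pair (l.drop 1).sum (y (φ r)))
          (pair ((h (φ m) i).drop 1).sum (y (φ r))) (G i)
        simp only [Function.comp_apply]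
        linarith
      · have : δ * m ≤ 1 := by
          rw [hδ, one_div, inv_mul_le_iff₀ hn0, mul_one]
          exact_mod_cast hm
        linarith
    · refine (hw.nrm_union_sum_le n fun r => (hθ1 r).le).trans ?_
      have : (n : ℝ) * (δ / 8) = 1 / 8 := by rw [hδ]; field_simp
      linarith
  have hvM := hw.card_div_le_nrm_sq (by linarith) (n := n) (fun k m hm =>
    (le_max_right _ _).trans (hysupp (φ k) m hm).le) hθ1
  rw [← hv] at hvM
  have hv0 : v ≠ 0 := hw.block.sum_ne_zero (range n) θ (m := 0)
    (mem_range.2 (by exact_mod_cast hn0)) (by simp [hθ])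
  have hvx : v ∈ Submodule.span ℝ (Set.range x) :=
    Submodule.sum_mem _ fun r _ => Submodule.smul_mem _ _ (hyx _)
  have h1 := (hcon v hvx hv0).trans hvS
  have h2 : (ε * c.norming₂ₛ.nrm v) ^ 2 ≤ 12 ^ 2 := by
    have := c.norming₂ₛ.nrm_nonneg v
    gcongr
  nlinarith [sq_nonneg ε]

end Coding
end JTGFamily

/-! ### The gliding hump -/

namespace NormingSet

variable (G : NormingSet)

/-- The inclusion of `c₀₀(ℕ)` in its completion. -/
def emb : C00 →ₗ[ℝ] G.Completed :=
  (UniformSpace.Completion.toComplₗᵢ (𝕜 := ℝ) (E := G.Pre)).toLinearMap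

lemma norm_emb (x : C00) : ‖G.emb x‖ = G.nrm x :=
  UniformSpace.Completion.norm_coe (E := G.Pre) x

lemma denseRange_emb : DenseRange G.emb :=
  UniformSpace.Completion.denseRange_coe (α := G.Pre)

lemma abs_apply_le_nrm (x : C00) (n : ℕ+) : |x n| ≤ G.nrm x := by
  rw [← pair_single_left]
  exact G.abs_pair_le (G.single_mem n) x

lemma nrm_le_l1 (x : C00) : G.nrm x ≤ l1 x := G.nrm_le fun _ hf => G.pair_le hf x

/-- The coordinate functionals on the completion. -/
def coord (n : ℕ+) : G.Completed →L[ℝ] ℝ := (Finsupp.lapply n : C00 →ₗ[ℝ] ℝ).extendOfNorm G.emb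

lemma coord_bound (n : ℕ+) (x : C00) : ‖(Finsupp.lapply n : C00 →ₗ[ℝ] ℝ) x‖ ≤ 1 * ‖G.emb x‖ := by
  rw [one_mul, norm_emb]
  exact G.abs_apply_le_nrm x n

lemma coord_emb (n : ℕ+) (x : C00) : G.coord n (G.emb x) = x n :=
  LinearMap.extendOfNorm_eq G.denseRange_emb ⟨1, G.coord_bound n⟩ x

lemma abs_coord_le (n : ℕ+) (v : G.Completed) : |G.coord n v| ≤ ‖v‖ := by
  have := LinearMap.norm_extendOfNorm_apply_le G.denseRange_emb 1 (G.coord_bound n) v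
  rwa [one_mul] at this

variable {G}

/-- An infinite dimensional subspace of the completion contains vectors close to finitely supported
vectors whose supports are arbitrarily far out. -/
lemma exists_mem_norm_sub_emb_lt {Y : Submodule ℝ G.Completed} (hY : ¬ FiniteDimensional ℝ Y)
    (N : ℕ) {η : ℝ} (hη : 0 < η) : ∃ v ∈ Y, ∃ u : C00, G.nrm u = 1 ∧
      (∀ n ∈ u.support, N < (n : ℕ)) ∧ ‖v - G.emb u‖ < η := by
  let L : Y →ₗ[ℝ] (Fin N → ℝ) :=
    LinearMap.pi fun i => (G.coord i.1.succPNat).toLinearMap ∘ₗ Y.subtype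
  obtain ⟨v₀, hv₀L, hv₀⟩ : ∃ v : Y, L v = 0 ∧ v ≠ 0 := by
    by_contra! h
    exact hY (Module.Finite.of_injective L ((injective_iff_map_eq_zero L).2 h))
  have hv₀n : 0 < ‖v₀‖ := norm_pos_iff.2 hv₀
  set v : G.Completed := ‖v₀‖⁻¹ • (v₀ : G.Completed) with hv
  have hvY : v ∈ Y := Y.smul_mem _ v₀.2
  have hv1 : ‖v‖ = 1 := by
    rw [hv, norm_smul, norm_inv, norm_norm]
    exact inv_mul_cancel₀ hv₀n.ne'
  have hvc : ∀ n : ℕ+, (n : ℕ) ≤ N → G.coord n v = 0 := by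
    intro n hn
    have h1 : G.coord n (v₀ : G.Completed) = 0 := by
      have := congrFun hv₀L ⟨n.natPred, by have := n.natPred_add_one; omega⟩
      simpa [L] using this
    rw [hv, map_smul, h1, smul_zero]
  set κ := min η 1 / 3 with hκ
  have hκ0 : 0 < κ := by positivity
  have hκη : κ ≤ η / 3 := by rw [hκ]; gcongr; exact min_le_left _ _
  have hκ1 : κ ≤ 1 / 3 := by rw [hκ]; gcongr; exact min_le_right _ _
  obtain ⟨u₀, hu₀⟩ := G.denseRange_emb.exists_dist_lt v
    (show 0 < κ / (N + 1) by positivity)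
  rw [dist_eq_norm] at hu₀
  set u₁ := restrict {n : ℕ+ | N < (n : ℕ)} u₀ with hu₁
  have hsmall : G.nrm (u₀ - u₁) ≤ N * (κ / (N + 1)) := by
    refine (G.nrm_le_l1 _).trans ?_
    have hs : (u₀ - u₁).support ⊆ (Finset.range N).map ⟨Nat.succPNat, Nat.succPNat_injective⟩ := by
      intro n hn
      by_cases h : N < (n : ℕ)
      · rw [Finsupp.mem_support_iff, Finsupp.sub_apply, hu₁,
          restrict_of_mem (E := {n : ℕ+ | N < (n : ℕ)}) h, sub_self] at hn
        exact absurd rfl hn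
      · rw [Finset.mem_map]
        refine ⟨n.natPred, ?_, by simp⟩
        have := n.natPred_add_one
        rw [Finset.mem_range]
        omega
    have hterm : ∀ n ∈ (u₀ - u₁).support, |(u₀ - u₁) n| ≤ κ / (N + 1) := by
      intro n hn
      have hnN : ¬ N < (n : ℕ) := by
        intro h
        rw [Finsupp.mem_support_iff, Finsupp.sub_apply, hu₁,
          restrict_of_mem (E := {n : ℕ+ | N < (n : ℕ)}) h, sub_self] at hn
        exact hn rfl
      rw [Finsupp.sub_apply, hu₁, restrict_of_notMem (E := {n : ℕ+ | N < (n : ℕ)}) hnN, sub_zero]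
      have h1 := G.abs_coord_le n (v - G.emb u₀)
      rw [map_sub, coord_emb, hvc n (not_lt.1 hnN), zero_sub, abs_neg] at h1
      exact h1.trans hu₀.le
    refine (sum_le_card_nsmul _ _ _ hterm).trans ?_
    rw [nsmul_eq_mul]
    have : #(u₀ - u₁).support ≤ N := by simpa using card_le_card hs
    gcongr
  have hvu : ‖v - G.emb u₁‖ < κ := by
    have h1 : v - G.emb u₁ = (v - G.emb u₀) + G.emb (u₀ - u₁) := by rw [map_sub]; abel
    rw [h1]
    refine (norm_add_le _ _).trans_lt ?_
    rw [norm_emb]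
    have h2 : κ = κ / (N + 1) + N * (κ / (N + 1)) := by field_simp; ring
    linarith
  have hu1 : 1 - κ ≤ G.nrm u₁ := by
    rw [← norm_emb]
    have := norm_sub_norm_le v (G.emb u₁)
    linarith
  have hpos : 0 < G.nrm u₁ := by linarith
  refine ⟨(G.nrm u₁)⁻¹ • v, Y.smul_mem _ hvY, (G.nrm u₁)⁻¹ • u₁, ?_, fun n hn => ?_, ?_⟩
  · rw [nrm_smul, abs_inv, abs_of_pos hpos, inv_mul_cancel₀ hpos.ne']
  · exact (mem_support_restrict.1 (Finsupp.support_smul hn)).1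
  · rw [map_smul, ← smul_sub, norm_smul, norm_inv, Real.norm_eq_abs, abs_of_pos hpos,
      inv_mul_lt_iff₀ hpos]
    nlinarith

end NormingSet

namespace JTGFamily
namespace Coding

variable {𝓕 : JTGFamily} {c : 𝓕.Coding}

/-- Vectors that are small in `‖·‖_𝒮` exist near every infinite dimensional subspace: approximate a
block sequence by vectors of the subspace, and transfer a suitable combination. -/
lemma exists_mem_nrm_normingS_lt {G : NormingSet} (hG : G.IsIntervalClosed)
    (hM : ∀ x, c.norming₂ₛ.nrm x ≤ G.nrm x) {Y : Submodule ℝ G.Completed}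
    (hY : ¬ FiniteDimensional ℝ Y) (N : ℕ) {η : ℝ} (hη : 0 < η) : ∃ v ∈ Y, ∃ u : C00,
      G.nrm u = 1 ∧ (∀ n ∈ u.support, N < (n : ℕ)) ∧ ‖v - G.emb u‖ < η ∧
        c.normingS.nrm u < η := by
  obtain ⟨s, hs, hR⟩ := exists_blockSequence (fun a : C00 × G.Completed => a.1)
    (fun l a => a.2 ∈ Y ∧ G.nrm a.1 = 1 ∧ (∀ n ∈ a.1.support, N < (n : ℕ)) ∧
      ‖a.2 - G.emb a.1‖ < η / 2 * (1 / 2) ^ (l.length + 1)) (fun l N' => by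
        obtain ⟨v, hv, u, hu, hun, huv⟩ := NormingSet.exists_mem_norm_sub_emb_lt hY (max N N')
          (show 0 < η / 2 * (1 / 2) ^ (l.length + 1) by positivity)
        refine ⟨(u, v), ?_, fun n hn => (le_max_right _ _).trans_lt (hun n hn), hv, hu,
          fun n hn => (le_max_left _ _).trans_lt (hun n hn), huv⟩
        rintro rfl
        rw [G.nrm_zero] at hu
        exact zero_ne_one hu)
  simp only [List.length_map, List.length_range] at hR
  obtain ⟨w, hw, hw0, hwS⟩ := exists_mem_span_nrm_normingS_lt c hs hη
  have hpos := G.nrm_pos hw0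
  have hwn := support_gt_of_mem_span (fun k => (hR k).2.2.1) hw
  obtain ⟨a, ha⟩ := exists_sum_of_mem_span hw
  set v := ∑ k ∈ a.support, a k • (s k).2 with hv
  have hvY : v ∈ Y := Y.sum_mem fun k _ => Y.smul_mem _ (hR k).1
  have hvw : ‖v - G.emb w‖ ≤ η / 2 * G.nrm w := by
    have h1 : v - G.emb w = ∑ k ∈ a.support, a k • ((s k).2 - G.emb (s k).1) := by
      rw [hv, ha, map_sum, ← sum_sub_distrib]
      exact sum_congr rfl fun k _ => by rw [smul_sub, Function.comp_apply, map_smul]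
    rw [h1]
    refine (norm_sum_le _ _).trans ?_
    calc ∑ k ∈ a.support, ‖a k • ((s k).2 - G.emb (s k).1)‖
        ≤ ∑ k ∈ a.support, G.nrm w * (η / 2) * (1 / 2) ^ (k + 1) := by
          refine sum_le_sum fun k hk => ?_
          have h2 := hG.abs_coeff_mul_le hs a.support a hk
          rw [← ha, Function.comp_apply, (hR k).2.1, mul_one] at h2
          rw [norm_smul, mul_assoc]
          exact mul_le_mul h2 (hR k).2.2.2.le (norm_nonneg _) hpos.le
      _ ≤ G.nrm w * (η / 2) := by
          rw [← mul_sum]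
          exact mul_le_of_le_one_right (by positivity) (sum_half_pow_succ_le _)
      _ = η / 2 * G.nrm w := mul_comm _ _
  refine ⟨(G.nrm w)⁻¹ • v, Y.smul_mem _ hvY, (G.nrm w)⁻¹ • w, ?_, fun n hn => ?_, ?_, ?_⟩
  · rw [NormingSet.nrm_smul, abs_inv, abs_of_pos hpos, inv_mul_cancel₀ hpos.ne']
  · exact hwn n (Finsupp.support_smul hn)
  · rw [map_smul, ← smul_sub, norm_smul, norm_inv, Real.norm_eq_abs, abs_of_pos hpos,
      inv_mul_lt_iff₀ hpos]
    nlinarith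
  · rw [NormingSet.nrm_smul, abs_inv, abs_of_pos hpos, inv_mul_lt_iff₀ hpos, mul_comm]
    exact hwS.trans_le (mul_le_mul_of_nonneg_left (hM w) hη.le)

/-- Gliding hump: an infinite dimensional subspace almost contains a normalized block sequence
`(u k)` for which `‖u k‖_𝒮` is as small as desired in terms of a number `q m`, `m < k`, that depends
on the earlier terms through a prescribed relation `P`. -/
lemma exists_glidingHump {G : NormingSet} (hG : G.IsIntervalClosed)
    (hM : ∀ x, c.norming₂ₛ.nrm x ≤ G.nrm x) {Y : Submodule ℝ G.Completed}
    (hY : ¬ FiniteDimensional ℝ Y) {θ : ℝ} (hθ : 0 < θ) (P : ℕ → C00 → ℕ → Prop)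
    (hP : ∀ k u p, ∃ q, p ≤ q ∧ P k u q) :
    ∃ (u : ℕ → C00) (v : ℕ → G.Completed) (q : ℕ → ℕ), IsBlockSequence u ∧ Monotone q ∧
      (∀ k, v k ∈ Y) ∧ (∀ k, G.nrm (u k) = 1) ∧ (∀ k, P k (u k) (q k)) ∧
      (∀ k, ‖v k - G.emb (u k)‖ ≤ θ * (1 / 2) ^ (k + 1)) ∧
      (∀ k, c.normingS.nrm (u k) ≤ θ * (1 / 2) ^ (k + 1)) ∧
      ∀ m k, m < k → q m * c.normingS.nrm (u k) ≤ θ * (1 / 2) ^ (k + 1) := by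
  obtain ⟨s, hs, hR⟩ := exists_blockSequence (fun a : C00 × G.Completed × ℕ => a.1)
    (fun l a => a.2.1 ∈ Y ∧ G.nrm a.1 = 1 ∧ P l.length a.1 a.2.2 ∧
      ‖a.2.1 - G.emb a.1‖ ≤ θ * (1 / 2) ^ (l.length + 1) ∧
      c.normingS.nrm a.1 ≤ θ * (1 / 2) ^ (l.length + 1) ∧
      ∀ b ∈ l, b.2.2 ≤ a.2.2 ∧ b.2.2 * c.normingS.nrm a.1 ≤ θ * (1 / 2) ^ (l.length + 1))
    (fun l N => by
      have hp : ∃ p : ℕ, ∀ b ∈ l, b.2.2 ≤ p := by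
        clear hP
        induction l with
        | nil => exact ⟨0, by simp⟩
        | cons b l ih =>
          obtain ⟨p, hp⟩ := ih
          refine ⟨max b.2.2 p, fun d hd => ?_⟩
          rcases List.mem_cons.1 hd with rfl | hd
          · exact le_max_left _ _
          · exact (hp d hd).trans (le_max_right _ _)
      obtain ⟨p, hp⟩ := hp
      set κ := θ * (1 / 2) ^ (l.length + 1) with hκ
      have hκ0 : 0 < κ := by positivity
      obtain ⟨v, hv, u, hu, hun, huv, huS⟩ := exists_mem_nrm_normingS_lt hG hM hY N
        (show 0 < κ / (p + 1) by positivity)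
      have hle : κ / (p + 1) ≤ κ := div_le_self hκ0.le (by simp)
      obtain ⟨q, hpq, hq⟩ := hP l.length u p
      refine ⟨(u, v, q), ?_, hun, hv, hu, hq, huv.le.trans hle, huS.le.trans hle,
        fun b hb => ⟨(hp b hb).trans hpq, ?_⟩⟩
      · rintro rfl
        rw [G.nrm_zero] at hu
        exact zero_ne_one hu
      · have h1 : (b.2.2 : ℝ) ≤ p := by exact_mod_cast hp b hb
        have h2 := c.normingS.nrm_nonneg u
        rw [lt_div_iff₀ (by positivity)] at huS
        nlinarith)
  simp only [List.length_map, List.length_range] at hR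
  have hmem : ∀ {m k}, m < k → s m ∈ (List.range k).map s := fun h =>
    List.mem_map.2 ⟨_, List.mem_range.2 h, rfl⟩
  exact ⟨fun k => (s k).1, fun k => (s k).2.1, fun k => (s k).2.2, hs,
    monotone_nat_of_le_succ fun k => ((hR (k + 1)).2.2.2.2.2 _ (hmem k.lt_succ_self)).1,
    fun k => (hR k).1, fun k => (hR k).2.1, fun k => (hR k).2.2.1, fun k => (hR k).2.2.2.1,
    fun k => (hR k).2.2.2.2.1, fun m k hmk => ((hR k).2.2.2.2.2 _ (hmem hmk)).2⟩

end Coding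
end JTGFamily

/-! ### Estimates for hump sequences -/

namespace JTGFamily
namespace Coding

variable {𝓕 : JTGFamily} {c : 𝓕.Coding}

lemma DisjointFamily.restrict {d : ℕ} {x : Fin d → C00} (h : c.DisjointFamily x) {E : Set ℕ+}
    (hE : E.OrdConnected) : c.DisjointFamily fun k => C00.restrict E (x k) := by
  obtain ⟨I, hI, hd⟩ := h
  choose I' hI' hxI' using fun k => (hI k).restrict hE
  exact ⟨I', hxI', fun k m hkm => (hd hkm).mono (hI' k) (hI' m)⟩

lemma isIntervalClosed_norming₂ : c.norming₂.IsIntervalClosed := by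
  rintro f (hf | ⟨d, a, x, ha, hx, rfl⟩) E hE
  · exact (𝓕.restrict_F_zero hf E).imp_right Or.inl
  · refine Or.inr (Or.inr ⟨d, a, _, ha, hx.restrict hE, ?_⟩)
    rw [restrict_sum]
    exact sum_congr rfl fun _ _ => restrict_smul _ _ _

lemma isIntervalClosed_norming₂ₛ : c.norming₂ₛ.IsIntervalClosed := by
  rintro f (hf | ⟨d, a, x, ha, hx, hd, rfl⟩) E hE
  · exact (𝓕.restrict_F_zero hf E).imp_right Or.inl
  · refine Or.inr (Or.inr ⟨d, a, _, ha, hx.restrict hE,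
      fun k n hn => hd k n (mem_support_restrict.1 hn).2, ?_⟩)
    rw [restrict_sum]
    exact sum_congr rfl fun _ _ => restrict_smul _ _ _

lemma isIntervalClosed_normingₛ : c.normingₛ.IsIntervalClosed := by
  rintro f (hf | ⟨d, a, x, ha, hx, hd, rfl⟩) E hE
  · exact (𝓕.restrict_F_zero hf E).imp_right Or.inl
  · refine Or.inr (Or.inr ⟨d, a, _, ha, hx.restrict hE,
      fun k n hn => hd k n (mem_support_restrict.1 hn).2, ?_⟩)
    rw [restrict_sum]
    exact sum_congr rfl fun _ _ => restrict_smul _ _ _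

lemma norming₂ₛ_le_norming₂ (x : C00) : c.norming₂ₛ.nrm x ≤ c.norming₂.nrm x := by
  refine NormingSet.nrm_le _ fun f hf => c.norming₂.pair_le_supOn ?_ x
  rcases hf with hf | ⟨d, a, x, ha, hx, -, rfl⟩
  exacts [Or.inl hf, Or.inr ⟨d, a, x, ha, hx, rfl⟩]

lemma norming₂ₛ_le_normingₛ (x : C00) : c.norming₂ₛ.nrm x ≤ c.normingₛ.nrm x := by
  refine NormingSet.nrm_le _ fun f hf => ?_
  rcases hf with hf | ⟨d, a, z, ha, hz, hd, rfl⟩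
  · exact c.normingₛ.pair_le_supOn (Or.inl hf) x
  · -- Choosing the signs of the values gives the `ℓ₁` sum, which dominates.
    let ε : Fin d → ℝ := fun k => if 0 ≤ pair (z k) x then 1 else -1
    have h1 := c.normingₛ.pair_le_supOn (f := ∑ k, ε k • z k) (Or.inr ⟨d, ε, z, fun k => by
      simp only [ε]; split_ifs <;> simp, hz, hd, rfl⟩) x
    refine le_trans ?_ h1
    rw [pair_sum_left, pair_sum_left]
    refine sum_le_sum fun k _ => ?_
    rw [pair_smul_left, pair_smul_left]
    have h2 : ε k * pair (z k) x = |pair (z k) x| := by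
      simp only [ε]
      split_ifs with h
      · rw [one_mul, abs_of_nonneg h]
      · rw [abs_of_neg (not_le.1 h)]; ring
    rw [h2]
    refine (le_abs_self _).trans ?_
    rw [abs_mul]
    exact mul_le_of_le_one_left (abs_nonneg _) (abs_coeff_le_one ha k)

/-- A normalized block sequence whose terms are quickly decreasing in `‖·‖_𝒮`, also in comparison
with the numbers `q m` that belong to earlier terms. -/
structure IsHump (c : 𝓕.Coding) (G : NormingSet) (θ : ℝ) (u : ℕ → C00) (q : ℕ → ℕ) : Prop where
  block : IsBlockSequence u
  mono : Monotone q
  nrm : ∀ k, G.nrm (u k) = 1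
  small : ∀ k, c.normingS.nrm (u k) ≤ θ * (1 / 2) ^ (k + 1)
  mul_small : ∀ m k, m < k → q m * c.normingS.nrm (u k) ≤ θ * (1 / 2) ^ (k + 1)

namespace IsHump

variable {G : NormingSet} {θ : ℝ} {u : ℕ → C00} {q : ℕ → ℕ}

lemma nonneg (h : c.IsHump G θ u q) : 0 ≤ θ := by
  have := (c.normingS.nrm_nonneg _).trans (h.small 0)
  simpa using this

lemma abs_coeff_le (h : c.IsHump G θ u q) (hG : G.IsIntervalClosed) (a : ℕ →₀ ℝ) (k : ℕ) :
    |a k| ≤ G.nrm (∑ k ∈ a.support, a k • u k) := by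
  by_cases hk : k ∈ a.support
  · simpa [h.nrm] using hG.abs_coeff_mul_le h.block a.support a hk
  · rw [Finsupp.notMem_support_iff.1 hk, abs_zero]
    exact G.nrm_nonneg _

lemma abs_pair_F_zero_le (h : c.IsHump G θ u q) {f : C00} (hf : f ∈ 𝓕.F 0) (k : ℕ) :
    |pair f (u k)| ≤ θ * (1 / 2) ^ (k + 1) :=
  (abs_pair_le_normingS hf _).trans (h.small k)

/-- The upper `c₀` estimate: a functional with `d` pieces supported above `d` annihilates the terms
before some `u k₀` and is small on the terms after it. -/
lemma nrm_sum_le_of_abs_le (h : c.IsHump G θ u q) (hq : ∀ k, ∀ n ∈ (u k).support, (n : ℕ) ≤ q k)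
    (hcar : ∀ f ∈ G.carrier, f ∈ 𝓕.F 0 ∨ ∃ (d : ℕ) (a : Fin d → ℝ) (x : Fin d → C00),
      (∀ k, |a k| ≤ 1) ∧ (∀ k, ∃ I, c.HasIndex (x k) I) ∧ (∀ k, ∀ n ∈ (x k).support, d ≤ (n : ℕ)) ∧
        f = ∑ k, a k • x k) (a : ℕ →₀ ℝ) {C : ℝ} (hC : 0 ≤ C) (ha : ∀ k, |a k| ≤ C) :
    G.nrm (∑ k ∈ a.support, a k • u k) ≤ (1 + θ) * C := by
  refine G.nrm_le fun f hf => ?_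
  obtain ⟨k₀, hk₀⟩ : ∃ k₀, ∀ k, k ≠ k₀ → |pair f (u k)| ≤ θ * (1 / 2) ^ (k + 1) := by
    rcases hcar f hf with hf0 | ⟨d, b, x, hb, hx, hd, rfl⟩
    · exact ⟨0, fun k _ => h.abs_pair_F_zero_le hf0 k⟩
    have hzero : ∀ k, q k < d → pair (∑ i, b i • x i) (u k) = 0 := by
      intro k hk
      rw [pair_sum_left]
      refine sum_eq_zero fun i _ => ?_
      rw [pair_smul_left, pair_eq_zero (fun n hn => ?_), mul_zero]
      by_contra hne
      have h1 := hd i n (Finsupp.mem_support_iff.2 hne)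
      have h2 := hq k n hn
      omega
    have hpos : ∀ k, 0 ≤ θ * (1 / 2 : ℝ) ^ (k + 1) := fun k =>
      mul_nonneg h.nonneg (by positivity)
    by_cases hex : ∃ k, d ≤ q k
    · classical
      refine ⟨Nat.find hex, fun k hk => ?_⟩
      rcases lt_or_gt_of_ne hk with hk | hk
      · rw [hzero k (not_le.1 (Nat.find_min hex hk)), abs_zero]
        exact hpos k
      · refine le_trans ?_ (h.mul_small _ k hk)
        rw [pair_sum_left]
        refine (abs_sum_le_sum_abs _ _).trans
          ((sum_le_card_nsmul univ _ (c.normingS.nrm (u k)) fun i _ => ?_).trans ?_)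
        · rw [pair_smul_left, abs_mul]
          obtain ⟨I, hI⟩ := hx i
          exact (mul_le_of_le_one_left (abs_nonneg _) (hb i)).trans (hI.abs_pair_le _)
        · rw [card_univ, Fintype.card_fin, nsmul_eq_mul]
          have : (d : ℝ) ≤ q (Nat.find hex) := by exact_mod_cast Nat.find_spec hex
          have := c.normingS.nrm_nonneg (u k)
          gcongr
    · push Not at hex
      refine ⟨0, fun k _ => ?_⟩
      rw [hzero k (hex k), abs_zero]
      exact hpos k
  rw [pair_sum]
  calc ∑ k ∈ a.support, pair f (a k • u k)
      ≤ ∑ k ∈ a.support, C * ((if k = k₀ then 1 else 0) + θ * (1 / 2) ^ (k + 1)) := by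
        refine sum_le_sum fun k _ => ?_
        rw [pair_smul]
        refine (le_abs_self _).trans ?_
        rw [abs_mul]
        refine mul_le_mul (ha k) ?_ (abs_nonneg _) hC
        split_ifs with hk
        · have h1 := G.abs_pair_le hf (u k)
          rw [h.nrm] at h1
          have := mul_nonneg h.nonneg (show (0 : ℝ) ≤ (1 / 2) ^ (k + 1) by positivity)
          linarith
        · rw [zero_add]; exact hk₀ k hk
    _ = C * ((∑ k ∈ a.support, if k = k₀ then 1 else 0) +
          θ * ∑ k ∈ a.support, (1 / 2 : ℝ) ^ (k + 1)) := by
        rw [← mul_sum, sum_add_distrib, mul_sum (f := fun k => (1 / 2 : ℝ) ^ (k + 1))]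
    _ ≤ C * (1 + θ * 1) := by
        have h1 : (∑ k ∈ a.support, if k = k₀ then (1 : ℝ) else 0) ≤ 1 := by
          rw [sum_ite_eq']
          split_ifs <;> norm_num
        have h2 := mul_le_mul_of_nonneg_left (sum_half_pow_succ_le a.support) h.nonneg
        gcongr
    _ = (1 + θ) * C := by ring

/-- Few functionals with disjoint indices have an index below some earlier `q m`; together they are
small on `u k`. -/
lemma abs_sum_old_le (h : c.IsHump G θ u q) {ι : Type*} {s : Finset ι} {x : ι → C00}
    {I : ι → Set ℕ} {b : ι → ℝ} (hx : ∀ i ∈ s, c.HasIndex (x i) (I i))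
    (hd : (s : Set ι).PairwiseDisjoint I) (hb : ∀ i ∈ s, |b i| ≤ 1) {k : ℕ}
    (hold : ∀ i ∈ s, ∃ m < k, ∃ j ∈ I i, j ≤ q m) :
    |∑ i ∈ s, b i * pair (x i) (u k)| ≤ 2 * (θ * (1 / 2) ^ (k + 1)) := by
  have hpos : 0 ≤ θ * (1 / 2 : ℝ) ^ (k + 1) := mul_nonneg h.nonneg (by positivity)
  rcases Nat.eq_zero_or_eq_succ_pred k with rfl | hk
  · have : s = ∅ := by
      refine eq_empty_of_forall_notMem fun i hi => ?_
      obtain ⟨m, hm, -⟩ := hold i hi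
      exact Nat.not_lt_zero m hm
    rw [this, sum_empty, abs_zero]
    linarith
  · set m := k.pred
    have hold' : ∀ i, ∃ j, i ∈ s → j ∈ I i ∧ j ≤ q m := by
      intro i
      by_cases hi : i ∈ s
      · obtain ⟨m', hm', j, hj, hjq⟩ := hold i hi
        exact ⟨j, fun _ => ⟨hj, hjq.trans (h.mono (by omega))⟩⟩
      · exact ⟨0, fun hi' => absurd hi' hi⟩
    choose j hj using hold'
    have hcard : #s ≤ q m + 1 := by
      have := card_le_card_of_injOn (s := s) (t := range (q m + 1)) j
        (fun i hi => mem_coe.2 (mem_range.2 (Nat.lt_succ_of_le (hj i hi).2)))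
        (fun i hi i' hi' hii => by
          by_contra hne
          exact Set.disjoint_left.1 (hd hi hi' hne) (hj i hi).1 (hii ▸ (hj i' hi').1))
      simpa using this
    refine (abs_sum_le_sum_abs _ _).trans
      ((sum_le_card_nsmul s _ (c.normingS.nrm (u k)) fun i hi => ?_).trans ?_)
    · rw [abs_mul]
      exact (mul_le_of_le_one_left (abs_nonneg _) (hb i hi)).trans ((hx i hi).abs_pair_le _)
    · rw [nsmul_eq_mul]
      have h1 : (#s : ℝ) ≤ q m + 1 := by exact_mod_cast hcard
      have h2 := h.mul_small m k (by omega)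
      have h3 := h.small k
      have h4 := c.normingS.nrm_nonneg (u k)
      nlinarith

end IsHump

/-- Functionals with disjoint indices above `p`, with coefficients at most one. -/
lemma abs_sum_mul_pair_le_tauTail {ι : Type*} {s : Finset ι} {x : ι → C00} {I : ι → Set ℕ}
    {b : ι → ℝ} (hx : ∀ i ∈ s, c.HasIndex (x i) (I i)) (hd : (s : Set ι).PairwiseDisjoint I)
    (hb : ∀ i ∈ s, |b i| ≤ 1) {p : ℕ} (hp : ∀ i ∈ s, I i ⊆ Set.Ioi p) (y : C00) :
    |∑ i ∈ s, b i * pair (x i) y| ≤ 𝓕.tauTail p * l1 y := by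
  have : ∑ i ∈ s, b i * pair (x i) y = pair (∑ i ∈ s, b i • x i) y := by
    rw [pair_sum_left]
    exact sum_congr rfl fun i _ => (pair_smul_left _ _ _).symm
  rw [this]
  refine abs_pair_le_mul_l1 fun n _ => ?_
  rw [Finsupp.finsetSum_apply]
  refine (abs_sum_le_sum_abs _ _).trans (le_trans (sum_le_sum fun i hi => ?_)
    (sum_abs_apply_le_tauTail hx hd hp n))
  rw [Finsupp.smul_apply, smul_eq_mul, abs_mul]
  exact mul_le_of_le_one_left (abs_nonneg _) (hb i hi)

namespace IsHump

variable {θ : ℝ} {u : ℕ → C00} {q : ℕ → ℕ}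

/-- On a hump sequence a functional of `𝓕₂` is almost a sequence in the unit ball of `ℓ₂`: each of
its pieces is counted at the first `u k` for which it has an index at most `q k`. -/
lemma exists_ell_two_bound (h : c.IsHump c.norming₂ θ u q)
    (hq : ∀ k, 𝓕.tauTail (q k) * l1 (u k) ≤ θ * (1 / 2) ^ (k + 1)) {f : C00}
    (hf : f ∈ c.norming₂.carrier) : ∃ β : ℕ → ℝ, (∀ s : Finset ℕ, ∑ k ∈ s, β k ^ 2 ≤ 1) ∧
      ∀ k, |pair f (u k)| ≤ β k + 3 * (θ * (1 / 2) ^ (k + 1)) := by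
  classical
  rcases hf with hf | ⟨d, b, x, hb, ⟨I, hI, hd⟩, rfl⟩
  · refine ⟨0, by simp, fun k => ?_⟩
    have h1 := h.abs_pair_F_zero_le hf k
    have h2 := (abs_nonneg _).trans h1
    rw [Pi.zero_apply]
    linarith
  have hb1 : ∀ i, |(b i : ℝ)| ≤ 1 := abs_coeff_le_one hb
  have hb2 : ∑ i, (b i : ℝ) ^ 2 ≤ 1 := by exact_mod_cast hb
  have hdis : ∀ s : Finset (Fin d), (s : Set (Fin d)).PairwiseDisjoint I :=
    fun s i _ i' _ hii => hd hii
  let A : ℕ → Fin d → Prop := fun k i => ∃ j ∈ I i, j ≤ q k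
  let B : ℕ → Finset (Fin d) := fun k => {i | A k i ∧ ∀ m < k, ¬ A m i}
  refine ⟨fun k => √(∑ i ∈ B k, (b i : ℝ) ^ 2), fun s => ?_, fun k => ?_⟩
  · have hB : (s : Set ℕ).PairwiseDisjoint B := by
      intro k _ m _ hkm
      refine disjoint_left.2 fun i hik him => ?_
      have h1 := (mem_filter.1 hik).2
      have h2 := (mem_filter.1 him).2
      rcases lt_or_gt_of_ne hkm with hkm | hkm
      exacts [h2.2 k hkm h1.1, h1.2 m hkm h2.1]
    simp only [Real.sq_sqrt (sum_nonneg fun i (_ : i ∈ B _) => sq_nonneg (b i : ℝ))]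
    rw [← sum_biUnion hB]
    exact (sum_le_univ_sum_of_nonneg fun i => sq_nonneg (b i : ℝ)).trans hb2
  · have hsplit : pair (∑ i, (b i : ℝ) • x i) (u k) =
        ∑ i ∈ B k, (b i : ℝ) * pair (x i) (u k) +
        (∑ i with ∃ m < k, A m i, (b i : ℝ) * pair (x i) (u k) +
         ∑ i with ¬ A k i ∧ ¬ ∃ m < k, A m i, (b i : ℝ) * pair (x i) (u k)) := by
      rw [pair_sum_left]
      simp only [pair_smul_left]
      simp only [B, sum_filter, ← sum_add_distrib]
      refine sum_congr rfl fun i _ => ?_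
      by_cases h1 : ∃ m < k, A m i
      · obtain ⟨m, hm, hmi⟩ := h1
        rw [if_neg fun h => h.2 m hm hmi, if_pos ⟨m, hm, hmi⟩, if_neg fun h => h.2 ⟨m, hm, hmi⟩]
        ring
      · have h2 : ∀ m < k, ¬ A m i := fun m hm hmi => h1 ⟨m, hm, hmi⟩
        by_cases h3 : A k i
        · rw [if_pos ⟨h3, h2⟩, if_neg h1, if_neg fun h => h.1 h3]
          ring
        · rw [if_neg fun h => h3 h.1, if_neg h1, if_pos ⟨h3, h1⟩]
          ring
    have hB : |∑ i ∈ B k, (b i : ℝ) * pair (x i) (u k)| ≤ √(∑ i ∈ B k, (b i : ℝ) ^ 2) := by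
      refine Real.abs_le_sqrt ((sum_mul_sq_le_sq_mul_sq _ _ _).trans ?_)
      have := sum_sq_pair_le_norming₂ (c := c) (s := B k) (x := x) (I := I) (fun i _ => hI i)
        (hdis _) (u k)
      rw [h.nrm, one_pow] at this
      exact mul_le_of_le_one_right (sum_nonneg fun i _ => sq_nonneg _) this
    have hold := h.abs_sum_old_le (s := {i | ∃ m < k, A m i}) (x := x) (I := I)
      (b := fun i => (b i : ℝ)) (k := k) (fun i _ => hI i) (hdis _) (fun i _ => hb1 i)
      (fun i hi => (mem_filter.1 hi).2)
    have hnew := (abs_sum_mul_pair_le_tauTail (s := {i | ¬ A k i ∧ ¬ ∃ m < k, A m i}) (x := x)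
      (I := I) (b := fun i => (b i : ℝ)) (p := q k) (fun i _ => hI i) (hdis _)
      (fun i _ => hb1 i) (fun i hi j hj => by
        by_contra hle
        exact (mem_filter.1 hi).2.1 ⟨j, hj, not_lt.1 hle⟩) (u k)).trans (hq k)
    rw [hsplit]
    have h1 := abs_add_le (∑ i ∈ B k, (b i : ℝ) * pair (x i) (u k))
      (∑ i with ∃ m < k, A m i, (b i : ℝ) * pair (x i) (u k) +
         ∑ i with ¬ A k i ∧ ¬ ∃ m < k, A m i, (b i : ℝ) * pair (x i) (u k))
    have h2 := abs_add_le (∑ i with ∃ m < k, A m i, (b i : ℝ) * pair (x i) (u k))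
      (∑ i with ¬ A k i ∧ ¬ ∃ m < k, A m i, (b i : ℝ) * pair (x i) (u k))
    linarith

lemma nrm_sum_le_sqrt (h : c.IsHump c.norming₂ θ u q)
    (hq : ∀ k, 𝓕.tauTail (q k) * l1 (u k) ≤ θ * (1 / 2) ^ (k + 1)) (a : ℕ →₀ ℝ) :
    c.norming₂.nrm (∑ k ∈ a.support, a k • u k) ≤
      (1 + 3 * θ) * √(∑ k ∈ a.support, a k ^ 2) := by
  set R := √(∑ k ∈ a.support, a k ^ 2) with hR
  have haR : ∀ k ∈ a.support, |a k| ≤ R := fun k hk =>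
    Real.abs_le_sqrt (single_le_sum (f := fun k => a k ^ 2) (fun _ _ => sq_nonneg _) hk)
  refine NormingSet.nrm_le _ fun f hf => ?_
  obtain ⟨β, hβ, hfβ⟩ := h.exists_ell_two_bound hq hf
  rw [pair_sum]
  calc ∑ k ∈ a.support, pair f (a k • u k)
      ≤ ∑ k ∈ a.support, (|a k| * β k + R * (3 * θ) * (1 / 2) ^ (k + 1)) := by
        refine sum_le_sum fun k hk => ?_
        rw [pair_smul]
        refine (le_abs_self _).trans ?_
        rw [abs_mul]
        refine (mul_le_mul_of_nonneg_left (hfβ k) (abs_nonneg _)).trans ?_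
        rw [mul_add]
        have h1 : 0 ≤ 3 * (θ * (1 / 2 : ℝ) ^ (k + 1)) := by
          have := h.nonneg; positivity
        have h2 := mul_le_mul_of_nonneg_right (haR k hk) h1
        linarith
    _ = ∑ k ∈ a.support, |a k| * β k + R * (3 * θ) * ∑ k ∈ a.support, (1 / 2 : ℝ) ^ (k + 1) := by
        rw [sum_add_distrib, mul_sum]
    _ ≤ R + R * (3 * θ) * 1 := by
        have h1 : ∑ k ∈ a.support, |a k| * β k ≤ R := by
          refine Real.le_sqrt_of_sq_le ((sum_mul_sq_le_sq_mul_sq _ _ _).trans ?_)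
          simp only [sq_abs]
          exact mul_le_of_le_one_right (sum_nonneg fun _ _ => sq_nonneg _) (hβ _)
        have h2 : 0 ≤ R * (3 * θ) := by
          have := h.nonneg; positivity
        have h3 := mul_le_mul_of_nonneg_left (sum_half_pow_succ_le a.support) h2
        linarith
    _ = (1 + 3 * θ) * R := by ring

/-- Each `u k` is almost normed by functionals whose indices lie between `q (k - 1)` and `q k`. -/
lemma exists_norming_family (h : c.IsHump c.norming₂ θ u q) (hθ : θ ≤ 1 / 8)
    (hq : ∀ k, 𝓕.tauTail (q k) * l1 (u k) ≤ θ * (1 / 2) ^ (k + 1)) (k : ℕ) :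
    ∃ (d : ℕ) (x : Fin d → C00) (I : Fin d → Set ℕ), (∀ i, c.HasIndex (x i) (I i)) ∧
      Pairwise (fun i j => Disjoint (I i) (I j)) ∧
      (∀ i, ∀ j ∈ I i, (∀ m < k, q m < j) ∧ j ≤ q k) ∧
      (∀ i, ∀ n ∈ (x i).support, n ∈ hull (u k)) ∧
      (1 - 4 * θ) ^ 2 ≤ ∑ i, pair (x i) (u k) ^ 2 := by
  classical
  have hθ0 := h.nonneg
  have hpow : (1 / 2 : ℝ) ^ (k + 1) ≤ 1 := pow_le_one₀ (by norm_num) (by norm_num)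
  have hθk : θ * (1 / 2 : ℝ) ^ (k + 1) ≤ θ := mul_le_of_le_one_right hθ0 hpow
  obtain ⟨f, hf, hfu⟩ : ∃ f ∈ c.norming₂.carrier, 1 - θ ≤ pair f (u k) := by
    rcases hθ0.eq_or_lt with h0 | h0
    · exact absurd (c.normingS.nrm_eq_zero.1 (le_antisymm (by simpa [← h0] using h.small k)
        (c.normingS.nrm_nonneg _))) (h.block.1 k)
    · obtain ⟨f, hf, hfu⟩ := c.norming₂.exists_lt_pair (x := u k) (c := 1 - θ)
        (by rw [h.nrm]; linarith)
      exact ⟨f, hf, hfu.le⟩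
  rcases hf with hf | ⟨d, b, x, hb, ⟨I, hI, hd⟩, rfl⟩
  · have := (le_abs_self _).trans (h.abs_pair_F_zero_le hf k)
    linarith
  have hb1 : ∀ i, |(b i : ℝ)| ≤ 1 := abs_coeff_le_one hb
  have hb2 : ∑ i, (b i : ℝ) ^ 2 ≤ 1 := by exact_mod_cast hb
  let old : Fin d → Prop := fun i => ∃ m < k, ∃ j ∈ I i, j ≤ q m
  choose x₁ x₂ hx hx₁ hx₂ using fun i => (hI i).split (q k)
  choose J hJ hJx using fun i => (hx₁ i).restrict (ordConnected_hull (u k))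
  refine ⟨d, fun i => if old i then 0 else C00.restrict (hull (u k)) (x₁ i),
    fun i => if old i then ∅ else J i, fun i => ?_, fun i i' hii => ?_, fun i j hj => ?_,
    fun i n hn => ?_, ?_⟩
  · dsimp only
    split_ifs
    exacts [c.hasIndex_zero, hJx i]
  · dsimp only
    split_ifs
    · simp
    · simp
    · simp
    · exact (hd hii).mono ((hJ i).trans Set.inter_subset_left)
        ((hJ i').trans Set.inter_subset_left)
  · by_cases ho : old i
    · simp [ho] at hj
    · simp only [ho, if_false] at hj
      refine ⟨fun m hm => ?_, (hJ i hj).2⟩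
      by_contra hle
      exact ho ⟨m, hm, j, (hJ i hj).1, not_lt.1 hle⟩
  · by_cases ho : old i
    · simp [ho] at hn
    · simp only [ho, if_false] at hn
      exact (mem_support_restrict.1 hn).1
  · set g : Fin d → ℝ := fun i =>
      pair (if old i then 0 else C00.restrict (hull (u k)) (x₁ i)) (u k) with hg
    have hsplit : pair (∑ i, (b i : ℝ) • x i) (u k) = ∑ i, (b i : ℝ) * g i +
        (∑ i with old i, (b i : ℝ) * pair (x i) (u k) +
         ∑ i with ¬ old i, (b i : ℝ) * pair (x₂ i) (u k)) := by
      rw [pair_sum_left]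
      simp only [pair_smul_left, sum_filter, ← sum_add_distrib]
      refine sum_congr rfl fun i _ => ?_
      by_cases ho : old i
      · simp [hg, ho, pair_zero_left]
      · simp only [hg, ho, if_false, not_false_eq_true, if_true]
        rw [pair_restrict_of_subset (subset_hull _)]
        conv_lhs => rw [hx i, pair_add_left]
        ring
    have hold := h.abs_sum_old_le (s := {i | old i}) (x := x) (I := I)
      (b := fun i => (b i : ℝ)) (k := k) (fun i _ => hI i) (fun i _ i' _ hii => hd hii)
      (fun i _ => hb1 i) (fun i hi => (mem_filter.1 hi).2)
    have hnew := (abs_sum_mul_pair_le_tauTail (s := {i | ¬ old i}) (x := x₂)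
      (b := fun i => (b i : ℝ)) (p := q k) (fun i _ => hx₂ i)
      (fun i _ i' _ hii => (hd hii).mono Set.inter_subset_left Set.inter_subset_left)
      (fun i _ => hb1 i) (fun i _ => Set.inter_subset_right) (u k)).trans (hq k)
    have hmain : 1 - 4 * θ ≤ ∑ i, (b i : ℝ) * g i := by
      rw [hsplit] at hfu
      have h1 := le_abs_self (∑ i with old i, (b i : ℝ) * pair (x i) (u k))
      have h2 := le_abs_self (∑ i with ¬ old i, (b i : ℝ) * pair (x₂ i) (u k))
      linarith
    calc (1 - 4 * θ) ^ 2 ≤ (∑ i, (b i : ℝ) * g i) ^ 2 := by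
          have : 0 ≤ 1 - 4 * θ := by linarith
          gcongr
      _ ≤ (∑ i, (b i : ℝ) ^ 2) * ∑ i, g i ^ 2 := sum_mul_sq_le_sq_mul_sq _ _ _
      _ ≤ ∑ i, g i ^ 2 := mul_le_of_le_one_left (sum_nonneg fun _ _ => sq_nonneg _) hb2

lemma sqrt_le_nrm_sum (h : c.IsHump c.norming₂ θ u q) (hθ : θ ≤ 1 / 8)
    (hq : ∀ k, 𝓕.tauTail (q k) * l1 (u k) ≤ θ * (1 / 2) ^ (k + 1)) (a : ℕ →₀ ℝ) :
    (1 - 4 * θ) * √(∑ k ∈ a.support, a k ^ 2) ≤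
      c.norming₂.nrm (∑ k ∈ a.support, a k • u k) := by
  choose d x I hI hd hJ hs hx using h.exists_norming_family hθ hq
  have hbessel := sum_sq_pair_le_norming₂ (c := c)
    (s := a.support.sigma fun k => (univ : Finset (Fin (d k))))
    (x := fun i => x i.1 i.2) (I := fun i => I i.1 i.2) (fun i _ => hI i.1 i.2)
    (by
      rintro ⟨k, i⟩ - ⟨m, i'⟩ - hne
      refine Set.disjoint_left.2 fun j hj hj' => ?_
      rcases lt_trichotomy k m with hkm | rfl | hkm
      · exact absurd ((hJ m i' j hj').1 k hkm) (not_lt.2 (hJ k i j hj).2)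
      · exact Set.disjoint_left.1 (hd k fun hii : i = i' => hne (by rw [hii])) hj hj'
      · exact absurd ((hJ k i j hj).1 m hkm) (not_lt.2 (hJ m i' j hj').2))
    (∑ k ∈ a.support, a k • u k)
  rw [sum_sigma] at hbessel
  have hpair : ∀ k ∈ a.support, ∀ i,
      pair (x k i) (∑ m ∈ a.support, a m • u m) = a k * pair (x k i) (u k) := by
    intro k hk i
    rw [← pair_smul, ← h.block.restrict_hull a.support a hk, ← pair_restrict,
      restrict_eq_self (hs k i)]
  have hle : (1 - 4 * θ) ^ 2 * ∑ k ∈ a.support, a k ^ 2 ≤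
      c.norming₂.nrm (∑ k ∈ a.support, a k • u k) ^ 2 := by
    refine le_trans ?_ hbessel
    rw [mul_sum]
    refine sum_le_sum fun k hk => ?_
    simp only [hpair k hk, mul_pow]
    rw [← mul_sum, mul_comm]
    exact mul_le_mul_of_nonneg_left (hx k) (sq_nonneg _)
  refine le_of_sq_le_sq ?_ (NormingSet.nrm_nonneg _ _)
  rw [mul_pow, Real.sq_sqrt (sum_nonneg fun _ _ => sq_nonneg _)]
  exact hle

end IsHump
end Coding
end JTGFamily

/-! ### Copies of the model spaces -/

/-- Two-sided estimates on a dense subspace give a copy of `Z` inside `Y`. -/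
lemma exists_equiv_of_bounds {E X Z : Type*} [AddCommGroup E] [Module ℝ E] [NormedAddCommGroup X]
    [NormedSpace ℝ X] [CompleteSpace X] [NormedAddCommGroup Z] [NormedSpace ℝ Z]
    {Y : Submodule ℝ X} (hY : IsClosed (Y : Set X)) (A : E →ₗ[ℝ] Z) (hA : DenseRange A)
    (B : E →ₗ[ℝ] X) (hB : ∀ a, B a ∈ Y) {m K : ℝ} (hm : 0 < m) (hK : 0 ≤ K)
    (h1 : ∀ a, m * ‖A a‖ ≤ ‖B a‖) (h2 : ∀ a, ‖B a‖ ≤ K * ‖A a‖) :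
    ∃ V : Submodule ℝ X, V ≤ Y ∧ ∃ T : V ≃L[ℝ] Z,
      ‖(T : V →L[ℝ] Z)‖ * ‖(T.symm : Z →L[ℝ] V)‖ ≤ K / m := by
  set S : Z →L[ℝ] X := B.extendOfNorm A with hS
  have hSA : ∀ a, S (A a) = B a := LinearMap.extendOfNorm_eq hA ⟨K, h2⟩
  have hSK : ∀ z, ‖S z‖ ≤ K * ‖z‖ := LinearMap.norm_extendOfNorm_apply_le hA K h2
  have hSm : ∀ z, m * ‖z‖ ≤ ‖S z‖ := fun z =>
    hA.induction_on (p := fun z => m * ‖z‖ ≤ ‖S z‖) z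
      (isClosed_le (by fun_prop) (by fun_prop)) fun a => by rw [hSA]; exact h1 a
  have hSY : ∀ z, S z ∈ Y := fun z =>
    hA.induction_on (p := fun z => S z ∈ Y) z (hY.preimage S.continuous) fun a => by
      rw [hSA]; exact hB a
  have hinj : Function.Injective (S : Z →ₗ[ℝ] X) := by
    rw [injective_iff_map_eq_zero]
    intro z hz
    have h := hSm z
    rw [show S z = 0 from hz, norm_zero] at h
    exact norm_eq_zero.1 (le_antisymm (nonpos_of_mul_nonpos_right h hm) (norm_nonneg z))
  let e : Z ≃ₗ[ℝ] LinearMap.range (S : Z →ₗ[ℝ] X) := LinearEquiv.ofInjective (S : Z →ₗ[ℝ] X) hinj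
  have he : ∀ z, ‖e z‖ = ‖S z‖ := fun z => rfl
  have hsymm : ∀ v, ‖e.symm v‖ ≤ m⁻¹ * ‖v‖ := fun v => by
    have h := hSm (e.symm v)
    rw [← he, e.apply_symm_apply] at h
    rwa [inv_mul_eq_div, le_div_iff₀ hm, mul_comm]
  let T := e.symm.toContinuousLinearEquivOfBounds m⁻¹ K hsymm fun z => by
    rw [LinearEquiv.symm_symm, he]; exact hSK z
  refine ⟨LinearMap.range (S : Z →ₗ[ℝ] X), ?_, T, ?_⟩
  · rintro _ ⟨z, rfl⟩
    exact hSY z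
  · have hT : ‖(T : LinearMap.range (S : Z →ₗ[ℝ] X) →L[ℝ] Z)‖ ≤ m⁻¹ :=
      ContinuousLinearMap.opNorm_le_bound _ (inv_nonneg.2 hm.le) hsymm
    have hT' : ‖(T.symm : Z →L[ℝ] LinearMap.range (S : Z →ₗ[ℝ] X))‖ ≤ K :=
      ContinuousLinearMap.opNorm_le_bound _ hK fun z => (he z).le.trans (hSK z)
    rw [div_eq_inv_mul]
    exact mul_le_mul hT hT' (ContinuousLinearMap.opNorm_nonneg _) (inv_nonneg.2 hm.le)

/-- Finitely supported sequences as elements of `c₀`. -/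
def toCZero : (ℕ →₀ ℝ) →ₗ[ℝ] CZero where
  toFun a := ⟨⟨a, continuous_of_discreteTopology⟩, by
    refine tendsto_nhds_of_eventually_eq ?_
    rw [Filter.cocompact_eq_cofinite]
    refine (Set.Finite.subset a.support.finite_toSet fun k hk => ?_)
    exact Finsupp.mem_support_iff.2 hk⟩
  map_add' a b := by ext; simp
  map_smul' r a := by ext; simp

lemma toCZero_apply (a : ℕ →₀ ℝ) (k : ℕ) : toCZero a k = a k := rfl

lemma CZero.norm_le {f : CZero} {C : ℝ} (hC : 0 ≤ C) : ‖f‖ ≤ C ↔ ∀ k, |f k| ≤ C := by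
  rw [← ZeroAtInftyContinuousMap.norm_toBCF_eq_norm, BoundedContinuousFunction.norm_le hC]
  rfl

lemma denseRange_toCZero : DenseRange toCZero := by
  classical
  refine Metric.denseRange_iff.2 fun f r hr => ?_
  have hf : ∀ᶠ k in Filter.cofinite, |f k| < r / 2 := by
    have := f.zero_at_infty'
    rw [Filter.cocompact_eq_cofinite] at this
    simpa using this.eventually (Metric.ball_mem_nhds (0 : ℝ) (half_pos hr))
  have hfin : {k | ¬ |f k| < r / 2}.Finite := hf
  let a : ℕ →₀ ℝ := Finsupp.onFinset hfin.toFinset (fun k => if |f k| < r / 2 then 0 else f k)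
    fun k hk => by
      rw [Set.Finite.mem_toFinset]
      intro h
      exact hk (if_pos h)
  refine ⟨a, ?_⟩
  rw [dist_eq_norm]
  refine lt_of_le_of_lt ((CZero.norm_le (half_pos hr).le).2 fun k => ?_) (half_lt_self hr)
  rw [ZeroAtInftyContinuousMap.sub_apply, toCZero_apply]
  simp only [a, Finsupp.onFinset_apply]
  split_ifs with h
  · rw [sub_zero]; exact h.le
  · rw [sub_self, abs_zero]; exact (half_pos hr).le

/-- Finitely supported sequences as elements of `ℓ₂`. -/
def toEllTwo : (ℕ →₀ ℝ) →ₗ[ℝ] EllTwo :=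
  Finsupp.linearCombination ℝ fun k => lp.single 2 k (1 : ℝ)

lemma toEllTwo_apply (a : ℕ →₀ ℝ) :
    toEllTwo a = ∑ k ∈ a.support, lp.single (E := fun _ : ℕ => ℝ) 2 k (a k) := by
  rw [toEllTwo, Finsupp.linearCombination_apply, Finsupp.sum]
  refine sum_congr rfl fun k _ => ?_
  rw [← lp.single_smul, smul_eq_mul, mul_one]

lemma norm_toEllTwo (a : ℕ →₀ ℝ) : ‖toEllTwo a‖ = √(∑ k ∈ a.support, a k ^ 2) := by
  have h := lp.norm_sum_single (E := fun _ : ℕ => ℝ) (p := 2) (by norm_num) a a.support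
  rw [← toEllTwo_apply] at h
  simp only [ENNReal.toReal_ofNat, Real.rpow_ofNat, Real.norm_eq_abs, sq_abs] at h
  rw [← h, Real.sqrt_sq (norm_nonneg _)]

lemma denseRange_toEllTwo : DenseRange toEllTwo := by
  intro f
  have h := lp.hasSum_single (E := fun _ : ℕ => ℝ) (p := 2) (by norm_num) f
  refine mem_closure_of_tendsto h (Filter.Eventually.of_forall fun s => ?_)
  refine (LinearMap.range toEllTwo).sum_mem fun k _ => ⟨Finsupp.single k (f k), ?_⟩
  rw [toEllTwo, Finsupp.linearCombination_single, ← lp.single_smul, smul_eq_mul, mul_one]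

lemma IsAlmostIsometricallySaturatedBy.isSaturatedBy {X Z : Type*} [NormedAddCommGroup X]
    [NormedSpace ℝ X] [NormedAddCommGroup Z] [NormedSpace ℝ Z]
    (h : IsAlmostIsometricallySaturatedBy X Z) : IsSaturatedBy X Z := fun Y hY hfin =>
  let ⟨V, hV, T, _⟩ := h Y hY hfin 1 one_pos
  ⟨V, hV, ⟨T⟩⟩

namespace JTGFamily
namespace Coding

variable {𝓕 : JTGFamily} {c : 𝓕.Coding}

/-- Perturbation of a hump sequence: if its combinations satisfy two-sided estimates, then nearby
vectors of `Y` span an almost isometric copy of the model space. -/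
lemma IsHump.exists_equiv {G : NormingSet} (hG : G.IsIntervalClosed) {Z : Type*}
    [NormedAddCommGroup Z] [NormedSpace ℝ Z] (A : (ℕ →₀ ℝ) →ₗ[ℝ] Z) (hA : DenseRange A)
    {Y : Submodule ℝ G.Completed} (hY : IsClosed (Y : Set G.Completed)) {θ : ℝ} {u : ℕ → C00}
    {q : ℕ → ℕ} (h : c.IsHump G θ u q) (hθ : θ ≤ 1 / 8) {v : ℕ → G.Completed}
    (hv : ∀ k, v k ∈ Y) (hvu : ∀ k, ‖v k - G.emb (u k)‖ ≤ θ * (1 / 2) ^ (k + 1))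
    (h1 : ∀ a, (1 - 4 * θ) * ‖A a‖ ≤ G.nrm (∑ k ∈ a.support, a k • u k))
    (h2 : ∀ a, G.nrm (∑ k ∈ a.support, a k • u k) ≤ (1 + 4 * θ) * ‖A a‖) :
    ∃ V : Submodule ℝ G.Completed, V ≤ Y ∧ ∃ T : V ≃L[ℝ] Z,
      ‖(T : V →L[ℝ] Z)‖ * ‖(T.symm : Z →L[ℝ] V)‖ ≤
        (1 + θ) * (1 + 4 * θ) / ((1 - θ) * (1 - 4 * θ)) := by
  have hθ0 := h.nonneg
  have hB : ∀ a : ℕ →₀ ℝ, Finsupp.linearCombination ℝ v a = ∑ k ∈ a.support, a k • v k :=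
    fun a => Finsupp.linearCombination_apply _ _
  have hdiff : ∀ a : ℕ →₀ ℝ, ‖∑ k ∈ a.support, a k • v k - G.emb (∑ k ∈ a.support, a k • u k)‖ ≤
      θ * G.nrm (∑ k ∈ a.support, a k • u k) := by
    intro a
    have h3 : ∑ k ∈ a.support, a k • v k - G.emb (∑ k ∈ a.support, a k • u k) =
        ∑ k ∈ a.support, a k • (v k - G.emb (u k)) := by
      rw [map_sum, ← sum_sub_distrib]
      exact sum_congr rfl fun k _ => by rw [smul_sub, map_smul]
    rw [h3]
    refine (norm_sum_le _ _).trans ?_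
    calc ∑ k ∈ a.support, ‖a k • (v k - G.emb (u k))‖
        ≤ ∑ k ∈ a.support, θ * G.nrm (∑ k ∈ a.support, a k • u k) * (1 / 2) ^ (k + 1) := by
          refine sum_le_sum fun k _ => ?_
          rw [norm_smul]
          refine (mul_le_mul (h.abs_coeff_le hG a k) (hvu k) (norm_nonneg _)
            (G.nrm_nonneg _)).trans (le_of_eq (by ring))
      _ ≤ _ := by
          rw [← mul_sum]
          exact mul_le_of_le_one_right (mul_nonneg hθ0 (G.nrm_nonneg _)) (sum_half_pow_succ_le _)
  refine exists_equiv_of_bounds hY A hA (Finsupp.linearCombination ℝ v) (fun a => ?_)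
    (mul_pos (by linarith) (by linarith)) (by positivity) (fun a => ?_) (fun a => ?_)
  · rw [hB]
    exact Y.sum_mem fun k _ => Y.smul_mem _ (hv k)
  · rw [hB]
    have h3 := norm_sub_norm_le (G.emb (∑ k ∈ a.support, a k • u k)) (∑ k ∈ a.support, a k • v k)
    rw [norm_sub_rev, G.norm_emb] at h3
    have h4 := hdiff a
    have h5 := mul_le_mul_of_nonneg_left (h1 a) (show 0 ≤ 1 - θ by linarith)
    linarith
  · rw [hB]
    have h3 := norm_sub_norm_le (∑ k ∈ a.support, a k • v k) (G.emb (∑ k ∈ a.support, a k • u k))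
    rw [G.norm_emb] at h3
    have h4 := hdiff a
    have h5 := mul_le_mul_of_nonneg_left (h2 a) (show 0 ≤ 1 + θ by linarith)
    linarith

/-- The distortion in `IsHump.exists_equiv` tends to one with `θ`. -/
lemma exists_theta {ε : ℝ} (hε : 0 < ε) : ∃ θ : ℝ, 0 < θ ∧ θ ≤ 1 / 8 ∧
    (1 + θ) * (1 + 4 * θ) / ((1 - θ) * (1 - 4 * θ)) ≤ 1 + ε := by
  have hc : ContinuousAt (fun θ : ℝ => (1 + θ) * (1 + 4 * θ) / ((1 - θ) * (1 - 4 * θ))) 0 :=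
    ContinuousAt.div (by fun_prop) (by fun_prop) (by norm_num)
  have h := hc.eventually_lt_const (u := 1 + ε) (by norm_num; exact hε)
  obtain ⟨r, hr, hball⟩ := Metric.eventually_nhds_iff.1 h
  refine ⟨min (r / 2) (1 / 8), by positivity, min_le_right _ _, (hball ?_).le⟩
  rw [Real.dist_eq, sub_zero, abs_of_pos (by positivity)]
  exact (min_le_left _ _).trans_lt (half_lt_self hr)

lemma almostIsometricallySaturated_cZero {G : NormingSet} (hG : G.IsIntervalClosed)
    (hM : ∀ x, c.norming₂ₛ.nrm x ≤ G.nrm x)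
    (hcar : ∀ f ∈ G.carrier, f ∈ 𝓕.F 0 ∨ ∃ (d : ℕ) (a : Fin d → ℝ) (x : Fin d → C00),
      (∀ k, |a k| ≤ 1) ∧ (∀ k, ∃ I, c.HasIndex (x k) I) ∧ (∀ k, ∀ n ∈ (x k).support, d ≤ (n : ℕ)) ∧
        f = ∑ k, a k • x k) :
    IsAlmostIsometricallySaturatedBy G.Completed CZero := by
  intro Y hY hfin ε hε
  obtain ⟨θ, hθ0, hθ, hle⟩ := exists_theta hε
  obtain ⟨u, v, q, hu, hqm, hv, hnrm, hq, hvu, hS, hqS⟩ := exists_glidingHump hG hM hfin hθ0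
    (fun _ x q => ∀ n ∈ x.support, (n : ℕ) ≤ q) (fun _ x p => by
      obtain ⟨N, hN⟩ := exists_support_le x
      exact ⟨max p N, le_max_left _ _, fun n hn => (hN n hn).trans (le_max_right _ _)⟩)
  have h : c.IsHump G θ u q := ⟨hu, hqm, hnrm, hS, hqS⟩
  obtain ⟨V, hV, T, hT⟩ := h.exists_equiv hG toCZero denseRange_toCZero hY hθ hv hvu
    (fun a => by
      have h1 : ‖toCZero a‖ ≤ G.nrm (∑ k ∈ a.support, a k • u k) :=
        (CZero.norm_le (G.nrm_nonneg _)).2 (h.abs_coeff_le hG a)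
      exact (mul_le_of_le_one_left (norm_nonneg _) (by linarith)).trans h1)
    (fun a => (h.nrm_sum_le_of_abs_le hq hcar a (norm_nonneg (toCZero a))
      ((CZero.norm_le (norm_nonneg (toCZero a))).1 le_rfl)).trans (by gcongr; linarith))
  exact ⟨V, hV, T, hT.trans hle⟩

lemma almostIsometricallySaturated_ellTwo : IsAlmostIsometricallySaturatedBy c.JT₂ EllTwo := by
  intro Y hY hfin ε hε
  obtain ⟨θ, hθ0, hθ, hle⟩ := exists_theta hε
  obtain ⟨u, v, q, hu, hqm, hv, hnrm, hq, hvu, hS, hqS⟩ := exists_glidingHump (c := c)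
    isIntervalClosed_norming₂ norming₂ₛ_le_norming₂ hfin hθ0
    (fun k x q => 𝓕.tauTail q * l1 x ≤ θ * (1 / 2) ^ (k + 1))
    (fun k x p => 𝓕.exists_pos_tauTail_mul_le p (l1 x) (by positivity))
  have h : c.IsHump c.norming₂ θ u q := ⟨hu, hqm, hnrm, hS, hqS⟩
  obtain ⟨V, hV, T, hT⟩ := h.exists_equiv isIntervalClosed_norming₂ toEllTwo denseRange_toEllTwo hY
    hθ hv hvu (fun a => by rw [norm_toEllTwo]; exact h.sqrt_le_nrm_sum hθ hq a)
    (fun a => by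
      rw [norm_toEllTwo]
      refine (h.nrm_sum_le_sqrt hq a).trans ?_
      gcongr
      linarith)
  exact ⟨V, hV, T, hT.trans hle⟩

lemma almostIsometricallySaturated_JT₂ₛ : IsAlmostIsometricallySaturatedBy c.JT₂ₛ CZero := by
  refine almostIsometricallySaturated_cZero isIntervalClosed_norming₂ₛ (fun _ => le_rfl) ?_
  rintro f (hf | ⟨d, a, x, ha, ⟨I, hI, -⟩, hd, rfl⟩)
  · exact Or.inl hf
  · exact Or.inr ⟨d, fun k => a k, x, abs_coeff_le_one ha, fun k => ⟨I k, hI k⟩, hd, rfl⟩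

lemma almostIsometricallySaturated_JTₛ : IsAlmostIsometricallySaturatedBy c.JTₛ CZero := by
  refine almostIsometricallySaturated_cZero isIntervalClosed_normingₛ norming₂ₛ_le_normingₛ ?_
  rintro f (hf | ⟨d, ε, x, hε, ⟨I, hI, -⟩, hd, rfl⟩)
  · exact Or.inl hf
  · refine Or.inr ⟨d, ε, x, fun k => ?_, fun k => ⟨I k, hI k⟩, hd, rfl⟩
    rcases hε k with h | h <;> simp [h]

end Coding
end JTGFamily

end

theorem mainTheorem11 (𝓕 : JTGFamily) (c : 𝓕.Coding) :
    (IsSaturatedBy c.JT₂ₛ CZero ∧ IsAlmostIsometricallySaturatedBy c.JT₂ₛ CZero) ∧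
    (IsSaturatedBy c.JT₂ EllTwo ∧ IsAlmostIsometricallySaturatedBy c.JT₂ EllTwo) ∧
    (IsSaturatedBy c.JTₛ CZero ∧ IsAlmostIsometricallySaturatedBy c.JTₛ CZero) :=
  ⟨⟨JTGFamily.Coding.almostIsometricallySaturated_JT₂ₛ.isSaturatedBy,
      JTGFamily.Coding.almostIsometricallySaturated_JT₂ₛ⟩,
    ⟨JTGFamily.Coding.almostIsometricallySaturated_ellTwo.isSaturatedBy,
      JTGFamily.Coding.almostIsometricallySaturated_ellTwo⟩,
    ⟨JTGFamily.Coding.almostIsometricallySaturated_JTₛ.isSaturatedBy,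
      JTGFamily.Coding.almostIsometricallySaturated_JTₛ⟩⟩
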